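/- Let $\sigma\in\mathbb{R}$ (in particular $\sigma=\pm1$). Let $\phi_n(x)=(2^n n!\sqrt{\pi})^{-1/2}H_n(x)e^{-x^2/2}$, $n=0,1,2,\dots$, be the Hermite functions, where $H_n$ are the physicists' Hermite polynomials, and put $K_{n,n_1,n_2,n_3}=(\phi_n,\phi_{n_1}\phi_{n_2}\phi_{n_3})_{L^2(\mathbb{R})}$. For $s\in\mathbb{R}$ let $l^2_s(\mathbb{N})$ be the space of complex sequences $\mathbf{a}=(a_n)_{n\ge0}$ with $\|\mathbf{a}\|_{l^2_s}^2=\sum_{n\ge0}(1+n)^{2s}|a_n|^2<\infty$, and let $\mathcal{H}_1(\mathbb{R})=\{u\in H^1(\mathbb{R}) : xu\in L^2(\mathbb{R})\}$ with $\|u\|_{\mathcal{H}_1}^2=\int_{\mathbb{R}}\left(|u'|^2+(x^2+1)|u|^2\right)dx$ (complex-valued functions). (a) Every $u\in L^2(\mathbb{R})$ has the expansion $u=\sum_n a_n\phi_n$ in $L^2(\mathbb{R})$ with $a_n=(\phi_n,u)$, and $u\in\mathcal{H}_1(\mathbb{R})$ if and only if $\mathbf{a}\in l^2_{1/2}(\mathbb{N})$.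 Every $\mathbf{a}\in l^2_{1/2}(\mathbb{N})$ is the coefficient sequence of some $u\in\mathcal{H}_1(\mathbb{R})$, and $\|u\|_{\mathcal{H}_1}^2=2\|\mathbf{a}\|_{l^2_{1/2}}^2$. (b) The discrete dynamical system $$i\dot a_n=n a_n+\sigma\sum_{(n_1,n_2,n_3)}K_{n,n_1,n_2,n_3}\,a_{n_1}\bar a_{n_2}a_{n_3},\qquad n=0,1,2,\dots,$$ is globally well-posed in $l^2_{1/2}(\mathbb{N})$. That is, for every $\mathbf{a}_0\in l^2_{1/2}(\mathbb{N})$ there is a solution $\mathbf{a}\in C(\mathbb{R},l^2_{1/2}(\mathbb{N}))\cap C^1(\mathbb{R},l^2_{-1/2}(\mathbb{N}))$ with $\mathbf{a}(0)=\mathbf{a}_0$, for which the triple series converges unconditionally for every $n$ and every $t$. On every interval $I\ni 0$ it is the only solution that is continuous with values in $l^2_{1/2}(\mathbb{N})$ and equals $\mathbf{a}_0$ at $t=0$. The map $(t,\mathbf{a}_0)\mapsto\mathbf{a}(t)$ is continuous from $\mathbb{R}\times l^2_{1/2}(\mathbb{N})$ to $l^2_{1/2}(\mathbb{N})$. -/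

import Mathlib

open MeasureTheory Filter Topology Set
open scoped ContDiff

noncomputable section

/-! ### Hermite functions -/

/-- The (physicists') Hermite polynomials `H₀ = 1`, `H₁ = 2x`, `H₂ = 4x² - 2`, `H₃ = 8x³ - 12x`,
and so on, by the recursion `Hₙ₊₁ = 2x Hₙ - Hₙ'`. -/
def physHermite : ℕ → Polynomial ℝ
  | 0 => 1
  | n + 1 => 2 * Polynomial.X * physHermite n - Polynomial.derivative (physHermite n)

/-- The Hermite function `φₙ(x) = (2ⁿ n! √π)^(-1/2) Hₙ(x) exp(-x²/2)`. -/
def hermiteFun (n : ℕ) (x : ℝ) : ℝ :=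
  1 / √(2 ^ n * (n.factorial : ℝ) * √Real.pi) * (physHermite n).eval x * Real.exp (-x ^ 2 / 2)

/-- The Hermite coefficient `(φₙ, u)` of a function `u` (the `φₙ` are real-valued). -/
def hermiteCoeff (u : ℝ → ℂ) (n : ℕ) : ℂ := ∫ x, (hermiteFun n x : ℂ) * u x

/-- `u = ∑ aₙ φₙ`, with convergence in `L²(ℝ)`. -/
def IsHermiteExpansion (a : ℕ → ℂ) (u : ℝ → ℂ) : Prop :=
  Tendsto (fun N : ℕ =>
    eLpNorm (fun x => u x - ∑ n ∈ Finset.range N, a n * (hermiteFun n x : ℂ)) 2 volume)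
    atTop (𝓝 0)

/-- The coefficients `K_{n,n₁,n₂,n₃} = (φₙ, φₙ₁ φₙ₂ φₙ₃)`. -/
def hermiteK (n n₁ n₂ n₃ : ℕ) : ℝ :=
  ∫ x, hermiteFun n x * (hermiteFun n₁ x * hermiteFun n₂ x * hermiteFun n₃ x)

/-! ### The energy space -/

/-- `v` is the weak derivative of `u` on `ℝ`. -/
def IsWeakDeriv (u v : ℝ → ℂ) : Prop :=
  LocallyIntegrable u ∧ LocallyIntegrable v ∧
    ∀ ψ : ℝ → ℝ, ContDiff ℝ ∞ ψ → HasCompactSupport ψ →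
      ∫ x, u x * ((deriv ψ x : ℝ) : ℂ) = -∫ x, v x * (ψ x : ℂ)

/-- Membership in the energy space `{u ∈ H¹(ℝ) : x u ∈ L²(ℝ)}`. -/
def MemEnergySpace (u : ℝ → ℂ) : Prop :=
  MemLp u 2 ∧ (∃ v : ℝ → ℂ, MemLp v 2 ∧ IsWeakDeriv u v) ∧ MemLp (fun x : ℝ => (x : ℂ) * u x) 2

/-! ### The weighted sequence spaces -/

/-- Multiplication of a sequence by the weight `(1 + n)^s`. -/
def weightSeq (s : ℝ) : (ℕ → ℂ) →ₗ[ℂ] (ℕ → ℂ) where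
  toFun a n := (((1 + n : ℝ) ^ s : ℝ) : ℂ) * a n
  map_add' a b := by ext n; simp [mul_add]
  map_smul' c a := by ext n; simp [mul_left_comm]

/-- Membership in `l²_s(ℕ)`: the series `∑ (1 + n)^(2s) |aₙ|²` converges. -/
def MemWeightedL2 (s : ℝ) (a : ℕ → ℂ) : Prop :=
  Summable fun n : ℕ => (1 + n : ℝ) ^ (2 * s) * ‖a n‖ ^ 2

theorem norm_weightSeq_sq (s : ℝ) (a : ℕ → ℂ) (n : ℕ) :
    ‖weightSeq s a n‖ ^ 2 = (1 + n : ℝ) ^ (2 * s) * ‖a n‖ ^ 2 := by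
  have h : (0 : ℝ) ≤ 1 + n := by positivity
  have h2 : (1 + n : ℝ) ^ (2 * s) = ((1 + n : ℝ) ^ s) ^ 2 := by
    rw [mul_comm, Real.rpow_mul h]; norm_cast
  have h3 : ‖weightSeq s a n‖ = (1 + n : ℝ) ^ s * ‖a n‖ := by
    change ‖(((1 + n : ℝ) ^ s : ℝ) : ℂ) * a n‖ = _
    rw [norm_mul, Complex.norm_real, Real.norm_of_nonneg (Real.rpow_nonneg h s)]
  rw [h3, h2, mul_pow]

theorem memWeightedL2_iff (s : ℝ) (a : ℕ → ℂ) :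
    MemWeightedL2 s a ↔ Memℓp (weightSeq s a) 2 := by
  rw [memℓp_gen_iff (by norm_num), MemWeightedL2]
  simp [norm_weightSeq_sq]

/-- `l²_s(ℕ)` as a set of sequences. -/
def weightedL2Submodule (s : ℝ) : Submodule ℂ (ℕ → ℂ) where
  carrier := {a | MemWeightedL2 s a}
  add_mem' {a b} ha hb := by
    have h := ((memWeightedL2_iff s a).1 ha).add ((memWeightedL2_iff s b).1 hb)
    exact (memWeightedL2_iff s (a + b)).2 (by rwa [map_add])
  zero_mem' := by
    exact (memWeightedL2_iff s 0).2 (by rw [map_zero]; exact zero_memℓp)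
  smul_mem' c a ha := by
    have h := ((memWeightedL2_iff s a).1 ha).const_smul c
    exact (memWeightedL2_iff s (c • a)).2 (by rwa [map_smul])

/-- The space `l²_s(ℕ)`; its norm is introduced below. -/
def WeightedL2 (s : ℝ) : Type := weightedL2Submodule s

namespace WeightedL2

variable {s r : ℝ}

instance : AddCommGroup (WeightedL2 s) := inferInstanceAs (AddCommGroup (weightedL2Submodule s))

instance : Module ℂ (WeightedL2 s) := inferInstanceAs (Module ℂ (weightedL2Submodule s))

instance : CoeFun (WeightedL2 s) (fun _ => ℕ → ℂ) := ⟨fun a => a.1⟩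

/-- Multiplication by the weight, as a map into the unweighted `l²(ℕ)`. -/
def toLp (s : ℝ) : WeightedL2 s →ₗ[ℂ] lp (fun _ : ℕ => ℂ) 2 where
  toFun a := ⟨weightSeq s a.1, (memWeightedL2_iff s a.1).1 a.2⟩
  map_add' a b := Subtype.ext ((weightSeq s).map_add a.1 b.1)
  map_smul' c a := Subtype.ext ((weightSeq s).map_smul c a.1)

theorem toLp_injective (s : ℝ) : Function.Injective (toLp s) := by
  intro a b h
  refine Subtype.ext (funext fun n => ?_)
  have h1 : (((1 + n : ℝ) ^ s : ℝ) : ℂ) * a n = (((1 + n : ℝ) ^ s : ℝ) : ℂ) * b n :=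
    congrFun (congrArg Subtype.val h) n
  have h2 : (((1 + n : ℝ) ^ s : ℝ) : ℂ) ≠ 0 :=
    Complex.ofReal_ne_zero.2 (Real.rpow_pos_of_pos (by positivity) s).ne'
  exact mul_left_cancel₀ h2 h1

instance : NormedAddCommGroup (WeightedL2 s) :=
  NormedAddCommGroup.induced (WeightedL2 s) (lp (fun _ : ℕ => ℂ) 2) (toLp s) (toLp_injective s)

instance : NormedSpace ℂ (WeightedL2 s) :=
  NormedSpace.induced ℂ (WeightedL2 s) (lp (fun _ : ℕ => ℂ) 2) (toLp s)

/-- The norm of `l²_s(ℕ)` is given by `‖a‖² = ∑ (1 + n)^(2s) |aₙ|²`. -/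
theorem norm_sq_eq (a : WeightedL2 s) :
    ‖a‖ ^ 2 = ∑' n : ℕ, (1 + n : ℝ) ^ (2 * s) * ‖a n‖ ^ 2 := by
  have h := lp.norm_rpow_eq_tsum (p := 2) (by norm_num) (toLp s a)
  simp only [ENNReal.toReal_ofNat, Real.rpow_ofNat] at h
  exact h.trans (tsum_congr fun n => norm_weightSeq_sq s a.1 n)

/-- The inclusion `l²_s(ℕ) ⊆ l²_r(ℕ)` for `r ≤ s`. -/
def incl (h : r ≤ s) (a : WeightedL2 s) : WeightedL2 r :=
  ⟨a.1, Summable.of_nonneg_of_le (fun n => by positivity)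
    (fun n => mul_le_mul_of_nonneg_right
      (Real.rpow_le_rpow_of_exponent_le (by simp) (by linarith)) (by positivity)) a.2⟩

end WeightedL2

/-! ### The discrete system -/

/-- The curve `t ↦ a(t)`, `t ∈ I`, is continuous in `l²_{1/2}(ℕ)` and solves, for all `n`,
`i ȧₙ = n aₙ + σ ∑_{(n₁,n₂,n₃)} K_{n,n₁,n₂,n₃} aₙ₁ āₙ₂ aₙ₃`
at all times `t ∈ I`; the series has to converge (unconditionally), and the derivative is the
one-sided one at an end point that belongs to `I`. -/
def IsSolutionOn (σ : ℝ) (I : Set ℝ) (a : ℝ → WeightedL2 (1 / 2)) : Prop :=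
  ContinuousOn a I ∧ ∀ t ∈ I, ∀ n : ℕ, ∃ d S : ℂ,
    HasDerivWithinAt (fun τ => a τ n) d I t ∧
    HasSum (fun m : ℕ × ℕ × ℕ =>
      (hermiteK n m.1 m.2.1 m.2.2 : ℂ) * a t m.1 * star (a t m.2.1) * a t m.2.2) S ∧
    Complex.I * d = n * a t n + σ * S

/-- Global well-posedness of the discrete system in `l²_{1/2}(ℕ)`: there is a flow
`Φ t a₀`, `t ∈ ℝ`, jointly continuous in time and initial data, such that for every `a₀` the curve
`t ↦ Φ t a₀` is a solution on `ℝ` with value `a₀` at `t = 0`, is continuously differentiable with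
values in `l²_{-1/2}(ℕ)`, and is the only solution on each interval `I ∋ 0` with this
initial value. -/
def IsGloballyWellPosed (σ : ℝ) : Prop :=
  ∃ Φ : ℝ → WeightedL2 (1 / 2) → WeightedL2 (1 / 2),
    Continuous (fun p : ℝ × WeightedL2 (1 / 2) => Φ p.1 p.2) ∧
    ∀ a₀ : WeightedL2 (1 / 2),
      Φ 0 a₀ = a₀ ∧
      IsSolutionOn σ univ (fun t => Φ t a₀) ∧
      ContDiff ℝ 1 (fun t => WeightedL2.incl (r := -1 / 2) (by norm_num) (Φ t a₀)) ∧
      ∀ (I : Set ℝ) (b : ℝ → WeightedL2 (1 / 2)), I.OrdConnected → (0 : ℝ) ∈ I →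
        IsSolutionOn σ I b → b 0 = a₀ → ∀ t ∈ I, b t = Φ t a₀

end

noncomputable section

/-! Part (a) rests on the ladder operators. Both `x φₙ` and `φₙ'` are combinations of `φₙ₋₁` and
`φₙ₊₁`; adjointness of `x - d/dx` and `x + d/dx` gives orthonormality. For completeness, if `u ∈ L²`
is orthogonal to every `φₙ`, then so are all its moments against `φ₀`, hence the Fourier transform
of `φ₀ u` vanishes and `u = 0` because `φ₀ > 0`. The functions `xu + u'` and `xu - u'` have
coefficients that are weighted shifts of those of `u`, so Parseval and the parallelogram law turn
the energy norm into `2 ∑ (1 + n)|aₙ|²` (`hasSum_energy`). The converse is summation by parts in the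
index (`integral_star_mul_eq_of_ladderCoeff`).

For part (b), the one-dimensional Sobolev inequality makes the energy space stable under cubic
products: `norm_trilinear_le`. The pointwise decay `|φₘ(x)| ≤ 2(1 + |x|)(1 + m)^(-1/4)` makes
Hermite series converge absolutely at each point, which identifies the coefficients of `|u|²u` with
the triple series (`hasSum_hermiteK_mul`). So the system reads `i ȧ = D a + F(a)`, where `D`
multiplies `aₙ` by `n` and `F` is locally Lipschitz on `l²_{1/2}`.

The phases `exp(-int)` are isometries; conjugating by them removes the unbounded `D` and leaves an
ordinary differential equation. With `F` cut off outside a large ball it is globally Lipschitz and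
bounded, and Picard-Lindelöf gives a solution on all of `ℝ`. While the solution stays inside the
ball, the mass `∑ |aₙ|²` and the energy `‖a‖² + (σ/2) ∫ |u|⁴` are conserved. Since `∫ |u|⁴ ≤ 4
mass^(3/2) ‖a‖` is only linear in `‖a‖`, they bound the norm for either sign of `σ`; a connectedness
argument shows that the cutoff is never active. Uniqueness and continuous dependence follow from
Grönwall's inequality. -/

/-! ### Ladder relations for the Hermite functions -/

theorem derivative_physHermite_succ (n : ℕ) :
    Polynomial.derivative (physHermite (n + 1)) = 2 * ((n : Polynomial ℝ) + 1) * physHermite n := by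
  induction n with
  | zero => simp [physHermite]
  | succ n ih =>
    rw [physHermite, Polynomial.derivative_sub, Polynomial.derivative_mul, ih]
    conv_rhs => rw [physHermite]
    simp only [Polynomial.derivative_mul, Polynomial.derivative_X, Polynomial.derivative_add,
      Polynomial.derivative_one, Polynomial.derivative_natCast, Polynomial.derivative_ofNat]
    conv_lhs => rw [physHermite]
    push_cast
    ring

theorem hermite_norm_const_succ (n : ℕ) :
    1 / √(2 ^ (n + 1) * ((n + 1).factorial : ℝ) * √Real.pi) * √(2 * (n + 1)) =
      1 / √(2 ^ n * (n.factorial : ℝ) * √Real.pi) := by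
  have h : (2 : ℝ) ^ (n + 1) * ((n + 1).factorial : ℝ) * √Real.pi =
      (2 ^ n * (n.factorial : ℝ) * √Real.pi) * (2 * (n + 1)) := by
    rw [Nat.factorial_succ]; push_cast; ring
  rw [h, Real.sqrt_mul (by positivity)]
  have h1 : √(2 * ((n : ℝ) + 1)) ≠ 0 := by positivity
  have h2 : √(2 ^ n * (n.factorial : ℝ) * √Real.pi) ≠ 0 := by positivity
  field_simp

/-- The derivative of the Hermite function `φₙ`. -/
def hermiteFunDeriv (n : ℕ) (x : ℝ) : ℝ := x * hermiteFun n x - √(2 * (n + 1)) * hermiteFun (n + 1) x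

theorem hasDerivAt_hermiteFun (n : ℕ) (x : ℝ) :
    HasDerivAt (hermiteFun n) (hermiteFunDeriv n x) x := by
  have h1 : HasDerivAt (fun x : ℝ => Real.exp (-x ^ 2 / 2)) (Real.exp (-x ^ 2 / 2) * (-x)) x := by
    have : HasDerivAt (fun x : ℝ => -x ^ 2 / 2) (-x) x := by
      exact (((hasDerivAt_pow 2 x).neg).div_const 2).congr_deriv (by push_cast; ring)
    exact this.exp
  have h := (((physHermite n).hasDerivAt x).const_mul
    (1 / √(2 ^ n * (n.factorial : ℝ) * √Real.pi))).mul h1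
  refine HasDerivAt.congr_deriv (f := hermiteFun n) h ?_
  rw [hermiteFunDeriv, hermiteFun, hermiteFun, ← hermite_norm_const_succ n, physHermite]
  have h2 : √(2 * ((n : ℝ) + 1)) ≠ 0 := by positivity
  simp
  ring

/-- This is the lowering operator `d/dx + x`. For `n = 0` natural subtraction turns the index `n -
1` into `0`, which is harmless because the factor `√(2 * 0)` vanishes; all later ladder formulas use
the same convention. -/
theorem hermiteFunDeriv_add (n : ℕ) (x : ℝ) :
    hermiteFunDeriv n x + x * hermiteFun n x = √(2 * n) * hermiteFun (n - 1) x := by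
  cases n with
  | zero => simp [hermiteFunDeriv, hermiteFun, physHermite]; field_simp; ring
  | succ n =>
    have h := hermite_norm_const_succ (n + 1)
    have h3 := hermite_norm_const_succ n
    have h4 : (physHermite (n + 1 + 1)).eval x = 2 * x * (physHermite (n + 1)).eval x -
        2 * (n + 1) * (physHermite n).eval x := by
      rw [physHermite, derivative_physHermite_succ]; simp
    simp only [Nat.add_sub_cancel]
    rw [hermiteFunDeriv, hermiteFun, hermiteFun, hermiteFun, h4, ← h3, ← h]
    have h1 : √(2 * ((n : ℝ) + 1)) * √(2 * ((n : ℝ) + 1)) = 2 * (n + 1) :=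
      Real.mul_self_sqrt (by positivity)
    push_cast
    linear_combination (-(1 / √(2 ^ (n + 1 + 1) * ((n + 1 + 1).factorial : ℝ) * √Real.pi) *
      √(2 * ((n : ℝ) + 1 + 1)) * (physHermite n).eval x * Real.exp (-x ^ 2 / 2))) * h1

theorem mul_hermiteFun (n : ℕ) (x : ℝ) : x * hermiteFun n x =
    √(n / 2) * hermiteFun (n - 1) x + √((n + 1) / 2) * hermiteFun (n + 1) x := by
  have h := hermiteFunDeriv_add n x
  rw [hermiteFunDeriv] at h
  have h1 : √(2 * (n : ℝ)) = 2 * √(n / 2) := by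
    rw [show (2 * n : ℝ) = 2 ^ 2 * (n / 2) by ring, Real.sqrt_mul (by positivity)]; simp
  have h2 : √(2 * ((n : ℝ) + 1)) = 2 * √((n + 1) / 2) := by
    rw [show (2 * (n + 1) : ℝ) = 2 ^ 2 * ((n + 1) / 2) by ring, Real.sqrt_mul (by positivity)]; simp
  rw [h1, h2] at h
  linarith

theorem hermiteFunDeriv_eq (n : ℕ) (x : ℝ) : hermiteFunDeriv n x =
    √(n / 2) * hermiteFun (n - 1) x - √((n + 1) / 2) * hermiteFun (n + 1) x := by
  have h2 : √(2 * ((n : ℝ) + 1)) = 2 * √((n + 1) / 2) := by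
    rw [show (2 * (n + 1) : ℝ) = 2 ^ 2 * ((n + 1) / 2) by ring, Real.sqrt_mul (by positivity)]; simp
  rw [hermiteFunDeriv, mul_hermiteFun, h2]; ring

/-! ### Gaussian decay -/

theorem one_add_abs_pow_mul_exp_le (j : ℕ) (x : ℝ) :
    (1 + |x|) ^ j * Real.exp (-x ^ 2 / 2) ≤ Real.exp (j ^ 2) * Real.exp (-(1 / 4) * x ^ 2) := by
  have h1 : 1 + |x| ≤ Real.exp |x| := by linarith [Real.add_one_le_exp |x|]
  calc (1 + |x|) ^ j * Real.exp (-x ^ 2 / 2) ≤ Real.exp |x| ^ j * Real.exp (-x ^ 2 / 2) := by gcongr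
    _ = Real.exp (j * |x| + (-x ^ 2 / 2)) := by rw [Real.exp_add, Real.exp_nat_mul]
    _ ≤ Real.exp (j ^ 2 + (-(1 / 4) * x ^ 2)) := by
      apply Real.exp_le_exp.2
      -- Completing the square: `j|x| - x²/4 ≤ j²`.
      nlinarith [sq_nonneg (|x| / 2 - j), sq_abs x]
    _ = _ := Real.exp_add _ _

theorem exists_abs_eval_le (p : Polynomial ℝ) :
    ∃ (C : ℝ) (d : ℕ), 0 ≤ C ∧ ∀ x, |p.eval x| ≤ C * (1 + |x|) ^ d := by
  induction p using Polynomial.induction_on' with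
  | add p q hp hq =>
    obtain ⟨C, d, hC, h⟩ := hp
    obtain ⟨C', d', hC', h'⟩ := hq
    refine ⟨C + C', d + d', by positivity, fun x => ?_⟩
    have h1 : 1 ≤ 1 + |x| := by simp
    rw [Polynomial.eval_add, add_mul]
    refine (abs_add_le _ _).trans (add_le_add ((h x).trans ?_) ((h' x).trans ?_))
    · gcongr; omega
    · gcongr; omega
  | monomial n a =>
    refine ⟨|a|, n, abs_nonneg _, fun x => ?_⟩
    rw [Polynomial.eval_monomial, abs_mul, abs_pow]
    gcongr; linarith

theorem exists_hermiteFun_decay (n k : ℕ) :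
    ∃ C, 0 ≤ C ∧ ∀ x, (1 + |x|) ^ k * |hermiteFun n x| ≤ C * Real.exp (-(1 / 4) * x ^ 2) := by
  obtain ⟨C, d, hC, h⟩ := exists_abs_eval_le (physHermite n)
  set c := 1 / √(2 ^ n * (n.factorial : ℝ) * √Real.pi) with hc
  have hc0 : 0 ≤ c := by positivity
  refine ⟨c * C * Real.exp ((k + d : ℕ) ^ 2), by positivity, fun x => ?_⟩
  rw [hermiteFun, ← hc, abs_mul, abs_mul, abs_of_nonneg hc0, Real.abs_exp]
  calc (1 + |x|) ^ k * (c * |(physHermite n).eval x| * Real.exp (-x ^ 2 / 2))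
      ≤ (1 + |x|) ^ k * (c * (C * (1 + |x|) ^ d) * Real.exp (-x ^ 2 / 2)) := by gcongr; exact h x
    _ = c * C * ((1 + |x|) ^ (k + d) * Real.exp (-x ^ 2 / 2)) := by ring
    _ ≤ c * C * (Real.exp ((k + d : ℕ) ^ 2) * Real.exp (-(1 / 4) * x ^ 2)) := by
      exact mul_le_mul_of_nonneg_left (one_add_abs_pow_mul_exp_le _ _) (by positivity)
    _ = _ := by ring

theorem continuous_hermiteFun (n : ℕ) : Continuous (hermiteFun n) :=
  continuous_iff_continuousAt.2 fun x => (hasDerivAt_hermiteFun n x).continuousAt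

theorem integrable_pow_mul_hermiteFun (n k : ℕ) :
    Integrable fun x => (1 + |x|) ^ k * |hermiteFun n x| := by
  obtain ⟨C, hC, h⟩ := exists_hermiteFun_decay n k
  refine ((integrable_exp_neg_mul_sq (b := 1 / 4) (by norm_num)).const_mul C).mono'
    (by have := continuous_hermiteFun n; fun_prop) (Eventually.of_forall fun x => ?_)
  rw [Real.norm_of_nonneg (by positivity)]
  exact h x

theorem exists_abs_hermiteFun_le (n : ℕ) : ∃ C, 0 ≤ C ∧ ∀ x, |hermiteFun n x| ≤ C := by
  obtain ⟨C, hC, h⟩ := exists_hermiteFun_decay n 0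
  refine ⟨C, hC, fun x => ?_⟩
  have := h x
  rw [pow_zero, one_mul] at this
  refine this.trans (mul_le_of_le_one_right hC (Real.exp_le_one_iff.2 ?_))
  nlinarith [sq_nonneg x]

theorem memLp_hermiteFun_real (n : ℕ) : MemLp (hermiteFun n) 2 := by
  obtain ⟨C, hC, h⟩ := exists_abs_hermiteFun_le n
  refine (memLp_two_iff_integrable_sq (continuous_hermiteFun n).aestronglyMeasurable).2 ?_
  refine ((integrable_pow_mul_hermiteFun n 0).const_mul C).mono'
    (by have := continuous_hermiteFun n; fun_prop) (Eventually.of_forall fun x => ?_)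
  rw [Real.norm_of_nonneg (by positivity), ← sq_abs, sq, pow_zero, one_mul]
  gcongr; exact h x

theorem memLp_hermiteFun (n : ℕ) : MemLp (fun x => (hermiteFun n x : ℂ)) 2 :=
  (memLp_hermiteFun_real n).ofReal

theorem memLp_hermiteFunDeriv_real (n : ℕ) : MemLp (hermiteFunDeriv n) 2 := by
  have h : hermiteFunDeriv n = fun x =>
    √(n / 2) * hermiteFun (n - 1) x - √((n + 1) / 2) * hermiteFun (n + 1) x :=
    funext (hermiteFunDeriv_eq n)
  rw [h]
  exact ((memLp_hermiteFun_real _).const_mul _).sub ((memLp_hermiteFun_real _).const_mul _)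

theorem memLp_mul_hermiteFun_real (n : ℕ) : MemLp (fun x => x * hermiteFun n x) 2 := by
  have h : (fun x => x * hermiteFun n x) = fun x =>
    √(n / 2) * hermiteFun (n - 1) x + √((n + 1) / 2) * hermiteFun (n + 1) x :=
    funext (mul_hermiteFun n)
  rw [h]
  exact ((memLp_hermiteFun_real _).const_mul _).add ((memLp_hermiteFun_real _).const_mul _)

/-! ### Orthonormality -/

theorem integral_hermiteFun_mul_deriv (n m : ℕ) :
    ∫ x, hermiteFun n x * hermiteFunDeriv m x = -∫ x, hermiteFunDeriv n x * hermiteFun m x := by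
  have h1 := (memLp_hermiteFun_real n).integrable_mul (memLp_hermiteFunDeriv_real m)
  have h2 := (memLp_hermiteFunDeriv_real n).integrable_mul (memLp_hermiteFun_real m)
  have h3 := (memLp_hermiteFun_real n).integrable_mul (memLp_hermiteFun_real m)
  have h := integral_eq_zero_of_hasDerivAt_of_integrable
    (fun x => (hasDerivAt_hermiteFun n x).mul (hasDerivAt_hermiteFun m x)) (h2.add h1) h3
  have h' := integral_add h2 h1
  simp only [Pi.mul_apply] at h'
  linarith

/-- The raising operator `x - d/dx` acting on `φₙ` is moved to the other factor, where it becomes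
the lowering operator `x + d/dx`. Orthonormality then follows by induction on the first index. -/
theorem integral_hermiteFun_succ_mul (n m : ℕ) :
    √(2 * (n + 1)) * ∫ x, hermiteFun (n + 1) x * hermiteFun m x =
      √(2 * m) * ∫ x, hermiteFun n x * hermiteFun (m - 1) x := by
  have h1 := (memLp_hermiteFun_real n).integrable_mul (memLp_hermiteFunDeriv_real m)
  have h2 := (memLp_hermiteFunDeriv_real n).integrable_mul (memLp_hermiteFun_real m)
  have h3 := (memLp_hermiteFun_real n).integrable_mul (memLp_mul_hermiteFun_real m)
  rw [← integral_const_mul, ← integral_const_mul]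
  have e1 : ∀ x, √(2 * (n + 1)) * (hermiteFun (n + 1) x * hermiteFun m x) =
      hermiteFun n x * (x * hermiteFun m x) - hermiteFunDeriv n x * hermiteFun m x := fun x => by
    rw [hermiteFunDeriv]; ring
  have e2 : ∀ x, √(2 * m) * (hermiteFun n x * hermiteFun (m - 1) x) =
      hermiteFun n x * (x * hermiteFun m x) + hermiteFun n x * hermiteFunDeriv m x := fun x => by
    linear_combination (- hermiteFun n x) * hermiteFunDeriv_add m x
  simp_rw [e1, e2]
  have h := integral_hermiteFun_mul_deriv n m
  have h4 := integral_sub h3 h2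
  have h5 := integral_add h3 h1
  simp only [Pi.mul_apply] at h4 h5
  rw [h4, h5, h]; ring

theorem integral_hermiteFun_zero_sq : ∫ x, hermiteFun 0 x * hermiteFun 0 x = 1 := by
  have h : ∀ x, hermiteFun 0 x * hermiteFun 0 x = 1 / √Real.pi * Real.exp (-1 * x ^ 2) := fun x => by
    have h1 : √√Real.pi * √√Real.pi = √Real.pi := Real.mul_self_sqrt (by positivity)
    have h2 : Real.exp (-x ^ 2 / 2) * Real.exp (-x ^ 2 / 2) = Real.exp (-1 * x ^ 2) := by
      rw [← Real.exp_add]; ring_nf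
    simp only [hermiteFun, physHermite, ← h2]
    simp
    rw [← h1]
    field_simp
    simp
  simp_rw [h, integral_const_mul, integral_gaussian]
  have : √Real.pi ≠ 0 := by positivity
  simp [this]

theorem integral_hermiteFun_mul (n m : ℕ) :
    ∫ x, hermiteFun n x * hermiteFun m x = if n = m then 1 else 0 := by
  induction n generalizing m with
  | zero =>
    cases m with
    | zero => simpa using integral_hermiteFun_zero_sq
    | succ m =>
      have h := integral_hermiteFun_succ_mul m 0
      have h2 : √(2 * ((m : ℝ) + 1)) ≠ 0 := by positivity
      simp only [CharP.cast_eq_zero, mul_zero, Real.sqrt_zero, zero_mul, mul_eq_zero, h2,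
        false_or] at h
      simp only [(Nat.succ_ne_zero m).symm, if_false]
      rw [← h]; simp_rw [mul_comm]
  | succ n ih =>
    have h := integral_hermiteFun_succ_mul n m
    have h2 : √(2 * ((n : ℝ) + 1)) ≠ 0 := by positivity
    rw [ih] at h
    refine mul_left_cancel₀ h2 (h.trans ?_)
    cases m with
    | zero => simp
    | succ m =>
      by_cases hnm : n = m
      · subst hnm; simp
      · simp [hnm]

/-! ### A Sobolev inequality and pointwise decay in the index -/

theorem integral_norm_mul_norm_le {E F : Type*} [NormedAddCommGroup E] [NormedAddCommGroup F]
    {u : ℝ → E} {v : ℝ → F} (hu : MemLp u 2) (hv : MemLp v 2) :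
    ∫ x, ‖u x‖ * ‖v x‖ ≤ √(∫ x, ‖u x‖ ^ 2) * √(∫ x, ‖v x‖ ^ 2) := by
  have h := integral_mul_le_Lp_mul_Lq_of_nonneg (μ := volume) (p := 2) (q := 2)
    (Real.HolderConjugate.two_two) (f := fun x => ‖u x‖) (g := fun x => ‖v x‖)
    (Eventually.of_forall fun x => norm_nonneg _) (Eventually.of_forall fun x => norm_nonneg _)
    (by simpa using hu.norm) (by simpa using hv.norm)
  simpa [Real.sqrt_eq_rpow] using h

/-- Integrate `(‖u‖²)' = 2⟨u, v⟩` from `-∞` to `x` and apply Cauchy-Schwarz; the boundary value at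
`-∞` is zero because `‖u‖²` and its derivative are both integrable. -/
theorem norm_sq_le_of_hasDerivAt {F : Type*} [NormedAddCommGroup F] [InnerProductSpace ℝ F]
    {u v : ℝ → F} (h : ∀ x, HasDerivAt u (v x) x) (hu : MemLp u 2) (hv : MemLp v 2) (x : ℝ) :
    ‖u x‖ ^ 2 ≤ 2 * (√(∫ x, ‖u x‖ ^ 2) * √(∫ x, ‖v x‖ ^ 2)) := by
  have hd : ∀ x, HasDerivAt (fun x => ‖u x‖ ^ 2) (2 * inner ℝ (u x) (v x)) x :=
    fun x => (h x).norm_sq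
  have hi : Integrable fun x => ‖u x‖ * ‖v x‖ := hu.norm.integrable_mul hv.norm
  have hle : ∀ x, ‖2 * inner ℝ (u x) (v x)‖ ≤ 2 * (‖u x‖ * ‖v x‖) := fun x => by
    rw [norm_mul, Real.norm_two]
    gcongr
    exact norm_inner_le_norm _ _
  have hi' : Integrable fun x => 2 * inner ℝ (u x) (v x) :=
    (hi.const_mul 2).mono' ((hu.1.inner hv.1).const_mul 2) (Eventually.of_forall hle)
  have hsq : Integrable fun x => ‖u x‖ ^ 2 := hu.integrable_norm_pow (by norm_num)
  have ht := tendsto_zero_of_hasDerivAt_of_integrableOn_Iic (a := x) (fun y _ => hd y)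
    hi'.integrableOn hsq.integrableOn
  have hI := integral_Iic_of_hasDerivAt_of_tendsto' (a := x) (fun y _ => hd y)
    hi'.integrableOn ht
  rw [sub_zero] at hI
  rw [← hI]
  calc ∫ y in Iic x, 2 * inner ℝ (u y) (v y) ≤ ∫ y in Iic x, 2 * (‖u y‖ * ‖v y‖) :=
        integral_mono hi'.integrableOn (hi.const_mul 2).integrableOn
          fun y => (le_abs_self _).trans (hle y)
    _ ≤ ∫ y, 2 * (‖u y‖ * ‖v y‖) :=
        setIntegral_le_integral (hi.const_mul 2) (Eventually.of_forall fun y => by positivity)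
    _ = 2 * ∫ y, ‖u y‖ * ‖v y‖ := integral_const_mul _ _
    _ ≤ _ := by gcongr; exact integral_norm_mul_norm_le hu hv

theorem integral_hermiteFunDeriv_sq (m : ℕ) :
    ∫ x, hermiteFunDeriv m x ^ 2 = (2 * m + 1) / 2 := by
  have h : ∀ x, hermiteFunDeriv m x ^ 2 =
      m / 2 * (hermiteFun (m - 1) x * hermiteFun (m - 1) x) -
      2 * √(m / 2) * √((m + 1) / 2) * (hermiteFun (m - 1) x * hermiteFun (m + 1) x) +
      (m + 1) / 2 * (hermiteFun (m + 1) x * hermiteFun (m + 1) x) := fun x => by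
    have h1 : √((m : ℝ) / 2) ^ 2 = m / 2 := Real.sq_sqrt (by positivity)
    have h2 : √(((m : ℝ) + 1) / 2) ^ 2 = (m + 1) / 2 := Real.sq_sqrt (by positivity)
    rw [hermiteFunDeriv_eq]
    linear_combination h1 * hermiteFun (m - 1) x ^ 2 + h2 * hermiteFun (m + 1) x ^ 2
  have hi : ∀ i j, Integrable fun x => hermiteFun i x * hermiteFun j x :=
    fun i j => (memLp_hermiteFun_real i).integrable_mul (memLp_hermiteFun_real j)
  simp_rw [h]
  have hs : ∀ a b : ℝ, Integrable fun x => a * (hermiteFun (m - 1) x * hermiteFun (m - 1) x) -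
      b * (hermiteFun (m - 1) x * hermiteFun (m + 1) x) :=
    fun a b => ((hi _ _).const_mul _).sub ((hi _ _).const_mul _)
  rw [integral_add (hs _ _) ((hi _ _).const_mul _),
    integral_sub ((hi _ _).const_mul _) ((hi _ _).const_mul _), integral_const_mul,
    integral_const_mul, integral_const_mul]
  simp only [integral_hermiteFun_mul]
  rw [if_neg (by omega : m - 1 ≠ m + 1)]
  simp
  ring

/-- A crude bound that grows with `m`; it serves only to absorb the term `x² φₘ²` in the sharper
estimate `hermiteFun_sq_le`. -/
theorem hermiteFun_sq_le_sqrt (m : ℕ) (x : ℝ) : hermiteFun m x ^ 2 ≤ 2 * √(m + 1) := by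
  have h := norm_sq_le_of_hasDerivAt (hasDerivAt_hermiteFun m) (memLp_hermiteFun_real m)
    (memLp_hermiteFunDeriv_real m) x
  simp only [Real.norm_eq_abs, sq_abs, integral_hermiteFunDeriv_sq] at h
  have h1 : ∫ x, hermiteFun m x ^ 2 = 1 := by
    simpa [sq] using integral_hermiteFun_mul m m
  rw [h1, Real.sqrt_one, one_mul] at h
  refine h.trans ?_
  gcongr
  linarith

theorem hasDerivAt_hermiteFunDeriv (n : ℕ) (x : ℝ) :
    HasDerivAt (hermiteFunDeriv n) ((x ^ 2 - (2 * n + 1)) * hermiteFun n x) x := by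
  have h := ((hasDerivAt_id x).mul (hasDerivAt_hermiteFun n x)).sub
    ((hasDerivAt_hermiteFun (n + 1) x).const_mul (√(2 * (n + 1))))
  refine HasDerivAt.congr_deriv (f := hermiteFunDeriv n) h ?_
  have h1 := hermiteFunDeriv_add (n + 1) x
  have h2 : √(2 * ((n : ℝ) + 1)) * √(2 * ((n : ℝ) + 1)) = 2 * (n + 1) :=
    Real.mul_self_sqrt (by positivity)
  rw [Nat.add_sub_cancel] at h1
  push_cast at h1
  have h3 := hermiteFunDeriv.eq_1 n x
  simp only [id]
  linear_combination (-√(2 * ((n : ℝ) + 1))) * h1 - hermiteFun n x * h2 + x * h3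

/-- By the equation `φ'' = (x² - (2n + 1)) φ`, the left side has derivative `-2x φ²`, so it
increases up to `x = 0` and decreases afterwards. -/
theorem hermiteFun_energy_le (n : ℕ) (x : ℝ) :
    hermiteFunDeriv n x ^ 2 + ((2 * n + 1) - x ^ 2) * hermiteFun n x ^ 2 ≤
      hermiteFunDeriv n 0 ^ 2 + (2 * n + 1) * hermiteFun n 0 ^ 2 := by
  set F : ℝ → ℝ := fun x => hermiteFunDeriv n x ^ 2 + ((2 * n + 1) - x ^ 2) * hermiteFun n x ^ 2
    with hF
  have hd : ∀ x, HasDerivAt F (-2 * x * hermiteFun n x ^ 2) x := fun x => by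
    have h := ((hasDerivAt_hermiteFunDeriv n x).pow 2).add
      ((((hasDerivAt_id x).pow 2).const_sub (2 * (n : ℝ) + 1)).mul
        ((hasDerivAt_hermiteFun n x).pow 2))
    refine HasDerivAt.congr_deriv (f := F) h ?_
    simp
    ring
  have hc : Continuous F := continuous_iff_continuousAt.2 fun x => (hd x).continuousAt
  have h0 : F 0 = hermiteFunDeriv n 0 ^ 2 + (2 * n + 1) * hermiteFun n 0 ^ 2 := by simp [hF]
  rw [← h0]
  change F x ≤ F 0
  rcases le_total 0 x with hx | hx
  · refine antitoneOn_of_deriv_nonpos (convex_Ici 0) hc.continuousOn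
      (fun y _ => (hd y).differentiableAt.differentiableWithinAt) (fun y hy => ?_)
      self_mem_Ici hx hx
    rw [interior_Ici] at hy
    rw [(hd y).deriv]
    have : 0 < y := hy
    nlinarith [mul_nonneg this.le (sq_nonneg (hermiteFun n y))]
  · refine monotoneOn_of_deriv_nonneg (convex_Iic 0) hc.continuousOn
      (fun y _ => (hd y).differentiableAt.differentiableWithinAt) (fun y hy => ?_)
      hx self_mem_Iic hx
    rw [interior_Iic] at hy
    rw [(hd y).deriv]
    have : y < 0 := hy
    nlinarith [mul_nonneg (neg_pos.2 this).le (sq_nonneg (hermiteFun n y))]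

/-- At `x = 0` the three-term recurrence reduces to `(m + 2) φₘ₊₂(0)² = (m + 1) φₘ(0)²`, and `√((m +
3)(m + 1)) ≤ m + 2` closes a two-step induction. -/
theorem sqrt_mul_hermiteFun_zero_sq_le (m : ℕ) : √(m + 1) * hermiteFun m 0 ^ 2 ≤ 1 := by
  induction m using Nat.twoStepInduction with
  | zero =>
    simp only [hermiteFun, physHermite]
    have h1 : √√Real.pi ^ 2 = √Real.pi := Real.sq_sqrt (by positivity)
    have h2 : 1 ≤ √Real.pi := by rw [Real.one_le_sqrt]; linarith [Real.pi_gt_three]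
    simp [h1]
    exact inv_le_one_of_one_le₀ h2
  | one => simp [hermiteFun, physHermite]
  | more m ih _ =>
    have h := mul_hermiteFun (m + 1) 0
    simp only [zero_mul, Nat.add_sub_cancel] at h
    push_cast at h ⊢
    have h1 : √(((m : ℝ) + 1) / 2) ^ 2 = (m + 1) / 2 := Real.sq_sqrt (by positivity)
    have h2 : √(((m : ℝ) + 1 + 1) / 2) ^ 2 = (m + 1 + 1) / 2 := Real.sq_sqrt (by positivity)
    have h3 : ((m : ℝ) + 2) * hermiteFun (m + 2) 0 ^ 2 = (m + 1) * hermiteFun m 0 ^ 2 := by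
      have h4 : (√(((m : ℝ) + 1) / 2) * hermiteFun m 0) ^ 2 =
          (√(((m : ℝ) + 1 + 1) / 2) * hermiteFun (m + 1 + 1) 0) ^ 2 := by
        rw [eq_neg_of_add_eq_zero_left h.symm, neg_sq]
      rw [mul_pow, mul_pow, h1, h2] at h4
      linarith
    have h5 : √((m : ℝ) + 2 + 1) * √((m : ℝ) + 1) ≤ m + 2 := by
      rw [← Real.sqrt_mul (by positivity)]
      exact Real.sqrt_le_iff.2 ⟨by positivity, by nlinarith⟩
    have h6 : √((m : ℝ) + 1) ^ 2 = m + 1 := Real.sq_sqrt (by positivity)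
    refine le_trans ?_ ih
    have h7 : (0 : ℝ) < m + 2 := by positivity
    refine le_of_mul_le_mul_left ?_ h7
    calc ((m : ℝ) + 2) * (√((m : ℝ) + 2 + 1) * hermiteFun (m + 2) 0 ^ 2)
        = √((m : ℝ) + 2 + 1) * ((m + 2) * hermiteFun (m + 2) 0 ^ 2) := by ring
      _ = (√((m : ℝ) + 2 + 1) * √((m : ℝ) + 1)) * (√((m : ℝ) + 1) * hermiteFun m 0 ^ 2) := by
        rw [h3]; linear_combination (-√((m : ℝ) + 2 + 1) * hermiteFun m 0 ^ 2) * h6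
      _ ≤ _ := by gcongr

theorem hermiteFun_energy_zero_le (m : ℕ) :
    hermiteFunDeriv m 0 ^ 2 + (2 * m + 1) * hermiteFun m 0 ^ 2 ≤ 4 * √(m + 1) := by
  have h1 := sqrt_mul_hermiteFun_zero_sq_le m
  have hs : √((m : ℝ) + 1) ^ 2 = m + 1 := Real.sq_sqrt (by positivity)
  have hs0 : 0 < √((m : ℝ) + 1) := by positivity
  have h2 : (2 * m + 1) * hermiteFun m 0 ^ 2 ≤ 2 * √(m + 1) := by
    calc (2 * m + 1) * hermiteFun m 0 ^ 2 ≤ (2 * (m + 1)) * hermiteFun m 0 ^ 2 := by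
          gcongr; linarith
      _ = 2 * √(m + 1) * (√(m + 1) * hermiteFun m 0 ^ 2) := by
          linear_combination (-2 * hermiteFun m 0 ^ 2) * hs
      _ ≤ _ := mul_le_of_le_one_right (by positivity) h1
  have h3 : hermiteFunDeriv m 0 ^ 2 ≤ 2 * √(m + 1) := by
    have h := hermiteFunDeriv_add m 0
    rw [zero_mul, add_zero] at h
    rw [h, mul_pow, Real.sq_sqrt (by positivity)]
    cases m with
    | zero => simp
    | succ k =>
      have h1 := sqrt_mul_hermiteFun_zero_sq_le k
      have hk : √((k : ℝ) + 1) ^ 2 = k + 1 := Real.sq_sqrt (by positivity)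
      push_cast
      calc 2 * ((k : ℝ) + 1) * hermiteFun k 0 ^ 2
          = 2 * √(k + 1) * (√(k + 1) * hermiteFun k 0 ^ 2) := by
            linear_combination (-2 * hermiteFun k 0 ^ 2) * hk
        _ ≤ 2 * √(k + 1) := mul_le_of_le_one_right (by positivity) h1
        _ ≤ _ := by gcongr; linarith
  linarith

/-- The energy function gives `(2m + 1) φₘ² ≤ 4√(m + 1) + x² φₘ²`, and the crude bound controls the
last term. Decay in `m` is obtained at the price of growth in `x`, which a fixed Hermite function
can absorb. -/
theorem hermiteFun_sq_le (m : ℕ) (x : ℝ) :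
    √(m + 1) * hermiteFun m x ^ 2 ≤ (2 * (1 + |x|)) ^ 2 := by
  have h1 := hermiteFun_energy_le m x
  have h2 := hermiteFun_energy_zero_le m
  have h3 := hermiteFun_sq_le_sqrt m x
  have hs : √((m : ℝ) + 1) ^ 2 = m + 1 := Real.sq_sqrt (by positivity)
  have hs0 : 0 < √((m : ℝ) + 1) := by positivity
  have h4 : ((m : ℝ) + 1) * hermiteFun m x ^ 2 ≤ 4 * √(m + 1) * (1 + x ^ 2) := by
    have : (m : ℝ) * hermiteFun m x ^ 2 ≥ 0 := by positivity
    nlinarith [sq_nonneg (hermiteFunDeriv m x), mul_le_mul_of_nonneg_left h3 (sq_nonneg x),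
      mul_nonneg hs0.le (sq_nonneg x)]
  refine le_of_mul_le_mul_left ?_ hs0
  calc √((m : ℝ) + 1) * (√(m + 1) * hermiteFun m x ^ 2) = (m + 1) * hermiteFun m x ^ 2 := by
        linear_combination hermiteFun m x ^ 2 * hs
    _ ≤ 4 * √(m + 1) * (1 + x ^ 2) := h4
    _ ≤ _ := by
      rw [← sq_abs x]
      nlinarith [mul_nonneg hs0.le (abs_nonneg x)]

theorem abs_hermiteFun_le (m : ℕ) (x : ℝ) :
    |hermiteFun m x| ≤ 2 * (1 + |x|) * (1 + m : ℝ) ^ (-(1 / 4) : ℝ) := by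
  have h := hermiteFun_sq_le m x
  have hm : (0 : ℝ) < 1 + m := by positivity
  have h1 : ((1 + m : ℝ) ^ (-(1 / 4) : ℝ)) ^ 2 * √(m + 1) = 1 := by
    rw [Real.sqrt_eq_rpow, add_comm (m : ℝ) 1, ← Real.rpow_natCast, ← Real.rpow_mul hm.le,
      ← Real.rpow_add hm]
    norm_num
  refine abs_le_of_sq_le_sq ?_ (by positivity)
  rw [mul_pow]
  calc hermiteFun m x ^ 2 = ((1 + m : ℝ) ^ (-(1 / 4) : ℝ)) ^ 2 * (√(m + 1) * hermiteFun m x ^ 2) := by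
        rw [← mul_assoc, h1, one_mul]
    _ ≤ ((1 + m : ℝ) ^ (-(1 / 4) : ℝ)) ^ 2 * (2 * (1 + |x|)) ^ 2 := by gcongr
    _ = _ := by ring

/-! ### Completeness of the Hermite functions -/

theorem integrable_hermiteFun_mul {u : ℝ → ℂ} (hu : MemLp u 2) (n : ℕ) :
    Integrable fun x => (hermiteFun n x : ℂ) * u x :=
  (memLp_hermiteFun n).integrable_mul hu

theorem memLp_pow_mul_hermiteFun (k n : ℕ) :
    MemLp (fun x : ℝ => (x : ℂ) ^ k * (hermiteFun n x : ℂ)) 2 := by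
  induction k generalizing n with
  | zero => simpa using memLp_hermiteFun n
  | succ k ih =>
    have h : (fun x : ℝ => (x : ℂ) ^ (k + 1) * (hermiteFun n x : ℂ)) = fun x : ℝ =>
        (√(n / 2) : ℂ) * ((x : ℂ) ^ k * (hermiteFun (n - 1) x : ℂ)) +
        (√((n + 1) / 2) : ℂ) * ((x : ℂ) ^ k * (hermiteFun (n + 1) x : ℂ)) := by
      ext x
      have := congrArg (fun y : ℝ => (y : ℂ)) (mul_hermiteFun n x)
      push_cast at this
      linear_combination (x : ℂ) ^ k * this
    rw [h]
    exact ((ih _).const_mul _).add ((ih _).const_mul _)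

/-- Each factor `x` is traded for neighbouring Hermite functions, so the vanishing of the
coefficients spreads to all moments by induction on `k`. -/
theorem integral_pow_mul_hermiteFun_mul_eq_zero {u : ℝ → ℂ} (hu : MemLp u 2)
    (h0 : ∀ n, hermiteCoeff u n = 0) (k n : ℕ) :
    ∫ x : ℝ, (x : ℂ) ^ k * (hermiteFun n x : ℂ) * u x = 0 := by
  induction k generalizing n with
  | zero => simpa [hermiteCoeff] using h0 n
  | succ k ih =>
    have h : ∀ x : ℝ, (x : ℂ) ^ (k + 1) * (hermiteFun n x : ℂ) * u x =
        (√(n / 2) : ℂ) * ((x : ℂ) ^ k * (hermiteFun (n - 1) x : ℂ) * u x) +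
        (√((n + 1) / 2) : ℂ) * ((x : ℂ) ^ k * (hermiteFun (n + 1) x : ℂ) * u x) := by
      intro x
      have := congrArg (fun y : ℝ => (y : ℂ)) (mul_hermiteFun n x)
      push_cast at this
      linear_combination (x : ℂ) ^ k * u x * this
    simp_rw [h]
    have hi : ∀ m, Integrable fun x : ℝ => (x : ℂ) ^ k * (hermiteFun m x : ℂ) * u x :=
      fun m => (memLp_pow_mul_hermiteFun k m).integrable_mul hu
    rw [integral_add ((hi _).const_mul _) ((hi _).const_mul _), integral_const_mul,
      integral_const_mul, ih, ih]
    simp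

theorem hermiteFun_zero_pos (x : ℝ) : 0 < hermiteFun 0 x := by
  simp only [hermiteFun, physHermite, Polynomial.eval_one]
  positivity

theorem memLp_exp_mul_hermiteFun_zero (b : ℝ) :
    MemLp (fun x => Real.exp (b * |x|) * hermiteFun 0 x) 2 := by
  have hc : Continuous fun x => Real.exp (b * |x|) * hermiteFun 0 x := by
    have := continuous_hermiteFun 0; fun_prop
  refine (memLp_two_iff_integrable_sq hc.aestronglyMeasurable).2 ?_
  set c := 1 / √(2 ^ 0 * ((0 : ℕ).factorial : ℝ) * √Real.pi) with hcd
  have hc0 : 0 ≤ c := by positivity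
  refine ((integrable_exp_neg_mul_sq (b := 1 / 2) (by norm_num)).const_mul
    (c ^ 2 * Real.exp (2 * b ^ 2))).mono' (hc.pow 2).aestronglyMeasurable
    (Eventually.of_forall fun x => ?_)
  rw [Real.norm_of_nonneg (by positivity), hermiteFun, ← hcd]
  have : (Real.exp (b * |x|) * (c * (physHermite 0).eval x * Real.exp (-x ^ 2 / 2))) ^ 2 =
      c ^ 2 * Real.exp (2 * (b * |x|) + 2 * (-x ^ 2 / 2)) := by
    have e : ∀ y, Real.exp (2 * y) = Real.exp y ^ 2 := fun y => by rw [two_mul, Real.exp_add, sq]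
    rw [Real.exp_add, e, e]
    simp [physHermite]; ring
  rw [this, mul_assoc, ← Real.exp_add]
  refine mul_le_mul_of_nonneg_left (Real.exp_le_exp.2 ?_) (by positivity)
  nlinarith [sq_abs x, sq_nonneg (|x| - 2 * b)]

open FourierTransform in
-- Expand the Fourier kernel in its power series: every term is a vanishing moment. The interchange
-- with the integral is dominated by `exp(2π|ξ||x|) φ₀ |u|`, integrable since the Gaussian beats the
-- exponential.
theorem fourier_hermiteFun_zero_mul_eq_zero {u : ℝ → ℂ} (hu : MemLp u 2)
    (h0 : ∀ n, hermiteCoeff u n = 0) (ξ : ℝ) :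
    𝓕 (fun x => (hermiteFun 0 x : ℂ) * u x) ξ = 0 := by
  rw [Real.fourier_real_eq_integral_exp_smul]
  set z : ℝ → ℂ := fun x => (↑(-2 * Real.pi * x * ξ) : ℂ) * Complex.I with hz
  have hb : ∀ x, ‖z x‖ = (2 * Real.pi * |ξ|) * |x| := fun x => by
    simp only [hz, norm_mul, Complex.norm_I, mul_one, Complex.norm_real, Real.norm_eq_abs,
      abs_neg, abs_two, abs_of_pos Real.pi_pos]
    ring
  have hS := hasSum_integral_of_dominated_convergence (μ := volume)
    (F := fun (k : ℕ) x => z x ^ k / (k.factorial : ℂ) * ((hermiteFun 0 x : ℂ) * u x))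
    (f := fun x => Complex.exp (z x) * ((hermiteFun 0 x : ℂ) * u x))
    (fun (k : ℕ) x => ‖z x‖ ^ k / k.factorial * (hermiteFun 0 x * ‖u x‖))
    (fun k => by
      have h1 : Continuous fun x => z x ^ k / (k.factorial : ℂ) := by fun_prop
      exact h1.aestronglyMeasurable.mul (integrable_hermiteFun_mul hu 0).1)
    (fun k => Eventually.of_forall fun x => by
      simp [abs_of_pos (hermiteFun_zero_pos x)])
    (Eventually.of_forall fun x => (Real.summable_pow_div_factorial _).mul_right _)
    (by
      have h1 : ∀ x, ∑' k : ℕ, ‖z x‖ ^ k / k.factorial * (hermiteFun 0 x * ‖u x‖) =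
          (Real.exp ((2 * Real.pi * |ξ|) * |x|) * hermiteFun 0 x) * ‖u x‖ := fun x => by
        rw [tsum_mul_right, ← hb, Real.exp_eq_exp_ℝ, NormedSpace.exp_eq_tsum_div, mul_assoc]
      simp_rw [h1]
      exact (memLp_exp_mul_hermiteFun_zero _).integrable_mul hu.norm)
    (Eventually.of_forall fun x => by
      have := NormedSpace.expSeries_div_hasSum_exp (z x)
      rw [← Complex.exp_eq_exp_ℂ] at this
      exact this.mul_right _)
  have h1 : ∀ k : ℕ, ∫ x, z x ^ k / (k.factorial : ℂ) * ((hermiteFun 0 x : ℂ) * u x) = 0 := by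
    intro k
    have h2 : ∀ x, z x ^ k / (k.factorial : ℂ) * ((hermiteFun 0 x : ℂ) * u x) =
        ((-2 * Real.pi * ξ * Complex.I) ^ k / (k.factorial : ℂ)) *
          ((x : ℂ) ^ k * (hermiteFun 0 x : ℂ) * u x) := fun x => by
      simp only [hz]; push_cast; ring
    simp_rw [h2]
    rw [integral_const_mul, integral_pow_mul_hermiteFun_mul_eq_zero hu h0, mul_zero]
  simp_rw [h1] at hS
  exact (hS.unique hasSum_zero)

open FourierTransform in
-- A test function is the Fourier transform of a Schwartz function; by the multiplication formula
-- the transform can be moved onto `g`, where it is zero.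
theorem ae_eq_zero_of_fourier_eq_zero {g : ℝ → ℂ} (hg : Integrable g) (h : ∀ ξ, 𝓕 g ξ = 0) :
    ∀ᵐ x, g x = 0 := by
  refine ae_eq_zero_of_integral_contDiff_smul_eq_zero hg.locallyIntegrable fun ψ hψ hc => ?_
  have h1 : HasCompactSupport (Complex.ofRealCLM ∘ ψ) := hc.comp_left rfl
  have h2 : ContDiff ℝ ∞ (Complex.ofRealCLM ∘ ψ) := by fun_prop
  set s := h1.toSchwartzMap h2 with hs
  have h3 := VectorFourier.integral_fourierIntegral_smul_eq_flip (L := innerₗ ℝ)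
      Real.continuous_fourierChar continuous_inner
      ((𝓕⁻ s : SchwartzMap ℝ ℂ).integrable (μ := volume)) hg
  have h4 : ∀ ξ, VectorFourier.fourierIntegral Real.fourierChar volume (innerₗ ℝ)
      (𝓕⁻ s : SchwartzMap ℝ ℂ) ξ =
      s ξ := fun ξ => by
    have h6 : 𝓕 (𝓕⁻ s : SchwartzMap ℝ ℂ) = s := FourierTransform.fourier_fourierInv_eq s
    exact congrArg (fun f : SchwartzMap ℝ ℂ => f ξ) h6
  have h5 : ∀ ξ, VectorFourier.fourierIntegral Real.fourierChar volume (innerₗ ℝ).flip g ξ = 0 := by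
    intro ξ
    rw [flip_innerₗ]
    exact h ξ
  simp_rw [h4, h5] at h3
  simpa [hs] using h3

theorem ae_eq_zero_of_hermiteCoeff_eq_zero {u : ℝ → ℂ} (hu : MemLp u 2)
    (h0 : ∀ n, hermiteCoeff u n = 0) : u =ᵐ[volume] 0 := by
  filter_upwards [ae_eq_zero_of_fourier_eq_zero (integrable_hermiteFun_mul hu 0)
    (fourier_hermiteFun_zero_mul_eq_zero hu h0)] with x hx
  simpa [(hermiteFun_zero_pos x).ne'] using hx

theorem inner_toLp {u v : ℝ → ℂ} (hu : MemLp u 2) (hv : MemLp v 2) :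
    inner ℂ (hu.toLp u) (hv.toLp v) = ∫ x, star (u x) * v x := by
  rw [L2.inner_def]
  refine integral_congr_ae ?_
  filter_upwards [hu.coeFn_toLp, hv.coeFn_toLp] with x h1 h2
  rw [h1, h2, RCLike.inner_apply, mul_comm]
  rfl

theorem inner_hermiteFun_toLp {u : ℝ → ℂ} (hu : MemLp u 2) (n : ℕ) :
    inner ℂ ((memLp_hermiteFun n).toLp _) (hu.toLp u) = hermiteCoeff u n := by
  rw [inner_toLp, hermiteCoeff]
  simp

theorem hermiteCoeff_hermiteFun (n m : ℕ) :
    hermiteCoeff (fun x => (hermiteFun m x : ℂ)) n = if n = m then 1 else 0 := by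
  have h := integral_hermiteFun_mul n m
  have h2 : ∫ x, ((hermiteFun n x * hermiteFun m x : ℝ) : ℂ) =
      ((∫ x, hermiteFun n x * hermiteFun m x : ℝ) : ℂ) := integral_ofReal
  rw [h] at h2
  push_cast at h2
  rw [hermiteCoeff, h2]
  split_ifs <;> simp

theorem orthonormal_hermiteFun :
    Orthonormal ℂ fun n => (memLp_hermiteFun n).toLp (fun x => (hermiteFun n x : ℂ)) := by
  rw [orthonormal_iff_ite]
  intro n m
  rw [inner_hermiteFun_toLp, hermiteCoeff_hermiteFun]

/-- The Hermite functions as a Hilbert basis of `L²(ℝ)`. -/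
def hermiteBasis : HilbertBasis ℕ ℂ (Lp ℂ 2 (volume : Measure ℝ)) :=
  HilbertBasis.mkOfOrthogonalEqBot orthonormal_hermiteFun (by
    rw [Submodule.eq_bot_iff]
    intro f hf
    have h0 : ∀ n, hermiteCoeff f n = 0 := fun n => by
      rw [← inner_hermiteFun_toLp (Lp.memLp f), Lp.toLp_coeFn]
      exact (Submodule.mem_orthogonal _ f).1 hf _ (Submodule.subset_span ⟨n, rfl⟩)
    rw [Lp.eq_zero_iff_ae_eq_zero]
    exact ae_eq_zero_of_hermiteCoeff_eq_zero (Lp.memLp f) h0)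

theorem hermiteBasis_apply (n : ℕ) :
    hermiteBasis n = (memLp_hermiteFun n).toLp (fun x => (hermiteFun n x : ℂ)) := by
  rw [hermiteBasis, HilbertBasis.coe_mkOfOrthogonalEqBot]

theorem hermiteBasis_repr_toLp {u : ℝ → ℂ} (hu : MemLp u 2) (n : ℕ) :
    hermiteBasis.repr (hu.toLp u) n = hermiteCoeff u n := by
  rw [HilbertBasis.repr_apply_apply, hermiteBasis_apply, inner_hermiteFun_toLp]

/-- Parseval's identity. -/
theorem hasSum_star_hermiteCoeff_mul {u v : ℝ → ℂ} (hu : MemLp u 2) (hv : MemLp v 2) :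
    HasSum (fun n => star (hermiteCoeff u n) * hermiteCoeff v n) (∫ x, star (u x) * v x) := by
  have h := hermiteBasis.hasSum_inner_mul_inner (hu.toLp u) (hv.toLp v)
  simp_rw [hermiteBasis_apply, inner_hermiteFun_toLp] at h
  rw [inner_toLp] at h
  refine h.congr_fun fun n => ?_
  rw [← inner_conj_symm (hu.toLp u), inner_hermiteFun_toLp]
  rfl

theorem hasSum_norm_hermiteCoeff_sq {u : ℝ → ℂ} (hu : MemLp u 2) :
    HasSum (fun n => ‖hermiteCoeff u n‖ ^ 2) (∫ x, ‖u x‖ ^ 2) := by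
  have h := hasSum_star_hermiteCoeff_mul hu hu
  have h1 : ∀ z : ℂ, star z * z = ((‖z‖ ^ 2 : ℝ) : ℂ) := fun z => by
    rw [← Complex.normSq_eq_norm_sq, Complex.normSq_eq_conj_mul_self]; rfl
  simp_rw [h1] at h
  rw [integral_complex_ofReal] at h
  exact Complex.hasSum_ofReal.1 h

theorem isHermiteExpansion_hermiteCoeff {u : ℝ → ℂ} (hu : MemLp u 2) :
    IsHermiteExpansion (hermiteCoeff u) u := by
  have h := (hermiteBasis.hasSum_repr (hu.toLp u)).tendsto_sum_nat
  rw [tendsto_iff_norm_sub_tendsto_zero] at h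
  have hs : ∀ N : ℕ, MemLp (fun x => ∑ n ∈ Finset.range N, hermiteCoeff u n * (hermiteFun n x : ℂ)) 2 :=
    fun N => memLp_finsetSum _ fun n _ => (memLp_hermiteFun n).const_mul _
  have h1 : ∀ N : ℕ, ∑ n ∈ Finset.range N, hermiteBasis.repr (hu.toLp u) n • hermiteBasis n =
      (hs N).toLp _ := by
    intro N
    induction N with
    | zero =>
      rw [Finset.sum_range_zero, eq_comm, Lp.eq_zero_iff_ae_eq_zero]
      filter_upwards [(hs 0).coeFn_toLp] with x hx
      rw [hx]; simp
    | succ N ih =>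
      rw [Finset.sum_range_succ, ih, hermiteBasis_repr_toLp, hermiteBasis_apply,
        ← MemLp.toLp_const_smul, ← MemLp.toLp_add]
      congr 1
      ext x
      simp [Finset.sum_range_succ]
  simp_rw [h1, norm_sub_rev _ (hu.toLp u), ← MemLp.toLp_sub, Lp.norm_toLp] at h
  have h2 := ENNReal.tendsto_ofReal h
  simp_rw [ENNReal.ofReal_toReal (hu.sub (hs _)).eLpNorm_ne_top, ENNReal.ofReal_zero] at h2
  exact h2

theorem exists_hermiteCoeff_eq {a : ℕ → ℂ} (ha : Summable fun n => ‖a n‖ ^ 2) :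
    ∃ u : ℝ → ℂ, MemLp u 2 ∧ hermiteCoeff u = a := by
  have h : Memℓp a 2 := by
    rw [memℓp_gen_iff (by norm_num)]
    simpa using ha
  set f := hermiteBasis.repr.symm ⟨a, h⟩ with hf
  refine ⟨f, Lp.memLp f, funext fun n => ?_⟩
  rw [← hermiteBasis_repr_toLp (Lp.memLp f), Lp.toLp_coeFn, hf, LinearIsometryEquiv.apply_symm_apply]

theorem hermiteCoeff_sub {u v : ℝ → ℂ} (hu : MemLp u 2) (hv : MemLp v 2) (n : ℕ) :
    hermiteCoeff (fun x => u x - v x) n = hermiteCoeff u n - hermiteCoeff v n := by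
  simp_rw [hermiteCoeff, mul_sub]
  exact integral_sub (integrable_hermiteFun_mul hu n) (integrable_hermiteFun_mul hv n)

theorem hermiteCoeff_add {u v : ℝ → ℂ} (hu : MemLp u 2) (hv : MemLp v 2) (n : ℕ) :
    hermiteCoeff (fun x => u x + v x) n = hermiteCoeff u n + hermiteCoeff v n := by
  simp_rw [hermiteCoeff, mul_add]
  exact integral_add (integrable_hermiteFun_mul hu n) (integrable_hermiteFun_mul hv n)

/-! ### The ladder relations for Hermite coefficients and the energy norm -/

theorem two_mul_sqrt_half (r : ℝ) (hr : 0 ≤ r) : (2 * √(r / 2)) ^ 2 = 2 * r := by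
  rw [mul_pow, Real.sq_sqrt (by positivity)]; ring

/-- The coefficients `√((n+1)/2) aₙ₊₁ + ε √(n/2) aₙ₋₁`. -/
def ladderCoeff (ε : ℂ) (a : ℕ → ℂ) (n : ℕ) : ℂ :=
  (√((n + 1) / 2) : ℂ) * a (n + 1) + ε * ((√(n / 2) : ℂ) * a (n - 1))

theorem hermiteCoeff_mul_id {u : ℝ → ℂ} (hu : MemLp u 2) :
    hermiteCoeff (fun x => (x : ℂ) * u x) = ladderCoeff 1 (hermiteCoeff u) := by
  ext n
  have h : ∀ x : ℝ, (hermiteFun n x : ℂ) * ((x : ℂ) * u x) =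
      (√((n + 1) / 2) : ℂ) * ((hermiteFun (n + 1) x : ℂ) * u x) +
      (√(n / 2) : ℂ) * ((hermiteFun (n - 1) x : ℂ) * u x) := fun x => by
    have := congrArg (fun y : ℝ => (y : ℂ)) (mul_hermiteFun n x)
    push_cast at this
    linear_combination u x * this
  simp_rw [hermiteCoeff, ladderCoeff, h]
  rw [integral_add ((integrable_hermiteFun_mul hu _).const_mul _)
    ((integrable_hermiteFun_mul hu _).const_mul _), integral_const_mul, integral_const_mul]
  simp [hermiteCoeff]

/-- `v` is the derivative of `u` when tested against Hermite functions. -/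
def IsHermiteDeriv (u v : ℝ → ℂ) : Prop :=
  ∀ n, ∫ x, (hermiteFun n x : ℂ) * v x = -∫ x, (hermiteFunDeriv n x : ℂ) * u x

theorem IsHermiteDeriv.hermiteCoeff_eq {u v : ℝ → ℂ} (h : IsHermiteDeriv u v) (hu : MemLp u 2) :
    hermiteCoeff v = ladderCoeff (-1) (hermiteCoeff u) := by
  ext n
  have h1 : ∀ x : ℝ, (hermiteFunDeriv n x : ℂ) * u x =
      (√(n / 2) : ℂ) * ((hermiteFun (n - 1) x : ℂ) * u x) -
      (√((n + 1) / 2) : ℂ) * ((hermiteFun (n + 1) x : ℂ) * u x) := fun x => by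
    have := congrArg (fun y : ℝ => (y : ℂ)) (hermiteFunDeriv_eq n x)
    push_cast at this
    linear_combination u x * this
  rw [hermiteCoeff, h n]
  simp_rw [ladderCoeff, h1]
  rw [integral_sub ((integrable_hermiteFun_mul hu _).const_mul _)
    ((integrable_hermiteFun_mul hu _).const_mul _), integral_const_mul, integral_const_mul]
  simp only [hermiteCoeff]
  ring

theorem integral_norm_add_sq_add_norm_sub_sq {f g : ℝ → ℂ} (hf : MemLp f 2) (hg : MemLp g 2) :
    (∫ x, ‖g x + f x‖ ^ 2) + ∫ x, ‖g x - f x‖ ^ 2 = 2 * (∫ x, ‖f x‖ ^ 2) + 2 * ∫ x, ‖g x‖ ^ 2 := by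
  have hi : ∀ {w : ℝ → ℂ}, MemLp w 2 → Integrable fun x => ‖w x‖ ^ 2 :=
    fun hw => hw.integrable_norm_pow (by norm_num)
  have ha : Integrable fun x => ‖g x + f x‖ ^ 2 := hi (hg.add hf)
  have hs : Integrable fun x => ‖g x - f x‖ ^ 2 := hi (hg.sub hf)
  rw [← integral_add ha hs, ← integral_const_mul, ← integral_const_mul,
    ← integral_add ((hi hf).const_mul 2) ((hi hg).const_mul 2)]
  refine integral_congr_ae (Eventually.of_forall fun x => ?_)
  have := parallelogram_law_with_norm ℝ (g x) (f x)
  simp only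
  nlinarith

/-- The energy norm in terms of the Hermite coefficients. -/
theorem hasSum_energy {u v : ℝ → ℂ} (hu : MemLp u 2) (hv : MemLp v 2)
    (hx : MemLp (fun x : ℝ => (x : ℂ) * u x) 2) (h : IsHermiteDeriv u v) :
    HasSum (fun n : ℕ => 2 * ((1 + n : ℝ) * ‖hermiteCoeff u n‖ ^ 2))
      ((∫ x, ‖v x‖ ^ 2) + (∫ x : ℝ, ‖(x : ℂ) * u x‖ ^ 2) + ∫ x, ‖u x‖ ^ 2) := by
  -- In `xu ± v` one of the two ladder terms cancels, so each coefficient involves a single `aₙ₊₁`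
  -- or `aₙ₋₁`.
  have h1 := hasSum_norm_hermiteCoeff_sq (u := fun x : ℝ => (x : ℂ) * u x + v x) (hx.add hv)
  have h2 := hasSum_norm_hermiteCoeff_sq (u := fun x : ℝ => (x : ℂ) * u x - v x) (hx.sub hv)
  simp_rw [hermiteCoeff_add hx hv, hermiteCoeff_mul_id hu, h.hermiteCoeff_eq hu, ladderCoeff] at h1
  simp_rw [hermiteCoeff_sub hx hv, hermiteCoeff_mul_id hu, h.hermiteCoeff_eq hu, ladderCoeff] at h2
  have e1 : ∀ n : ℕ, ‖(√((n + 1) / 2) : ℂ) * hermiteCoeff u (n + 1) +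
      1 * ((√(n / 2) : ℂ) * hermiteCoeff u (n - 1)) +
      ((√((n + 1) / 2) : ℂ) * hermiteCoeff u (n + 1) +
      -1 * ((√(n / 2) : ℂ) * hermiteCoeff u (n - 1)))‖ ^ 2 =
      2 * ((n + 1 : ℕ) : ℝ) * ‖hermiteCoeff u (n + 1)‖ ^ 2 := fun n => by
    rw [← two_mul_sqrt_half _ (by positivity), ← mul_pow]
    rw [show (√((n + 1) / 2) : ℂ) * hermiteCoeff u (n + 1) +
      1 * ((√(n / 2) : ℂ) * hermiteCoeff u (n - 1)) +
      ((√((n + 1) / 2) : ℂ) * hermiteCoeff u (n + 1) +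
      -1 * ((√(n / 2) : ℂ) * hermiteCoeff u (n - 1))) =
      ((2 * √((n + 1) / 2) : ℝ) : ℂ) * hermiteCoeff u (n + 1) by push_cast; ring, norm_mul,
      Complex.norm_real, Real.norm_of_nonneg (by positivity)]
    push_cast; rfl
  have e2 : ∀ n : ℕ, ‖(√((n + 1) / 2) : ℂ) * hermiteCoeff u (n + 1) +
      1 * ((√(n / 2) : ℂ) * hermiteCoeff u (n - 1)) -
      ((√((n + 1) / 2) : ℂ) * hermiteCoeff u (n + 1) +
      -1 * ((√(n / 2) : ℂ) * hermiteCoeff u (n - 1)))‖ ^ 2 =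
      2 * (n : ℝ) * ‖hermiteCoeff u (n - 1)‖ ^ 2 := fun n => by
    rw [← two_mul_sqrt_half _ (by positivity), ← mul_pow]
    rw [show (√((n + 1) / 2) : ℂ) * hermiteCoeff u (n + 1) +
      1 * ((√(n / 2) : ℂ) * hermiteCoeff u (n - 1)) -
      ((√((n + 1) / 2) : ℂ) * hermiteCoeff u (n + 1) +
      -1 * ((√(n / 2) : ℂ) * hermiteCoeff u (n - 1))) =
      ((2 * √(n / 2) : ℝ) : ℂ) * hermiteCoeff u (n - 1) by push_cast; ring, norm_mul,
      Complex.norm_real, Real.norm_of_nonneg (by positivity)]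
  simp_rw [e1] at h1
  simp_rw [e2] at h2
  -- Both index shifts are free of boundary terms because the weight vanishes at `n = 0`. The
  -- weights become `2n` and `2(n + 1)`; half their sum, plus `1` from `∫ |u|²`, is `2(1 + n)`.
  rw [← hasSum_nat_add_iff' 1] at h2
  rw [hasSum_nat_add_iff (f := fun n : ℕ => 2 * (n : ℝ) * ‖hermiteCoeff u n‖ ^ 2) 1] at h1
  simp only [Finset.range_one, Finset.sum_singleton, CharP.cast_eq_zero, mul_zero, zero_mul,
    add_zero, sub_zero, Nat.add_sub_cancel] at h1 h2
  have h3 := ((h1.add h2).mul_left (1 / 2)).add (hasSum_norm_hermiteCoeff_sq hu)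
  rw [integral_norm_add_sq_add_norm_sub_sq hv hx] at h3
  have hval : ∀ p q r : ℝ, 1 / 2 * (2 * p + 2 * q) + r = p + q + r := fun p q r => by ring
  rw [hval] at h3
  refine h3.congr_fun fun n => ?_
  push_cast
  ring

/-! ### Classical and weak derivatives tested against Hermite functions -/

theorem isHermiteDeriv_of_hasDerivAt {u v : ℝ → ℂ} (h : ∀ x, HasDerivAt u (v x) x)
    (hu : MemLp u 2) (hv : MemLp v 2) : IsHermiteDeriv u v := fun n => by
  have h1 : Integrable fun x => (hermiteFunDeriv n x : ℂ) * u x :=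
    (memLp_hermiteFunDeriv_real n).ofReal.integrable_mul hu
  have h2 := integrable_hermiteFun_mul hv n
  have h3 := integral_eq_zero_of_hasDerivAt_of_integrable
    (fun x => (hasDerivAt_hermiteFun n x).ofReal_comp.mul (h x)) (h1.add h2)
    (integrable_hermiteFun_mul hu n)
  rw [integral_add h1 h2] at h3
  exact eq_neg_of_add_eq_zero_right h3

theorem contDiff_hermiteFun (n : ℕ) : ContDiff ℝ ∞ (hermiteFun n) := by
  have h : ContDiff ℝ ∞ fun x => (physHermite n).eval x := by
    have h1 := Polynomial.contDiff_aeval (𝕜 := ℝ) (physHermite n) ∞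
    simp_rw [Polynomial.coe_aeval_eq_eval] at h1
    exact h1
  unfold hermiteFun
  fun_prop

theorem isHermiteDeriv_of_isWeakDeriv {u v : ℝ → ℂ} (h : IsWeakDeriv u v)
    (hu : MemLp u 2) (hv : MemLp v 2) : IsHermiteDeriv u v := fun n => by
  -- Since `φₙ` lacks compact support, the weak derivative is tested on `χ(rₖ x) φₙ(x)` with `rₖ =
  -- 1/(k + 1)`. The derivative of the cutoff is `O(rₖ)`, and dominated convergence removes it.
  let χ : ContDiffBump (0 : ℝ) := ⟨1, 2, one_pos, one_lt_two⟩
  have hχ : ContDiff ℝ ∞ χ := χ.contDiff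
  have hχ' : Continuous (deriv χ) := hχ.continuous_deriv (by simp)
  obtain ⟨M, hM⟩ := hχ'.bounded_above_of_compact_support χ.hasCompactSupport.deriv
  have hM0 : 0 ≤ M := (norm_nonneg _).trans (hM 0)
  set r : ℕ → ℝ := fun k => 1 / ((k : ℝ) + 1) with hr
  have hr0 : ∀ k, 0 < r k := fun k => by positivity
  have hr1 : ∀ k, r k ≤ 1 := fun k => by
    rw [hr]; simp only; rw [div_le_one (by positivity)]; simp
  have hrt : Tendsto r atTop (𝓝 0) := tendsto_one_div_add_atTop_nhds_zero_nat
  have hd : ∀ k x, HasDerivAt (fun x => χ (r k * x) * hermiteFun n x)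
      (r k * deriv χ (r k * x) * hermiteFun n x + χ (r k * x) * hermiteFunDeriv n x) x := by
    intro k x
    have h1 : HasDerivAt (fun x => χ (r k * x)) (r k * deriv χ (r k * x)) x := by
      have h2 : HasDerivAt χ (deriv χ (r k * x)) (r k * x) :=
        (hχ.differentiable (by simp) _).hasDerivAt
      have := h2.comp x ((hasDerivAt_id x).const_mul (r k))
      simpa [Function.comp_def, mul_comm] using this
    exact h1.mul (hasDerivAt_hermiteFun n x)
  have key : ∀ k, ∫ x, u x * ((r k * deriv χ (r k * x) * hermiteFun n x +
      χ (r k * x) * hermiteFunDeriv n x : ℝ) : ℂ) =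
      -∫ x, v x * ((χ (r k * x) * hermiteFun n x : ℝ) : ℂ) := by
    intro k
    have h1 := h.2.2 (fun x => χ (r k * x) * hermiteFun n x)
      ((hχ.comp (contDiff_const.mul contDiff_id)).mul (contDiff_hermiteFun n))
      ((χ.hasCompactSupport.comp_homeomorph (Homeomorph.mulLeft₀ (r k) (hr0 k).ne')).mul_right)
    simp_rw [(hd k _).deriv] at h1
    exact h1
  have hχle : ∀ y, |χ y| ≤ 1 := fun y => by rw [abs_of_nonneg χ.nonneg]; exact χ.le_one
  have hχt : ∀ x, Tendsto (fun k => χ (r k * x)) atTop (𝓝 1) := fun x => by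
    have h1 : Tendsto (fun k => r k * x) atTop (𝓝 0) := by simpa using hrt.mul_const x
    have h2 := (χ.continuous.tendsto 0).comp h1
    rwa [χ.one_of_mem_closedBall (Metric.mem_closedBall_self χ.rIn_pos.le)] at h2
  have hcH := continuous_hermiteFun n
  have hcD : Continuous (hermiteFunDeriv n) :=
    continuous_iff_continuousAt.2 fun x => (hasDerivAt_hermiteFunDeriv n x).continuousAt
  have hcχ := χ.continuous
  have l1 : Tendsto (fun k => ∫ x, v x * ((χ (r k * x) * hermiteFun n x : ℝ) : ℂ)) atTop
      (𝓝 (∫ x, v x * (hermiteFun n x : ℂ))) := by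
    refine tendsto_integral_of_dominated_convergence (fun x => ‖v x‖ * |hermiteFun n x|)
      (fun k => hv.1.mul (by fun_prop)) (hv.norm.integrable_mul (memLp_hermiteFun_real n).norm)
      (fun k => Eventually.of_forall fun x => ?_) (Eventually.of_forall fun x => ?_)
    · rw [norm_mul, Complex.norm_real, Real.norm_eq_abs, abs_mul]
      gcongr
      exact mul_le_of_le_one_left (abs_nonneg _) (hχle _)
    · refine Tendsto.const_mul _ ((Complex.continuous_ofReal.tendsto _).comp ?_)
      simpa using (hχt x).mul_const (hermiteFun n x)
  have l2 : Tendsto (fun k => ∫ x, u x * ((r k * deriv χ (r k * x) * hermiteFun n x +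
      χ (r k * x) * hermiteFunDeriv n x : ℝ) : ℂ)) atTop
      (𝓝 (∫ x, u x * (hermiteFunDeriv n x : ℂ))) := by
    refine tendsto_integral_of_dominated_convergence
      (fun x => ‖u x‖ * (M * |hermiteFun n x| + |hermiteFunDeriv n x|))
      (fun k => hu.1.mul (by fun_prop))
      (hu.norm.integrable_mul
        (((memLp_hermiteFun_real n).norm.const_mul M).add (memLp_hermiteFunDeriv_real n).norm))
      (fun k => Eventually.of_forall fun x => ?_) (Eventually.of_forall fun x => ?_)
    · rw [norm_mul, Complex.norm_real, Real.norm_eq_abs]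
      gcongr
      refine (abs_add_le _ _).trans (add_le_add ?_ ?_)
      · rw [abs_mul, abs_mul]
        gcongr
        rw [abs_of_pos (hr0 k)]
        calc r k * |deriv χ (r k * x)| ≤ 1 * M :=
              mul_le_mul (hr1 k) (hM _) (abs_nonneg _) zero_le_one
          _ = M := one_mul _
      · rw [abs_mul]
        exact mul_le_of_le_one_left (abs_nonneg _) (hχle _)
    · refine Tendsto.const_mul _ ((Complex.continuous_ofReal.tendsto _).comp ?_)
      have h1 : Tendsto (fun k => r k * deriv χ (r k * x)) atTop (𝓝 0) := by
        refine squeeze_zero_norm (a := fun k => r k * M) (fun k => ?_) (by simpa using hrt.mul_const M)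
        rw [norm_mul, Real.norm_of_nonneg (hr0 k).le]
        exact mul_le_mul_of_nonneg_left (hM _) (hr0 k).le
      simpa using (h1.mul_const (hermiteFun n x)).add ((hχt x).mul_const (hermiteFunDeriv n x))
  simp_rw [key] at l2
  have := tendsto_nhds_unique l1.neg l2
  simp_rw [mul_comm _ (v _), mul_comm _ (u _)]
  rw [← this, neg_neg]

/-! ### The converse -/

/-- Integration by parts on the side of the coefficients: `ε = 1` stands for multiplication by `x`,
which is symmetric, and `ε = -1` for `d/dx`, which is antisymmetric. -/
theorem integral_star_mul_eq_of_ladderCoeff {ε : ℂ} (hε : ε ^ 2 = 1) {f F u v : ℝ → ℂ}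
    (hf : MemLp f 2) (hF : MemLp F 2) (hu : MemLp u 2) (hv : MemLp v 2) (hε' : star ε = ε)
    (h1 : hermiteCoeff F = ladderCoeff ε (hermiteCoeff f))
    (h2 : hermiteCoeff v = ladderCoeff ε (hermiteCoeff u))
    (ha : Summable fun n : ℕ => (1 + n : ℝ) * ‖hermiteCoeff u n‖ ^ 2) :
    ∫ x, star (F x) * u x = ε * ∫ x, star (f x) * v x := by
  set a := hermiteCoeff u with hadef
  set b := hermiteCoeff f with hbdef
  have s1 := (hasSum_star_hermiteCoeff_mul hF hu).tendsto_sum_nat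
  have s2 := ((hasSum_star_hermiteCoeff_mul hf hv).mul_left ε).tendsto_sum_nat
  have s := s1.sub s2
  rw [h1, h2, ← hadef, ← hbdef] at s
  -- The difference of the partial sums telescopes to two boundary terms. They tend to zero because
  -- `√(1 + n) aₙ → 0` by the weighted summability and `bₙ → 0` by square summability.
  have key : ∀ N : ℕ, (∑ n ∈ Finset.range (N + 1), star (ladderCoeff ε b n) * a n) -
      ∑ n ∈ Finset.range (N + 1), ε * (star (b n) * ladderCoeff ε a n) =
      (√((N + 1) / 2) : ℂ) * (star (b (N + 1)) * a N) -
        ε * ((√((N + 1) / 2) : ℂ) * (star (b N) * a (N + 1))) := by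
    intro N
    induction N with
    | zero => simp [ladderCoeff]; ring
    | succ N ih =>
      rw [Finset.sum_range_succ _ (N + 1), Finset.sum_range_succ _ (N + 1)]
      have : ∀ p q r s : ℂ, p + q - (r + s) = (p - r) + (q - s) := fun p q r s => by ring
      rw [this, ih]
      simp only [ladderCoeff, star_add, star_mul', hε', Nat.add_sub_cancel]
      simp only [Complex.star_def, Complex.conj_ofReal]
      push_cast
      linear_combination (-(√((N + 1) / 2) : ℂ) * ((starRingEnd ℂ) (b (N + 1)) * a N)) * hε
  have s' := (tendsto_add_atTop_iff_nat 1).2 s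
  simp_rw [key] at s'
  have hwt : Tendsto (fun n : ℕ => √(1 + n) * ‖a n‖) atTop (𝓝 0) := by
    have := ha.tendsto_atTop_zero.sqrt
    simpa [Real.sqrt_mul (add_nonneg zero_le_one (Nat.cast_nonneg _)), Real.sqrt_sq] using this
  have hbt : Tendsto (fun n : ℕ => ‖b n‖) atTop (𝓝 0) := by
    have := (hasSum_norm_hermiteCoeff_sq hf).summable.tendsto_atTop_zero.sqrt
    simpa [Real.sqrt_sq] using this
  have t1 : Tendsto (fun N : ℕ => (√((N + 1) / 2) : ℂ) * (star (b (N + 1)) * a N)) atTop (𝓝 0) := by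
    refine squeeze_zero_norm (a := fun N => ‖b (N + 1)‖ * (√(1 + N) * ‖a N‖)) (fun N => ?_) ?_
    · rw [norm_mul, norm_mul, norm_star, Complex.norm_real, Real.norm_of_nonneg (by positivity)]
      rw [mul_left_comm]
      gcongr
      linarith
    · simpa using ((tendsto_add_atTop_iff_nat 1).2 hbt).mul hwt
  have t2 : Tendsto (fun N : ℕ => (√((N + 1) / 2) : ℂ) * (star (b N) * a (N + 1))) atTop (𝓝 0) := by
    refine squeeze_zero_norm (a := fun N => ‖b N‖ * (√(1 + (N + 1 : ℕ)) * ‖a (N + 1)‖))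
      (fun N => ?_) ?_
    · rw [norm_mul, norm_mul, norm_star, Complex.norm_real, Real.norm_of_nonneg (by positivity)]
      rw [mul_left_comm]
      gcongr
      push_cast
      linarith
    · simpa using hbt.mul ((tendsto_add_atTop_iff_nat 1).2 hwt)
  have t := t1.sub (t2.const_mul ε)
  have := tendsto_nhds_unique s' t
  simpa [sub_eq_zero] using this

theorem summable_ladderCoeff {ε : ℂ} (hε : ‖ε‖ = 1) {a : ℕ → ℂ}
    (ha : Summable fun n : ℕ => (1 + n : ℝ) * ‖a n‖ ^ 2) :
    Summable fun n => ‖ladderCoeff ε a n‖ ^ 2 := by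
  have h1 : Summable fun n : ℕ => (n + 1 : ℝ) * ‖a (n + 1)‖ ^ 2 := by
    refine ((summable_nat_add_iff 1).2 ha).of_nonneg_of_le (fun n => by positivity) fun n => ?_
    exact mul_le_mul_of_nonneg_right (by push_cast; linarith) (sq_nonneg _)
  have h2 : Summable fun n : ℕ => (n : ℝ) * ‖a (n - 1)‖ ^ 2 := by
    rw [← summable_nat_add_iff 1]
    simpa [add_comm] using ha
  refine (h1.add h2).of_nonneg_of_le (fun n => by positivity) fun n => ?_
  have h3 : √((n + 1 : ℝ) / 2) ^ 2 = (n + 1) / 2 := Real.sq_sqrt (by positivity)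
  have h4 : √((n : ℝ) / 2) ^ 2 = n / 2 := Real.sq_sqrt (by positivity)
  have h5 : ‖ladderCoeff ε a n‖ ≤ √((n + 1 : ℝ) / 2) * ‖a (n + 1)‖ + √((n : ℝ) / 2) * ‖a (n - 1)‖ := by
    refine (norm_add_le _ _).trans_eq ?_
    rw [norm_mul, norm_mul, norm_mul, hε, Complex.norm_real, Complex.norm_real,
      Real.norm_of_nonneg (by positivity), Real.norm_of_nonneg (by positivity), one_mul]
  calc ‖ladderCoeff ε a n‖ ^ 2 ≤ _ := pow_le_pow_left₀ (norm_nonneg _) h5 2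
    _ ≤ 2 * ((√((n + 1 : ℝ) / 2) * ‖a (n + 1)‖) ^ 2 + (√((n : ℝ) / 2) * ‖a (n - 1)‖) ^ 2) :=
      add_sq_le
    _ = _ := by rw [mul_pow, mul_pow, h3, h4]; ring

theorem memLp_of_hasCompactSupport {ψ : ℝ → ℝ} (hψ : Continuous ψ) (hc : HasCompactSupport ψ) :
    MemLp (fun x => (ψ x : ℂ)) 2 :=
  (hψ.memLp_of_hasCompactSupport hc).ofReal

/-- The candidates for `u'` and `xu` are the `L²` functions whose coefficients are the corresponding
ladder sequences; pairing with smooth compactly supported functions identifies them. -/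
theorem memEnergySpace_of_summable {u : ℝ → ℂ} (hu : MemLp u 2)
    (ha : Summable fun n : ℕ => (1 + n : ℝ) * ‖hermiteCoeff u n‖ ^ 2) : MemEnergySpace u := by
  refine ⟨hu, ?_, ?_⟩
  · obtain ⟨v, hv, hv'⟩ := exists_hermiteCoeff_eq (summable_ladderCoeff (ε := -1) (by simp) ha)
    refine ⟨v, hv, hu.locallyIntegrable (by norm_num), hv.locallyIntegrable (by norm_num),
      fun ψ hψ hc => ?_⟩
    have hd : ∀ x, HasDerivAt (fun x => (ψ x : ℂ)) ((deriv ψ x : ℝ) : ℂ) x :=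
      fun x => (hψ.differentiable (by simp) x).hasDerivAt.ofReal_comp
    have m1 := memLp_of_hasCompactSupport hψ.continuous hc
    have m2 := memLp_of_hasCompactSupport (hψ.continuous_deriv (by simp)) hc.deriv
    have := integral_star_mul_eq_of_ladderCoeff (ε := -1) (by norm_num) m1 m2 hu hv (by simp)
      ((isHermiteDeriv_of_hasDerivAt hd m1 m2).hermiteCoeff_eq m1) hv' ha
    simp only [Complex.star_def, Complex.conj_ofReal, neg_one_mul] at this
    simpa [mul_comm] using this
  · obtain ⟨v, hv, hv'⟩ := exists_hermiteCoeff_eq (summable_ladderCoeff (ε := 1) (by simp) ha)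
    refine hv.ae_eq ?_
    have hl : LocallyIntegrable fun x : ℝ => (x : ℂ) * u x := by
      exact (hu.locallyIntegrable (by norm_num)).continuous_mul Complex.continuous_ofReal
    refine ae_eq_of_integral_contDiff_smul_eq (hv.locallyIntegrable (by norm_num)) hl
      fun ψ hψ hc => ?_
    have m1 := memLp_of_hasCompactSupport hψ.continuous hc
    have m2 : MemLp (fun x : ℝ => (x : ℂ) * (ψ x : ℂ)) 2 := by
      simpa using memLp_of_hasCompactSupport (ψ := fun x => x * ψ x) (continuous_id.mul hψ.continuous)
        hc.mul_left
    have := integral_star_mul_eq_of_ladderCoeff (ε := 1) (by norm_num) m1 m2 hu hv (by simp)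
      (hermiteCoeff_mul_id m1) hv' ha
    simp only [Complex.star_def, Complex.conj_ofReal, one_mul, map_mul] at this
    simp only [Complex.real_smul]
    rw [← this]
    congr 1; ext x; ring

theorem summable_of_memEnergySpace {u : ℝ → ℂ} (hu : MemEnergySpace u) :
    Summable fun n : ℕ => (1 + n : ℝ) * ‖hermiteCoeff u n‖ ^ 2 := by
  obtain ⟨h1, ⟨v, hv, hw⟩, hx⟩ := hu
  have := (hasSum_energy h1 hv hx (isHermiteDeriv_of_isWeakDeriv hw h1 hv)).summable
  exact (summable_mul_left_iff two_ne_zero).1 this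

theorem one_add_rpow_two_mul_half (n : ℕ) : (1 + n : ℝ) ^ (2 * (1 / 2) : ℝ) = 1 + n := by
  norm_num

theorem memWeightedL2_half_iff (a : ℕ → ℂ) :
    MemWeightedL2 (1 / 2) a ↔ Summable fun n : ℕ => (1 + n : ℝ) * ‖a n‖ ^ 2 := by
  simp_rw [MemWeightedL2, one_add_rpow_two_mul_half]

theorem memEnergySpace_iff {u : ℝ → ℂ} (hu : MemLp u 2) :
    MemEnergySpace u ↔ MemWeightedL2 (1 / 2) (hermiteCoeff u) := by
  rw [memWeightedL2_half_iff]
  exact ⟨summable_of_memEnergySpace, memEnergySpace_of_summable hu⟩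

theorem summable_norm_sq_of_weighted {a : ℕ → ℂ}
    (ha : Summable fun n : ℕ => (1 + n : ℝ) * ‖a n‖ ^ 2) : Summable fun n => ‖a n‖ ^ 2 :=
  ha.of_nonneg_of_le (fun n => by positivity) fun n =>
    le_mul_of_one_le_left (by positivity) (by simp)

theorem exists_memEnergySpace (a : WeightedL2 (1 / 2)) :
    ∃ u : ℝ → ℂ, MemEnergySpace u ∧ hermiteCoeff u = a := by
  obtain ⟨u, hu, h⟩ := exists_hermiteCoeff_eq
    (summable_norm_sq_of_weighted ((memWeightedL2_half_iff a).1 a.2))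
  refine ⟨u, (memEnergySpace_iff hu).2 ?_, h⟩
  rw [h]; exact a.2

theorem WeightedL2.norm_half_sq (a : WeightedL2 (1 / 2)) :
    ‖a‖ ^ 2 = ∑' n : ℕ, (1 + n : ℝ) * ‖a n‖ ^ 2 := by
  rw [WeightedL2.norm_sq_eq]; simp_rw [one_add_rpow_two_mul_half]

theorem integral_energy_eq {u v : ℝ → ℂ} {a : WeightedL2 (1 / 2)} (hu : MemEnergySpace u)
    (hv : IsWeakDeriv u v) (ha : hermiteCoeff u = a) :
    ∫ x, (‖v x‖ ^ 2 + (x ^ 2 + 1) * ‖u x‖ ^ 2) = 2 * ‖a‖ ^ 2 := by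
  obtain ⟨h1, ⟨w, hw, hwd⟩, hx⟩ := hu
  -- The given weak derivative `v` is only locally integrable; uniqueness of weak derivatives makes
  -- it agree with the square integrable `w`.
  have hvw : v =ᵐ[volume] w := by
    refine ae_eq_of_integral_contDiff_smul_eq hv.2.1 hwd.2.1 fun ψ hψ hc => ?_
    have := neg_injective ((hv.2.2 ψ hψ hc).symm.trans (hwd.2.2 ψ hψ hc))
    simpa [mul_comm] using this
  have hv2 : MemLp v 2 := hw.ae_eq hvw.symm
  have h := hasSum_energy h1 hv2 hx (isHermiteDeriv_of_isWeakDeriv hv h1 hv2)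
  rw [WeightedL2.norm_half_sq, ← tsum_mul_left]
  have h3 := h.tsum_eq
  rw [ha] at h3
  rw [h3]
  have hi : ∀ {w : ℝ → ℂ}, MemLp w 2 → Integrable fun x => ‖w x‖ ^ 2 :=
    fun hw => hw.integrable_norm_pow (by norm_num)
  have i1 : Integrable fun x => ‖v x‖ ^ 2 + ‖(x : ℂ) * u x‖ ^ 2 := (hi hv2).add (hi hx)
  rw [← integral_add (hi hv2) (hi hx), ← integral_add i1 (hi h1)]
  congr 1; ext x
  rw [norm_mul, mul_pow, Complex.norm_real, Real.norm_eq_abs, sq_abs]; ring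

/-! ### Evaluation of Hermite series -/

namespace WeightedL2

variable {s : ℝ}

theorem add_apply (a b : WeightedL2 s) (n : ℕ) : (a + b) n = a n + b n := rfl
theorem sub_apply (a b : WeightedL2 s) (n : ℕ) : (a - b) n = a n - b n := rfl
theorem smul_apply (c : ℂ) (a : WeightedL2 s) (n : ℕ) : (c • a) n = c * a n := rfl
theorem zero_apply (n : ℕ) : (0 : WeightedL2 s) n = 0 := rfl

@[ext] theorem ext {a b : WeightedL2 s} (h : ∀ n, a n = b n) : a = b := Subtype.ext (funext h)

theorem summable_half (a : WeightedL2 (1 / 2)) : Summable fun n : ℕ => (1 + n : ℝ) * ‖a n‖ ^ 2 :=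
  (memWeightedL2_half_iff a).1 a.2

theorem summable_sq (a : WeightedL2 (1 / 2)) : Summable fun n : ℕ => ‖a n‖ ^ 2 :=
  summable_norm_sq_of_weighted a.summable_half

/-- The square of the unweighted `l²` norm. -/
def mass (a : WeightedL2 (1 / 2)) : ℝ := ∑' n : ℕ, ‖a n‖ ^ 2

theorem mass_nonneg (a : WeightedL2 (1 / 2)) : 0 ≤ a.mass := tsum_nonneg fun _ => by positivity

theorem mass_le (a : WeightedL2 (1 / 2)) : a.mass ≤ ‖a‖ ^ 2 := by
  rw [norm_half_sq]
  exact a.summable_sq.tsum_le_tsum (fun n => le_mul_of_one_le_left (by positivity) (by simp))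
    a.summable_half

/-- Split the weight as `(1 + n)^(-3/4) (1 + n)^(1/2)`: the first factor is square summable, and so
is the second times `|aₙ|`. This is where the decay exponent `1/4` of the Hermite functions
suffices. -/
theorem summable_quarter (a : WeightedL2 (1 / 2)) :
    Summable fun n : ℕ => ‖a n‖ * (1 + n : ℝ) ^ (-(1 / 4) : ℝ) := by
  have h1 : Summable fun n : ℕ => (1 + n : ℝ) ^ (-(3 / 2) : ℝ) := by
    have := (summable_nat_add_iff 1).2 (Real.summable_nat_rpow.2 (by norm_num : (-(3 / 2) : ℝ) < -1))
    simpa [add_comm] using this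
  refine (h1.add a.summable_half).of_nonneg_of_le (fun n => by positivity) fun n => ?_
  have hn : (0 : ℝ) < 1 + n := by positivity
  set p := (1 + n : ℝ) ^ (-(3 / 4) : ℝ) with hp
  set q := √(1 + n : ℝ) with hq
  have e1 : (1 + n : ℝ) ^ (-(3 / 2) : ℝ) = p ^ 2 := by
    rw [hp, ← Real.rpow_natCast, ← Real.rpow_mul hn.le]; norm_num
  have e2 : (1 + n : ℝ) ^ (-(1 / 4) : ℝ) = p * q := by
    rw [hp, hq, Real.sqrt_eq_rpow, ← Real.rpow_add hn]; norm_num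
  have e3 : (1 + n : ℝ) = q ^ 2 := (Real.sq_sqrt hn.le).symm
  have hp0 : 0 ≤ p := by positivity
  have hq0 : 0 ≤ q := by positivity
  rw [e1, e2]
  calc ‖a n‖ * (p * q) ≤ p ^ 2 + q ^ 2 * ‖a n‖ ^ 2 := by
        nlinarith [sq_nonneg (p - q * ‖a n‖), mul_nonneg hp0 (mul_nonneg hq0 (norm_nonneg (a n)))]
    _ = _ := by rw [← e3]

theorem norm_mul_hermiteFun_le (a : WeightedL2 (1 / 2)) (n : ℕ) (x : ℝ) :
    ‖a n * (hermiteFun n x : ℂ)‖ ≤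
      2 * (1 + |x|) * (‖a n‖ * (1 + n : ℝ) ^ (-(1 / 4) : ℝ)) := by
  rw [norm_mul, Complex.norm_real, Real.norm_eq_abs]
  calc ‖a n‖ * |hermiteFun n x| ≤ ‖a n‖ * (2 * (1 + |x|) * (1 + n : ℝ) ^ (-(1 / 4) : ℝ)) := by
        gcongr; exact abs_hermiteFun_le n x
    _ = _ := by ring

theorem summable_norm_mul_hermiteFun (a : WeightedL2 (1 / 2)) (x : ℝ) :
    Summable fun n => ‖a n * (hermiteFun n x : ℂ)‖ :=
  (a.summable_quarter.mul_left _).of_nonneg_of_le (fun _ => norm_nonneg _)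
    fun n => a.norm_mul_hermiteFun_le n x

/-- The function `∑ aₙ φₙ`, as a pointwise absolutely convergent series. -/
def eval (a : WeightedL2 (1 / 2)) (x : ℝ) : ℂ := ∑' n, a n * (hermiteFun n x : ℂ)

theorem hasSum_eval (a : WeightedL2 (1 / 2)) (x : ℝ) :
    HasSum (fun n => a n * (hermiteFun n x : ℂ)) (a.eval x) :=
  (a.summable_norm_mul_hermiteFun x).of_norm.hasSum

theorem eval_add (a b : WeightedL2 (1 / 2)) (x : ℝ) : (a + b).eval x = a.eval x + b.eval x := by
  refine (hasSum_eval (a + b) x).unique ?_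
  simp_rw [add_apply, add_mul]
  exact (hasSum_eval a x).add (hasSum_eval b x)

theorem eval_sub (a b : WeightedL2 (1 / 2)) (x : ℝ) : (a - b).eval x = a.eval x - b.eval x := by
  refine (hasSum_eval (a - b) x).unique ?_
  simp_rw [sub_apply, sub_mul]
  exact (hasSum_eval a x).sub (hasSum_eval b x)

/-- The partial sums of a Hermite series. -/
def partialSum (a : WeightedL2 (1 / 2)) (N : ℕ) (x : ℝ) : ℂ :=
  ∑ n ∈ Finset.range N, a n * (hermiteFun n x : ℂ)

/-- The derivatives of the partial sums of a Hermite series. -/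
def partialSumDeriv (a : WeightedL2 (1 / 2)) (N : ℕ) (x : ℝ) : ℂ :=
  ∑ n ∈ Finset.range N, a n * (hermiteFunDeriv n x : ℂ)

theorem tendsto_partialSum (a : WeightedL2 (1 / 2)) (x : ℝ) :
    Tendsto (fun N => a.partialSum N x) atTop (𝓝 (a.eval x)) := (a.hasSum_eval x).tendsto_sum_nat

theorem hasDerivAt_partialSum (a : WeightedL2 (1 / 2)) (N : ℕ) (x : ℝ) :
    HasDerivAt (a.partialSum N) (a.partialSumDeriv N x) x :=
  HasDerivAt.fun_sum fun n _ => (hasDerivAt_hermiteFun n x).ofReal_comp.const_mul (a n)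

theorem continuous_partialSum (a : WeightedL2 (1 / 2)) (N : ℕ) : Continuous (a.partialSum N) :=
  continuous_iff_continuousAt.2 fun x => (a.hasDerivAt_partialSum N x).continuousAt

theorem memLp_partialSum (a : WeightedL2 (1 / 2)) (N : ℕ) : MemLp (a.partialSum N) 2 :=
  memLp_finsetSum _ fun n _ => (memLp_hermiteFun n).const_mul _

theorem memLp_partialSumDeriv (a : WeightedL2 (1 / 2)) (N : ℕ) : MemLp (a.partialSumDeriv N) 2 :=
  memLp_finsetSum _ fun n _ => (memLp_hermiteFunDeriv_real n).ofReal.const_mul _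

theorem memLp_mul_partialSum (a : WeightedL2 (1 / 2)) (N : ℕ) :
    MemLp (fun x : ℝ => (x : ℂ) * a.partialSum N x) 2 := by
  have h : (fun x : ℝ => (x : ℂ) * a.partialSum N x) =
      fun x : ℝ => ∑ n ∈ Finset.range N, a n * ((x * hermiteFun n x : ℝ) : ℂ) := by
    ext x
    rw [partialSum, Finset.mul_sum]
    refine Finset.sum_congr rfl fun n _ => ?_
    push_cast; ring
  rw [h]
  exact memLp_finsetSum _ fun n _ => (memLp_mul_hermiteFun_real n).ofReal.const_mul _

theorem hermiteCoeff_partialSum (a : WeightedL2 (1 / 2)) (N n : ℕ) :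
    hermiteCoeff (a.partialSum N) n = if n < N then a n else 0 := by
  simp_rw [hermiteCoeff, partialSum, Finset.mul_sum]
  rw [integral_finsetSum _ fun m _ => integrable_hermiteFun_mul ((memLp_hermiteFun m).const_mul _) n]
  have h : ∀ m, ∫ x, (hermiteFun n x : ℂ) * (a m * (hermiteFun m x : ℂ)) =
      if n = m then a m else 0 := fun m => by
    simp_rw [mul_left_comm _ (a m)]
    rw [integral_const_mul]
    change a m * hermiteCoeff _ n = _
    rw [hermiteCoeff_hermiteFun]; simp
  simp_rw [h]
  simp

theorem integral_partialSum_energy_le (a : WeightedL2 (1 / 2)) (N : ℕ) :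
    (∫ x, ‖a.partialSumDeriv N x‖ ^ 2) + (∫ x : ℝ, ‖(x : ℂ) * a.partialSum N x‖ ^ 2) +
      ∫ x, ‖a.partialSum N x‖ ^ 2 ≤ 2 * ‖a‖ ^ 2 := by
  have h := hasSum_energy (a.memLp_partialSum N) (a.memLp_partialSumDeriv N)
    (a.memLp_mul_partialSum N) (isHermiteDeriv_of_hasDerivAt (a.hasDerivAt_partialSum N)
    (a.memLp_partialSum N) (a.memLp_partialSumDeriv N))
  rw [← h.tsum_eq, norm_half_sq, ← tsum_mul_left]
  refine h.summable.tsum_le_tsum (fun n => ?_) (a.summable_half.mul_left 2)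
  rw [hermiteCoeff_partialSum]
  split_ifs
  · exact le_rfl
  · simp; positivity

theorem integral_partialSum_sq_le (a : WeightedL2 (1 / 2)) (N : ℕ) :
    ∫ x, ‖a.partialSum N x‖ ^ 2 ≤ a.mass := by
  have h := hasSum_norm_hermiteCoeff_sq (a.memLp_partialSum N)
  rw [← h.tsum_eq, mass]
  refine h.summable.tsum_le_tsum (fun n => ?_) a.summable_sq
  rw [hermiteCoeff_partialSum]
  split_ifs
  · exact le_rfl
  · simp

/-- The bound by `√mass * ‖a‖` instead of `‖a‖²` is what later makes the quartic energy grow only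
linearly in `‖a‖` at fixed mass. -/
theorem norm_partialSum_sq_le (a : WeightedL2 (1 / 2)) (N : ℕ) (x : ℝ) :
    ‖a.partialSum N x‖ ^ 2 ≤ 4 * (√a.mass * ‖a‖) := by
  have h := norm_sq_le_of_hasDerivAt (a.hasDerivAt_partialSum N) (a.memLp_partialSum N)
    (a.memLp_partialSumDeriv N) x
  have h1 := a.integral_partialSum_energy_le N
  have h2 : 0 ≤ ∫ x, ‖a.partialSum N x‖ ^ 2 := integral_nonneg fun x => by positivity
  have h3 : 0 ≤ ∫ x : ℝ, ‖(x : ℂ) * a.partialSum N x‖ ^ 2 := integral_nonneg fun x => by positivity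
  have h4 : √(∫ x, ‖a.partialSumDeriv N x‖ ^ 2) ≤ 2 * ‖a‖ :=
    Real.sqrt_le_iff.2 ⟨by positivity, by nlinarith [sq_nonneg ‖a‖]⟩
  have h5 := Real.sqrt_le_sqrt (a.integral_partialSum_sq_le N)
  calc _ ≤ _ := h
    _ ≤ 2 * (√a.mass * (2 * ‖a‖)) := by gcongr
    _ = _ := by ring

theorem norm_partialSum_le (a : WeightedL2 (1 / 2)) (N : ℕ) (x : ℝ) :
    ‖a.partialSum N x‖ ≤ 2 * ‖a‖ := by
  have h1 : √a.mass ≤ ‖a‖ := Real.sqrt_le_iff.2 ⟨norm_nonneg _, a.mass_le⟩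
  refine le_of_sq_le_sq ?_ (by positivity)
  calc ‖a.partialSum N x‖ ^ 2 ≤ 4 * (√a.mass * ‖a‖) := a.norm_partialSum_sq_le N x
    _ ≤ 4 * (‖a‖ * ‖a‖) := by gcongr
    _ = _ := by ring

theorem norm_eval_sq_le (a : WeightedL2 (1 / 2)) (x : ℝ) :
    ‖a.eval x‖ ^ 2 ≤ 4 * (√a.mass * ‖a‖) :=
  le_of_tendsto' ((a.tendsto_partialSum x).norm.pow 2) fun N => a.norm_partialSum_sq_le N x

theorem norm_eval_le (a : WeightedL2 (1 / 2)) (x : ℝ) : ‖a.eval x‖ ≤ 2 * ‖a‖ :=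
  le_of_tendsto' (a.tendsto_partialSum x).norm fun N => a.norm_partialSum_le N x

theorem measurable_eval (a : WeightedL2 (1 / 2)) : Measurable a.eval :=
  measurable_of_tendsto_metrizable (fun N => (a.continuous_partialSum N).measurable)
    (tendsto_pi_nhds.2 a.tendsto_partialSum)

/-- The partial sums converge pointwise to `eval` and in `L²` to some `u`; lower semicontinuity of
the `L²` norm under pointwise limits forces the two limits to coincide almost everywhere. -/
theorem memLp_eval_and_hermiteCoeff_eval (a : WeightedL2 (1 / 2)) :
    MemLp a.eval 2 ∧ hermiteCoeff a.eval = a := by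
  obtain ⟨u, hu, hua⟩ := exists_hermiteCoeff_eq a.summable_sq
  have h := isHermiteExpansion_hermiteCoeff hu
  rw [hua] at h
  have h1 : eLpNorm (fun x => u x - a.eval x) 2 volume ≤ 0 := by
    have := Lp.eLpNorm_lim_le_liminf_eLpNorm (p := 2) (μ := volume)
      (f := fun N x => u x - ∑ n ∈ Finset.range N, a n * (hermiteFun n x : ℂ))
      (fun N => (hu.sub (a.memLp_partialSum N)).1) (fun x => u x - a.eval x)
      (Eventually.of_forall fun x => (a.tendsto_partialSum x).const_sub _)
    exact this.trans_eq h.liminf_eq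
  have hm : AEStronglyMeasurable a.eval volume := a.measurable_eval.aestronglyMeasurable
  have h2 := (eLpNorm_eq_zero_iff (hu.1.sub hm) (by norm_num)).1 (le_antisymm h1 zero_le)
  have h3 : u =ᵐ[volume] a.eval := by
    filter_upwards [h2] with x hx
    exact sub_eq_zero.1 hx
  refine ⟨hu.ae_eq h3, ?_⟩
  rw [← hua]
  ext n
  refine integral_congr_ae ?_
  filter_upwards [h3] with x hx
  rw [hx]

theorem memLp_eval (a : WeightedL2 (1 / 2)) : MemLp a.eval 2 :=
  a.memLp_eval_and_hermiteCoeff_eval.1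

theorem hermiteCoeff_eval (a : WeightedL2 (1 / 2)) : hermiteCoeff a.eval = a :=
  a.memLp_eval_and_hermiteCoeff_eval.2

theorem integral_norm_eval_sq (a : WeightedL2 (1 / 2)) : ∫ x, ‖a.eval x‖ ^ 2 = a.mass := by
  rw [← (hasSum_norm_hermiteCoeff_sq a.memLp_eval).tsum_eq, hermiteCoeff_eval, mass]

/-! ### The cubic nonlinearity -/

/-- The function `u ū' u''` for Hermite series `u, u', u''`. -/
def evalMul (a b c : WeightedL2 (1 / 2)) (x : ℝ) : ℂ := a.eval x * star (b.eval x) * c.eval x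

theorem norm_evalMul (a b c : WeightedL2 (1 / 2)) (x : ℝ) :
    ‖evalMul a b c x‖ = ‖a.eval x‖ * ‖b.eval x‖ * ‖c.eval x‖ := by
  rw [evalMul, norm_mul, norm_mul, norm_star]

theorem memLp_evalMul (a b c : WeightedL2 (1 / 2)) : MemLp (evalMul a b c) 2 := by
  refine a.memLp_eval.of_le_mul (c := (2 * ‖b‖) * (2 * ‖c‖)) ?_ (Eventually.of_forall fun x => ?_)
  · exact ((a.memLp_eval.1.mul b.memLp_eval.1.star).mul c.memLp_eval.1)
  · rw [norm_evalMul]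
    calc ‖a.eval x‖ * ‖b.eval x‖ * ‖c.eval x‖ ≤ ‖a.eval x‖ * (2 * ‖b‖) * (2 * ‖c‖) := by
          gcongr
          · exact b.norm_eval_le x
          · exact c.norm_eval_le x
      _ = _ := by ring

theorem integral_norm_mul_mul_sq_le {f g h : ℝ → ℂ} (hf : MemLp f 2) {G H : ℝ}
    (hg : ∀ x, ‖g x‖ ≤ G) (hh : ∀ x, ‖h x‖ ≤ H) :
    ∫ x, (‖f x‖ * ‖g x‖ * ‖h x‖) ^ 2 ≤ G ^ 2 * H ^ 2 * ∫ x, ‖f x‖ ^ 2 := by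
  have hi : Integrable fun x => ‖f x‖ ^ 2 := hf.integrable_norm_pow (by norm_num)
  rw [← integral_const_mul]
  refine integral_mono_of_nonneg (Eventually.of_forall fun x => by positivity) (hi.const_mul _)
    (Eventually.of_forall fun x => ?_)
  have hG : 0 ≤ G := (norm_nonneg _).trans (hg x)
  calc (‖f x‖ * ‖g x‖ * ‖h x‖) ^ 2 ≤ (‖f x‖ * G * H) ^ 2 := by
        gcongr
        · exact hg x
        · exact hh x
    _ = _ := by ring

theorem memLp_mul_mul {f g h : ℝ → ℂ} (hf : MemLp f 2) (hgc : Continuous g) (hhc : Continuous h)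
    {G H : ℝ} (hg : ∀ x, ‖g x‖ ≤ G) (hh : ∀ x, ‖h x‖ ≤ H) :
    MemLp (fun x => f x * g x * h x) 2 := by
  refine hf.of_le_mul (c := G * H) ?_ (Eventually.of_forall fun x => ?_)
  · exact (hf.1.mul hgc.aestronglyMeasurable).mul hhc.aestronglyMeasurable
  · have hG : 0 ≤ G := (norm_nonneg _).trans (hg x)
    rw [norm_mul, norm_mul]
    calc ‖f x‖ * ‖g x‖ * ‖h x‖ ≤ ‖f x‖ * G * H := by
          gcongr
          · exact hg x
          · exact hh x
      _ = _ := by ring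

/-- The product `u ū' u''` for partial sums of Hermite series. -/
def partialMul (a b c : WeightedL2 (1 / 2)) (N : ℕ) (x : ℝ) : ℂ :=
  a.partialSum N x * star (b.partialSum N x) * c.partialSum N x

/-- The derivative of the product of partial sums. -/
def partialMulDeriv (a b c : WeightedL2 (1 / 2)) (N : ℕ) (x : ℝ) : ℂ :=
  (a.partialSumDeriv N x * star (b.partialSum N x) * c.partialSum N x +
    star (b.partialSumDeriv N x) * a.partialSum N x * c.partialSum N x) +
    c.partialSumDeriv N x * a.partialSum N x * star (b.partialSum N x)

theorem hasDerivAt_partialMul (a b c : WeightedL2 (1 / 2)) (N : ℕ) (x : ℝ) :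
    HasDerivAt (partialMul a b c N) (partialMulDeriv a b c N x) x := by
  have h := ((a.hasDerivAt_partialSum N x).mul (b.hasDerivAt_partialSum N x).star).mul
    (c.hasDerivAt_partialSum N x)
  refine HasDerivAt.congr_deriv (f := partialMul a b c N) h ?_
  rw [partialMulDeriv, Pi.mul_apply]; ring

/-- The product rule leaves one differentiated factor in `L²` and two factors bounded by Sobolev.
Partial sums are used because they are smooth, with bounds uniform in `N`. -/
theorem sum_hermiteCoeff_partialMul_le (a b c : WeightedL2 (1 / 2)) (N : ℕ) (s : Finset ℕ) :
    ∑ n ∈ s, (1 + n : ℝ) * ‖hermiteCoeff (partialMul a b c N) n‖ ^ 2 ≤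
      (13 * ‖a‖ * ‖b‖ * ‖c‖) ^ 2 := by
  have sq_int : ∀ {w : ℝ → ℂ}, MemLp w 2 → Integrable fun x => ‖w x‖ ^ 2 :=
    fun hw => hw.integrable_norm_pow (by norm_num)
  have nn : ∀ w : ℝ → ℂ, 0 ≤ ∫ x, ‖w x‖ ^ 2 := fun w => integral_nonneg fun x => by positivity
  have bs : ∀ x, ‖star (b.partialSum N x)‖ ≤ 2 * ‖b‖ := fun x => by
    rw [norm_star]; exact b.norm_partialSum_le N x
  have as := a.norm_partialSum_le N
  have cs := c.norm_partialSum_le N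
  have ac := a.continuous_partialSum N
  have bc : Continuous fun x => star (b.partialSum N x) := (b.continuous_partialSum N).star
  have cc := c.continuous_partialSum N
  have m1 := memLp_mul_mul (a.memLp_partialSumDeriv N) bc cc bs cs
  have m2 := memLp_mul_mul (b.memLp_partialSumDeriv N).star ac cc as cs
  have m3 := memLp_mul_mul (c.memLp_partialSumDeriv N) ac bc as bs
  have mx' := memLp_mul_mul (a.memLp_mul_partialSum N) bc cc bs cs
  have mw : MemLp (partialMul a b c N) 2 := memLp_mul_mul (a.memLp_partialSum N) bc cc bs cs
  have mv : MemLp (partialMulDeriv a b c N) 2 := (m1.add m2).add m3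
  have mx : MemLp (fun x : ℝ => (x : ℂ) * partialMul a b c N x) 2 := by
    refine mx'.ae_eq (Eventually.of_forall fun x => ?_)
    simp only [partialMul]; ring
  have h := hasSum_energy mw mv mx (isHermiteDeriv_of_hasDerivAt (hasDerivAt_partialMul a b c N) mw mv)
  have e1 := a.integral_partialSum_energy_le N
  have e2 := b.integral_partialSum_energy_le N
  have e3 := c.integral_partialSum_energy_le N
  have nx : ∀ w : ℝ → ℂ, 0 ≤ ∫ x : ℝ, ‖(x : ℂ) * w x‖ ^ 2 :=
    fun w => integral_nonneg fun x => by positivity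
  have i1 : ∫ x, (‖a.partialSumDeriv N x‖ * ‖star (b.partialSum N x)‖ * ‖c.partialSum N x‖) ^ 2 ≤
      (2 * ‖b‖) ^ 2 * (2 * ‖c‖) ^ 2 * (2 * ‖a‖ ^ 2) :=
    (integral_norm_mul_mul_sq_le (a.memLp_partialSumDeriv N) bs cs).trans (by
      gcongr; linarith [nn (a.partialSum N), nx (a.partialSum N)])
  have i2 : ∫ x, (‖star (b.partialSumDeriv N x)‖ * ‖a.partialSum N x‖ * ‖c.partialSum N x‖) ^ 2 ≤
      (2 * ‖a‖) ^ 2 * (2 * ‖c‖) ^ 2 * (2 * ‖b‖ ^ 2) :=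
    (integral_norm_mul_mul_sq_le (b.memLp_partialSumDeriv N).star as cs).trans (by
      simp only [Pi.star_apply, norm_star]
      gcongr; linarith [nn (b.partialSum N), nx (b.partialSum N)])
  have i3 : ∫ x, (‖c.partialSumDeriv N x‖ * ‖a.partialSum N x‖ * ‖star (b.partialSum N x)‖) ^ 2 ≤
      (2 * ‖a‖) ^ 2 * (2 * ‖b‖) ^ 2 * (2 * ‖c‖ ^ 2) :=
    (integral_norm_mul_mul_sq_le (c.memLp_partialSumDeriv N) as bs).trans (by
      gcongr; linarith [nn (c.partialSum N), nx (c.partialSum N)])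
  have i4 : ∫ x : ℝ, ‖(x : ℂ) * partialMul a b c N x‖ ^ 2 ≤
      (2 * ‖b‖) ^ 2 * (2 * ‖c‖) ^ 2 * ∫ x : ℝ, ‖(x : ℂ) * a.partialSum N x‖ ^ 2 := by
    refine le_of_eq_of_le ?_ (integral_norm_mul_mul_sq_le (a.memLp_mul_partialSum N) bs cs)
    congr 1; ext x
    simp only [partialMul, norm_mul]; ring
  have i5 : ∫ x : ℝ, ‖partialMul a b c N x‖ ^ 2 ≤
      (2 * ‖b‖) ^ 2 * (2 * ‖c‖) ^ 2 * ∫ x : ℝ, ‖a.partialSum N x‖ ^ 2 := by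
    refine le_of_eq_of_le ?_ (integral_norm_mul_mul_sq_le (a.memLp_partialSum N) bs cs)
    simp only [partialMul, norm_mul]
  have i6 : ∫ x, ‖partialMulDeriv a b c N x‖ ^ 2 ≤
      3 * ((∫ x, (‖a.partialSumDeriv N x‖ * ‖star (b.partialSum N x)‖ * ‖c.partialSum N x‖) ^ 2) +
      (∫ x, (‖star (b.partialSumDeriv N x)‖ * ‖a.partialSum N x‖ * ‖c.partialSum N x‖) ^ 2) +
      ∫ x, (‖c.partialSumDeriv N x‖ * ‖a.partialSum N x‖ * ‖star (b.partialSum N x)‖) ^ 2) := by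
    have j1 := sq_int m1
    have j2 := sq_int m2
    have j3 := sq_int m3
    simp only [norm_mul, Pi.star_apply] at j1 j2 j3
    have j12 : Integrable fun x => (‖a.partialSumDeriv N x‖ * ‖star (b.partialSum N x)‖ *
      ‖c.partialSum N x‖) ^ 2 + (‖star (b.partialSumDeriv N x)‖ * ‖a.partialSum N x‖ *
      ‖c.partialSum N x‖) ^ 2 := j1.add j2
    rw [← integral_add j1 j2, ← integral_add j12 j3, ← integral_const_mul]
    refine integral_mono (sq_int mv) ((j12.add j3).const_mul 3) fun x => ?_
    have hle : ‖partialMulDeriv a b c N x‖ ≤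
        ‖a.partialSumDeriv N x‖ * ‖star (b.partialSum N x)‖ * ‖c.partialSum N x‖ +
        ‖star (b.partialSumDeriv N x)‖ * ‖a.partialSum N x‖ * ‖c.partialSum N x‖ +
        ‖c.partialSumDeriv N x‖ * ‖a.partialSum N x‖ * ‖star (b.partialSum N x)‖ := by
      rw [partialMulDeriv]
      refine norm_add₃_le.trans_eq ?_
      simp only [norm_mul]
    refine (pow_le_pow_left₀ (norm_nonneg _) hle 2).trans ?_
    generalize ‖a.partialSumDeriv N x‖ * ‖star (b.partialSum N x)‖ * ‖c.partialSum N x‖ = p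
    generalize ‖star (b.partialSumDeriv N x)‖ * ‖a.partialSum N x‖ * ‖c.partialSum N x‖ = q
    generalize ‖c.partialSumDeriv N x‖ * ‖a.partialSum N x‖ * ‖star (b.partialSum N x)‖ = r
    nlinarith [sq_nonneg (p - q), sq_nonneg (q - r), sq_nonneg (p - r)]
  have i7 : (2 * ‖b‖) ^ 2 * (2 * ‖c‖) ^ 2 * ((∫ x : ℝ, ‖(x : ℂ) * a.partialSum N x‖ ^ 2) +
      ∫ x : ℝ, ‖a.partialSum N x‖ ^ 2) ≤ (2 * ‖b‖) ^ 2 * (2 * ‖c‖) ^ 2 * (2 * ‖a‖ ^ 2) := by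
    gcongr; linarith [nn (a.partialSumDeriv N)]
  have hs := sum_le_hasSum s (fun n _ => by positivity) h
  rw [← Finset.mul_sum] at hs
  -- The energy is at most `3(32 + 32 + 32) + 32 = 320` times this product, and it equals twice the
  -- weighted sum; the constant comes from `160 ≤ 13²`.
  have hpos : 0 ≤ ‖a‖ ^ 2 * ‖b‖ ^ 2 * ‖c‖ ^ 2 := by positivity
  nlinarith

theorem tendsto_hermiteCoeff_partialMul (a b c : WeightedL2 (1 / 2)) (n : ℕ) :
    Tendsto (fun N => hermiteCoeff (partialMul a b c N) n) atTop
      (𝓝 (hermiteCoeff (evalMul a b c) n)) := by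
  refine tendsto_integral_of_dominated_convergence
    (fun x => |hermiteFun n x| * ((2 * ‖a‖) * (2 * ‖b‖) * (2 * ‖c‖))) (fun N => ?_) ?_
    (fun N => Eventually.of_forall fun x => ?_) (Eventually.of_forall fun x => ?_)
  · have h : Continuous (partialMul a b c N) :=
      continuous_iff_continuousAt.2 fun x => (hasDerivAt_partialMul a b c N x).continuousAt
    have := continuous_hermiteFun n
    fun_prop
  · simpa using (integrable_pow_mul_hermiteFun n 0).mul_const ((2 * ‖a‖) * (2 * ‖b‖) * (2 * ‖c‖))
  · rw [norm_mul, Complex.norm_real, Real.norm_eq_abs, partialMul, norm_mul, norm_mul, norm_star]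
    gcongr
    · exact a.norm_partialSum_le N x
    · exact b.norm_partialSum_le N x
    · exact c.norm_partialSum_le N x
  · exact (((a.tendsto_partialSum x).mul (b.tendsto_partialSum x).star).mul
      (c.tendsto_partialSum x)).const_mul _

/-- Over a finite index set the limit `N → ∞` can be taken coefficient by coefficient, so the
limiting product need not be differentiated. -/
theorem sum_hermiteCoeff_evalMul_le (a b c : WeightedL2 (1 / 2)) (s : Finset ℕ) :
    ∑ n ∈ s, (1 + n : ℝ) * ‖hermiteCoeff (evalMul a b c) n‖ ^ 2 ≤ (13 * ‖a‖ * ‖b‖ * ‖c‖) ^ 2 :=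
  le_of_tendsto' (tendsto_finsetSum _ fun n _ =>
    ((tendsto_hermiteCoeff_partialMul a b c n).norm.pow 2).const_mul _)
    fun N => sum_hermiteCoeff_partialMul_le a b c N s

/-- The trilinear map `(u, u', u'') ↦ u ū' u''` in Hermite coefficients. -/
def trilinear (a b c : WeightedL2 (1 / 2)) : WeightedL2 (1 / 2) :=
  ⟨hermiteCoeff (evalMul a b c), (memWeightedL2_half_iff _).2
    (summable_of_sum_le (fun n => by positivity) (sum_hermiteCoeff_evalMul_le a b c))⟩

theorem trilinear_apply (a b c : WeightedL2 (1 / 2)) (n : ℕ) :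
    trilinear a b c n = hermiteCoeff (evalMul a b c) n := rfl

theorem norm_trilinear_le (a b c : WeightedL2 (1 / 2)) :
    ‖trilinear a b c‖ ≤ 13 * ‖a‖ * ‖b‖ * ‖c‖ := by
  refine le_of_sq_le_sq ?_ (by positivity)
  rw [norm_half_sq]
  exact Real.tsum_le_of_sum_le (fun n => by positivity) (sum_hermiteCoeff_evalMul_le a b c)

theorem trilinear_sub_left (a a' b c : WeightedL2 (1 / 2)) :
    trilinear (a - a') b c = trilinear a b c - trilinear a' b c := by
  ext n
  rw [sub_apply, trilinear_apply, trilinear_apply, trilinear_apply,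
    ← hermiteCoeff_sub (memLp_evalMul _ _ _) (memLp_evalMul _ _ _)]
  congr 1; ext x; simp only [evalMul, eval_sub]; ring

theorem trilinear_sub_middle (a b b' c : WeightedL2 (1 / 2)) :
    trilinear a (b - b') c = trilinear a b c - trilinear a b' c := by
  ext n
  rw [sub_apply, trilinear_apply, trilinear_apply, trilinear_apply,
    ← hermiteCoeff_sub (memLp_evalMul _ _ _) (memLp_evalMul _ _ _)]
  congr 1; ext x; simp only [evalMul, eval_sub, star_sub]; ring

theorem trilinear_sub_right (a b c c' : WeightedL2 (1 / 2)) :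
    trilinear a b (c - c') = trilinear a b c - trilinear a b c' := by
  ext n
  rw [sub_apply, trilinear_apply, trilinear_apply, trilinear_apply,
    ← hermiteCoeff_sub (memLp_evalMul _ _ _) (memLp_evalMul _ _ _)]
  congr 1; ext x; simp only [evalMul, eval_sub]; ring

theorem _root_.HasSum.mul_of_summable_norm {ι κ : Type*} {f : ι → ℂ} {g : κ → ℂ} {F G : ℂ}
    (hf : HasSum f F) (hg : HasSum g G) (nf : Summable fun k => ‖f k‖)
    (ng : Summable fun k => ‖g k‖) : HasSum (fun m : ι × κ => f m.1 * g m.2) (F * G) :=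
  hf.mul hg (summable_mul_of_summable_norm nf ng)

theorem _root_.hasSum_mul_mul {f g h : ℕ → ℂ} {F G H : ℂ} (hf : HasSum f F) (hg : HasSum g G)
    (hh : HasSum h H) (nf : Summable fun k => ‖f k‖) (ng : Summable fun k => ‖g k‖)
    (nh : Summable fun k => ‖h k‖) :
    HasSum (fun m : ℕ × ℕ × ℕ => f m.1 * (g m.2.1 * h m.2.2)) (F * (G * H)) := by
  set k : ℕ × ℕ → ℂ := fun m => g m.1 * h m.2 with hk
  have h1 : HasSum k (G * H) := hg.mul_of_summable_norm hh ng nh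
  have n1 : Summable fun m => ‖k m‖ := ng.mul_norm nh
  have h2 := hf.mul_of_summable_norm h1 nf n1
  simpa only [hk] using h2

theorem hasSum_eval_mul_eval_mul_eval (a b c : WeightedL2 (1 / 2)) (x : ℝ) :
    HasSum (fun m : ℕ × ℕ × ℕ => (a m.1 * (hermiteFun m.1 x : ℂ)) *
      (star (b m.2.1 * (hermiteFun m.2.1 x : ℂ)) * (c m.2.2 * (hermiteFun m.2.2 x : ℂ))))
      (a.eval x * (star (b.eval x) * c.eval x)) := by
  have sb : Summable fun k => ‖star (b k * (hermiteFun k x : ℂ))‖ := by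
    simpa only [norm_star] using b.summable_norm_mul_hermiteFun x
  have hb : HasSum (fun k => star (b k * (hermiteFun k x : ℂ))) (star (b.eval x)) :=
    (b.hasSum_eval x).star
  have sa := a.summable_norm_mul_hermiteFun x
  have sc := c.summable_norm_mul_hermiteFun x
  have ha := a.hasSum_eval x
  have hc := c.hasSum_eval x
  have h := hasSum_mul_mul ha hb hc sa sb sc
  exact h

/-- The triple series for the coefficients of `u ū' u''` converges unconditionally. -/
theorem hasSum_hermiteK_mul (a b c : WeightedL2 (1 / 2)) (n : ℕ) :
    HasSum (fun m : ℕ × ℕ × ℕ =>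
      (hermiteK n m.1 m.2.1 m.2.2 : ℂ) * a m.1 * star (b m.2.1) * c m.2.2) (trilinear a b c n) := by
  set A : ℕ → ℝ := fun k => ‖a k‖ * (1 + k : ℝ) ^ (-(1 / 4) : ℝ) with hA
  set B : ℕ → ℝ := fun k => ‖b k‖ * (1 + k : ℝ) ^ (-(1 / 4) : ℝ) with hB
  set C : ℕ → ℝ := fun k => ‖c k‖ * (1 + k : ℝ) ^ (-(1 / 4) : ℝ) with hC
  have A0 : ∀ k, 0 ≤ A k := fun k => by positivity
  have B0 : ∀ k, 0 ≤ B k := fun k => by positivity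
  have C0 : ∀ k, 0 ≤ C k := fun k => by positivity
  let f : ℕ × ℕ × ℕ → ℝ → ℂ := fun m x => (hermiteFun n x : ℂ) *
    ((a m.1 * (hermiteFun m.1 x : ℂ)) * (star (b m.2.1 * (hermiteFun m.2.1 x : ℂ)) *
      (c m.2.2 * (hermiteFun m.2.2 x : ℂ))))
  have hf : ∀ m x, f m x = a m.1 * star (b m.2.1) * c m.2.2 *
      ((hermiteFun n x * (hermiteFun m.1 x * hermiteFun m.2.1 x * hermiteFun m.2.2 x) : ℝ) : ℂ) := by
    intro m x
    simp only [f, star_mul', Complex.star_def, Complex.conj_ofReal]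
    push_cast; ring
  -- Each of the three series contributes a factor `2(1 + |x|)`, whence the exponent `3` and the
  -- constant `8`; `φₙ` keeps the result integrable.
  have hint := integrable_pow_mul_hermiteFun n 3
  have hle : ∀ m x, ‖f m x‖ ≤ (8 * (A m.1 * (B m.2.1 * C m.2.2))) *
      ((1 + |x|) ^ 3 * |hermiteFun n x|) := by
    intro m x
    have h1 := a.norm_mul_hermiteFun_le m.1 x
    have h2 := b.norm_mul_hermiteFun_le m.2.1 x
    have h3 := c.norm_mul_hermiteFun_le m.2.2 x
    simp only [f]
    rw [norm_mul, norm_mul, norm_mul (star _), norm_star, Complex.norm_real, Real.norm_eq_abs]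
    calc |hermiteFun n x| * (‖a m.1 * (hermiteFun m.1 x : ℂ)‖ * (‖b m.2.1 * (hermiteFun m.2.1 x : ℂ)‖ *
          ‖c m.2.2 * (hermiteFun m.2.2 x : ℂ)‖))
        ≤ |hermiteFun n x| * ((2 * (1 + |x|) * A m.1) * ((2 * (1 + |x|) * B m.2.1) *
          (2 * (1 + |x|) * C m.2.2))) := by gcongr
      _ = _ := by ring
  have hcont : ∀ m, Continuous (f m) := fun m => by
    have h1 := continuous_hermiteFun n
    have h2 := fun k => continuous_hermiteFun k
    simp only [f]
    fun_prop
  have hfi : ∀ m, Integrable (f m) := fun m =>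
    (hint.const_mul _).mono' (hcont m).aestronglyMeasurable (Eventually.of_forall (hle m))
  have hsum : Summable fun m : ℕ × ℕ × ℕ => A m.1 * (B m.2.1 * C m.2.2) := by
    have h1 := b.summable_quarter.mul_of_nonneg c.summable_quarter B0 C0
    exact a.summable_quarter.mul_of_nonneg h1 A0 fun m => mul_nonneg (B0 _) (C0 _)
  -- Absolute summability of the integrals allows the triple sum and the integral to be exchanged.
  have hS : Summable fun m => ∫ x, ‖f m x‖ := by
    refine ((hsum.mul_left 8).mul_right (∫ x, (1 + |x|) ^ 3 * |hermiteFun n x|)).of_nonneg_of_le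
      (fun m => integral_nonneg fun x => norm_nonneg _) fun m => ?_
    rw [← integral_const_mul]
    exact integral_mono (hfi m).norm (hint.const_mul _) (hle m)
  have h := hasSum_integral_of_summable_integral_norm hfi hS
  have hpt : ∀ x, HasSum (fun m => f m x) ((hermiteFun n x : ℂ) * evalMul a b c x) := fun x => by
    rw [evalMul, mul_assoc]
    exact (hasSum_eval_mul_eval_mul_eval a b c x).mul_left (hermiteFun n x : ℂ)
  simp_rw [fun x => (hpt x).tsum_eq] at h
  refine h.congr_fun fun m => ?_
  simp_rw [hf]
  rw [integral_const_mul, integral_complex_ofReal, hermiteK]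
  ring

end WeightedL2

/-! ### The quartic functional -/

namespace WeightedL2

/-- The functional `∫ |u|⁴`. -/
def quartic (a : WeightedL2 (1 / 2)) : ℝ := ∫ x, ‖a.eval x‖ ^ 4

theorem integrable_norm_eval_sq (a : WeightedL2 (1 / 2)) : Integrable fun x => ‖a.eval x‖ ^ 2 :=
  a.memLp_eval.integrable_norm_pow (by norm_num)

theorem integrable_norm_eval_pow_four (a : WeightedL2 (1 / 2)) :
    Integrable fun x => ‖a.eval x‖ ^ 4 := by
  refine (a.integrable_norm_eval_sq.const_mul ((2 * ‖a‖) ^ 2)).mono'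
    (a.memLp_eval.1.norm.pow 4) (Eventually.of_forall fun x => ?_)
  rw [Real.norm_of_nonneg (by positivity), show 4 = 2 + 2 by norm_num, pow_add]
  gcongr
  exact a.norm_eval_le x

theorem quartic_nonneg (a : WeightedL2 (1 / 2)) : 0 ≤ a.quartic :=
  integral_nonneg fun x => by positivity

/-- A Gagliardo-Nirenberg inequality: the supremum bound on `|u|²` times `∫ |u|²`. -/
theorem quartic_le (a : WeightedL2 (1 / 2)) : a.quartic ≤ 4 * (√a.mass * ‖a‖) * a.mass := by
  rw [quartic, ← integral_norm_eval_sq, ← integral_const_mul]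
  refine integral_mono a.integrable_norm_eval_pow_four (a.integrable_norm_eval_sq.const_mul _)
    fun x => ?_
  simp only
  rw [show 4 = 2 + 2 by norm_num, pow_add, integral_norm_eval_sq]
  gcongr
  exact a.norm_eval_sq_le x

theorem hasSum_star_trilinear_mul (a h : WeightedL2 (1 / 2)) :
    HasSum (fun n => star (trilinear a a a n) * h n)
      (∫ x, star (evalMul a a a x) * h.eval x) := by
  have := hasSum_star_hermiteCoeff_mul (memLp_evalMul a a a) h.memLp_eval
  rwa [hermiteCoeff_eval] at this

theorem hasSum_star_trilinear_mul_self (a : WeightedL2 (1 / 2)) :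
    HasSum (fun n => star (trilinear a a a n) * a n) (a.quartic : ℂ) := by
  have h := hasSum_star_trilinear_mul a a
  have h1 : ∀ x, star (evalMul a a a x) * a.eval x = ((‖a.eval x‖ ^ 4 : ℝ) : ℂ) := fun x => by
    have h2 : star (a.eval x) * a.eval x = ((‖a.eval x‖ ^ 2 : ℝ) : ℂ) := by
      rw [← Complex.normSq_eq_norm_sq, Complex.normSq_eq_conj_mul_self]; rfl
    calc star (evalMul a a a x) * a.eval x
        = (star (a.eval x) * a.eval x) * (star (a.eval x) * a.eval x) := by
          rw [evalMul, star_mul', star_mul', star_star]; ring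
      _ = _ := by rw [h2]; push_cast; ring
  simp_rw [h1] at h
  rwa [integral_complex_ofReal] at h

theorem _root_.abs_norm_add_pow_four_sub_le (z w : ℂ) :
    |‖z + w‖ ^ 4 - ‖z‖ ^ 4 - 4 * (star (z * star z * z) * w).re| ≤
      6 * (‖z‖ + ‖w‖) ^ 2 * ‖w‖ ^ 2 := by
  set r := (star z * w).re with hr
  have h1 : (star (z * star z * z) * w).re = ‖z‖ ^ 2 * r := by
    have h2 : star z * z = ((‖z‖ ^ 2 : ℝ) : ℂ) := by
      rw [← Complex.normSq_eq_norm_sq, Complex.normSq_eq_conj_mul_self]; rfl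
    have : star (z * star z * z) * w = (star z * z) * (star z * w) := by
      rw [star_mul', star_mul', star_star]; ring
    rw [this, h2, Complex.re_ofReal_mul]
  have h3 : ‖z + w‖ ^ 2 = ‖z‖ ^ 2 + 2 * r + ‖w‖ ^ 2 := by
    simp only [← Complex.normSq_eq_norm_sq, hr, Complex.normSq_apply]
    simp
    ring
  have h4 : |r| ≤ ‖z‖ * ‖w‖ := by
    refine (Complex.abs_re_le_norm _).trans_eq ?_
    rw [norm_mul, norm_star]
  have h5 : ‖z + w‖ ^ 4 = (‖z‖ ^ 2 + 2 * r + ‖w‖ ^ 2) ^ 2 := by rw [← h3]; ring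
  rw [h1, h5]
  have hz := norm_nonneg z
  have hw := norm_nonneg w
  generalize ‖z‖ = p at *
  generalize ‖w‖ = q at *
  have e : (p ^ 2 + 2 * r + q ^ 2) ^ 2 - p ^ 4 - 4 * (p ^ 2 * r) =
    2 * p ^ 2 * q ^ 2 + (2 * r + q ^ 2) ^ 2 := by ring
  have h6 : (2 * r + q ^ 2) ^ 2 ≤ (2 * (p * q) + q ^ 2) ^ 2 := by
    refine sq_le_sq.2 ?_
    rw [abs_of_nonneg (by positivity : 0 ≤ 2 * (p * q) + q ^ 2)]
    refine (abs_add_le _ _).trans ?_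
    rw [abs_mul, abs_two, abs_of_nonneg (sq_nonneg q)]
    gcongr
  rw [e, abs_of_nonneg (by positivity)]
  nlinarith [mul_nonneg (mul_nonneg hz hw) (sq_nonneg q), sq_nonneg (q ^ 2)]

/-- First-order Taylor expansion of `∫ |u|⁴`. The remainder is measured by the mass of `h`, which
interpolates between `l²_{1/2}` and `l²_{-1/2}`; solutions are differentiated only in the latter
space. -/
theorem abs_quartic_add_sub_le (a h : WeightedL2 (1 / 2)) :
    |(a + h).quartic - a.quartic - 4 * (∫ x, star (evalMul a a a x) * h.eval x).re| ≤
      24 * (‖a‖ + ‖h‖) ^ 2 * h.mass := by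
  have i1 := (a + h).integrable_norm_eval_pow_four
  have i2 := a.integrable_norm_eval_pow_four
  have i3 : Integrable fun x => star (evalMul a a a x) * h.eval x :=
    (memLp_evalMul a a a).star.integrable_mul h.memLp_eval
  have i12 : Integrable fun x => ‖(a + h).eval x‖ ^ 4 - ‖a.eval x‖ ^ 4 := i1.sub i2
  have hre : (∫ x, star (evalMul a a a x) * h.eval x).re =
      ∫ x, (star (evalMul a a a x) * h.eval x).re := (integral_re i3).symm
  have i4 : Integrable fun x => 4 * (star (evalMul a a a x) * h.eval x).re := i3.re.const_mul 4
  rw [quartic, quartic, hre, ← integral_const_mul, ← integral_sub i1 i2, ← integral_sub i12 i4,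
    ← integral_norm_eval_sq, ← integral_const_mul, ← Real.norm_eq_abs]
  refine norm_integral_le_of_norm_le (h.integrable_norm_eval_sq.const_mul _)
    (Eventually.of_forall fun x => ?_)
  rw [eval_add, Real.norm_eq_abs]
  refine (abs_norm_add_pow_four_sub_le _ _).trans ?_
  have h1 : 6 * (‖a.eval x‖ + ‖h.eval x‖) ^ 2 ≤ 6 * (2 * ‖a‖ + 2 * ‖h‖) ^ 2 := by
    gcongr
    · exact a.norm_eval_le x
    · exact h.norm_eval_le x
  calc _ ≤ 6 * (2 * ‖a‖ + 2 * ‖h‖) ^ 2 * ‖h.eval x‖ ^ 2 := by gcongr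
    _ = _ := by ring

end WeightedL2

/-! ### Differentiation of curves in weighted sequence spaces -/

namespace WeightedL2

variable {s r : ℝ}

/-- Multiplication by the weight as a linear isometry. -/
def toLpₗᵢ (s : ℝ) : WeightedL2 s →ₗᵢ[ℂ] lp (fun _ : ℕ => ℂ) 2 := ⟨toLp s, fun _ => rfl⟩

theorem toLp_apply (a : WeightedL2 s) (n : ℕ) :
    toLpₗᵢ s a n = (((1 + n : ℝ) ^ s : ℝ) : ℂ) * a n := rfl

theorem weight_ne_zero (s : ℝ) (n : ℕ) : (((1 + n : ℝ) ^ s : ℝ) : ℂ) ≠ 0 :=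
  Complex.ofReal_ne_zero.2 (Real.rpow_pos_of_pos (by positivity) s).ne'

theorem toLp_surjective (s : ℝ) : Function.Surjective (toLpₗᵢ s) := fun f => by
  have h : weightSeq s (fun n => (((1 + n : ℝ) ^ s : ℝ) : ℂ)⁻¹ * f n) = f := by
    ext n
    exact mul_inv_cancel_left₀ (weight_ne_zero s n) _
  refine ⟨⟨fun n => (((1 + n : ℝ) ^ s : ℝ) : ℂ)⁻¹ * f n, (memWeightedL2_iff s _).2 ?_⟩, ?_⟩
  · rw [h]; exact f.2
  · exact Subtype.ext h

instance : CompleteSpace (WeightedL2 s) :=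
  (LinearIsometryEquiv.ofSurjective (toLpₗᵢ s) (toLp_surjective s)).toIsometryEquiv.completeSpace

theorem norm_apply_le (a : WeightedL2 s) (n : ℕ) : ‖a n‖ ≤ ((1 + n : ℝ) ^ s)⁻¹ * ‖a‖ := by
  have h := lp.norm_apply_le_norm two_ne_zero (toLpₗᵢ s a) n
  have h1 : (0 : ℝ) < (1 + n : ℝ) ^ s := Real.rpow_pos_of_pos (by positivity) s
  rw [toLp_apply, norm_mul, Complex.norm_real, Real.norm_of_nonneg h1.le,
    LinearIsometry.norm_map] at h
  rwa [← div_eq_inv_mul, le_div_iff₀ h1, mul_comm]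

/-- The coordinate functionals. -/
def coord (s : ℝ) (n : ℕ) : WeightedL2 s →L[ℂ] ℂ :=
  LinearMap.mkContinuous ⟨⟨fun a => a n, fun _ _ => rfl⟩, fun _ _ => rfl⟩ _ (fun a => norm_apply_le a n)

theorem coord_apply (a : WeightedL2 s) (n : ℕ) : coord s n a = a n := rfl

/-- The fundamental theorem of calculus in each coordinate shows that `e` is the vector-valued
integral of the continuous curve `h`, so it is differentiable in norm. -/
theorem hasDerivWithinAt_of_coord {e h : ℝ → WeightedL2 s} {α β : ℝ}
    (hh : ContinuousOn h (Icc α β))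
    (hd : ∀ t ∈ Icc α β, ∀ n, HasDerivWithinAt (fun τ => e τ n) (h t n) (Icc α β) t) :
    ∀ t ∈ Icc α β, HasDerivWithinAt e (h t) (Icc α β) t := by
  intro t ht
  have hαβ : α ≤ β := ht.1.trans ht.2
  -- With a right side independent of the state, `ODE.picard` is just `e α` plus the integral of
  -- `h`.
  have hp := ODE.hasDerivWithinAt_picard_Icc (f := fun τ (_ : WeightedL2 s) => h τ)
    (α := fun _ => (0 : WeightedL2 s)) (u := univ) (left_mem_Icc.2 hαβ)
    (hh.comp continuousOn_fst fun p hp => hp.1) continuousOn_const (fun _ _ => mem_univ _) (e α) ht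
  have heq : ∀ τ ∈ Icc α β, e τ = ODE.picard (fun τ (_ : WeightedL2 s) => h τ) α (e α)
      (fun _ => (0 : WeightedL2 s)) τ := by
    intro τ hτ
    have hsub : Icc α τ ⊆ Icc α β := Icc_subset_Icc_right hτ.2
    have hint : IntervalIntegrable h volume α τ :=
      (hh.mono (by rw [uIcc_of_le hτ.1]; exact hsub)).intervalIntegrable
    ext n
    rw [ODE.picard_apply, add_apply, ← coord_apply (∫ τ in α..τ, h τ),
      ← ContinuousLinearMap.intervalIntegral_comp_comm _ hint]
    have hc : ContinuousOn (fun t => h t n) (Icc α β) := (coord s n).continuous.comp_continuousOn hh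
    have := intervalIntegral.integral_eq_sub_of_hasDeriv_right (f := fun t => e t n)
      (f' := fun t => h t n) (a := α) (b := τ)
      (by
        rw [uIcc_of_le hτ.1]
        exact fun t ht => ((hd t (hsub ht) n).mono hsub).continuousWithinAt)
      (fun t ht => by
        rw [min_eq_left hτ.1, max_eq_right hτ.1] at ht
        exact ((hd t (hsub (Ioo_subset_Icc_self ht)) n).hasDerivAt
          (Icc_mem_nhds ht.1 (ht.2.trans_le hτ.2))).hasDerivWithinAt)
      ((hc.mono (by rw [uIcc_of_le hτ.1]; exact hsub)).intervalIntegrable)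
    simp only [coord_apply]
    rw [this]; ring
  exact hp.congr (fun τ hτ => heq τ hτ) (heq t ht)

theorem hasDerivAt_of_coord {e h : ℝ → WeightedL2 s} (hh : Continuous h)
    (hd : ∀ t n, HasDerivAt (fun τ => e τ n) (h t n) t) (t : ℝ) : HasDerivAt e (h t) t :=
  (hasDerivWithinAt_of_coord (α := t - 1) (β := t + 1) hh.continuousOn
    (fun τ _ n => (hd τ n).hasDerivWithinAt) t ⟨by linarith, by linarith⟩).hasDerivAt
    (Icc_mem_nhds (by linarith) (by linarith))

/-! ### The free evolution -/

/-- The phases `exp(-i n t)`. -/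
def phase (t : ℝ) (n : ℕ) : ℂ := Complex.exp (-(Complex.I * n * t))

theorem norm_phase (t : ℝ) (n : ℕ) : ‖phase t n‖ = 1 := by
  have : phase t n = Complex.exp ((-(n * t) : ℝ) * Complex.I) := by
    rw [phase]; congr 1; push_cast; ring
  rw [this, Complex.norm_exp_ofReal_mul_I]

theorem phase_neg_mul (t : ℝ) (n : ℕ) : phase (-t) n * phase t n = 1 := by
  rw [phase, phase, ← Complex.exp_add]
  push_cast
  rw [show -(Complex.I * n * -(t : ℂ)) + -(Complex.I * n * t) = 0 by ring, Complex.exp_zero]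

theorem phase_zero (n : ℕ) : phase 0 n = 1 := by simp [phase]

theorem hasDerivAt_phase (t : ℝ) (n : ℕ) :
    HasDerivAt (fun τ => phase τ n) (-(Complex.I * n) * phase t n) t := by
  have h1 : HasDerivAt (fun τ : ℝ => -(Complex.I * n * (τ : ℂ))) (-(Complex.I * n * 1)) t :=
    ((Complex.ofRealCLM.hasDerivAt (x := t)).const_mul (Complex.I * n)).neg
  have h2 := h1.cexp
  refine h2.congr_deriv ?_
  rw [phase]; ring

theorem hasDerivAt_phase_neg (t : ℝ) (n : ℕ) :
    HasDerivAt (fun τ => phase (-τ) n) (Complex.I * n * phase (-t) n) t := by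
  have h := (hasDerivAt_phase (-t) n).scomp t (hasDerivAt_neg t)
  refine HasDerivAt.congr_deriv (f := fun τ => phase (-τ) n) h ?_
  simp

/-- The free evolution `aₙ ↦ exp(-i n t) aₙ`. -/
def rot (t : ℝ) (a : WeightedL2 s) : WeightedL2 s :=
  ⟨fun n => phase t n * a n, by
    have h := a.2
    change Summable _ at h
    change Summable _
    simpa only [norm_mul, norm_phase, one_mul] using h⟩

theorem rot_apply (t : ℝ) (a : WeightedL2 s) (n : ℕ) : rot t a n = phase t n * a n := rfl

theorem rot_sub (t : ℝ) (a b : WeightedL2 s) : rot t (a - b) = rot t a - rot t b := by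
  ext n; simp only [rot_apply, sub_apply]; ring

theorem rot_zero (a : WeightedL2 s) : rot 0 a = a := by
  ext n; rw [rot_apply, phase_zero, one_mul]

theorem norm_rot (t : ℝ) (a : WeightedL2 s) : ‖rot t a‖ = ‖a‖ := by
  have h : ‖rot t a‖ ^ 2 = ‖a‖ ^ 2 := by
    rw [norm_sq_eq, norm_sq_eq]
    simp only [rot_apply, norm_mul, norm_phase, one_mul]
  exact (sq_eq_sq₀ (norm_nonneg _) (norm_nonneg _)).1 h

theorem mass_rot (t : ℝ) (a : WeightedL2 (1 / 2)) : (rot t a).mass = a.mass := by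
  simp only [mass, rot_apply, norm_mul, norm_phase, one_mul]

theorem continuous_rot_left (a : WeightedL2 s) : Continuous fun t => rot t a := by
  rw [continuous_iff_continuousAt]
  intro t
  have h : Tendsto (fun τ => ‖rot τ a - rot t a‖ ^ 2) (𝓝 t) (𝓝 0) := by
    simp_rw [norm_sq_eq]
    have h0 : (∑' n : ℕ, (0 : ℝ)) = 0 := tsum_zero
    rw [← h0]
    have ha : Summable fun n : ℕ => (1 + n : ℝ) ^ (2 * s) * ‖a n‖ ^ 2 := a.2
    refine tendsto_tsum_of_dominated_convergence (ha.mul_left 4) (fun n => ?_)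
      (Eventually.of_forall fun τ n => ?_)
    · have hc : Continuous fun τ => phase τ n :=
        continuous_iff_continuousAt.2 fun τ => (hasDerivAt_phase τ n).continuousAt
      have h1 : Continuous fun τ => (1 + n : ℝ) ^ (2 * s) * ‖(rot τ a - rot t a) n‖ ^ 2 := by
        simp only [sub_apply, rot_apply]
        fun_prop
      simpa [zero_apply] using h1.tendsto t
    · rw [Real.norm_of_nonneg (by positivity), sub_apply, rot_apply, rot_apply, ← sub_mul, norm_mul,
        mul_pow]
      have h2 : ‖phase τ n - phase t n‖ ≤ 2 := by
        refine (norm_sub_le _ _).trans ?_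
        rw [norm_phase, norm_phase]; norm_num
      calc (1 + n : ℝ) ^ (2 * s) * (‖phase τ n - phase t n‖ ^ 2 * ‖a n‖ ^ 2)
          ≤ (1 + n : ℝ) ^ (2 * s) * (2 ^ 2 * ‖a n‖ ^ 2) := by gcongr
        _ = _ := by ring
  have h2 := h.sqrt
  simp only [Real.sqrt_zero, Real.sqrt_sq (norm_nonneg _)] at h2
  exact tendsto_iff_norm_sub_tendsto_zero.2 h2

/-- Strong continuity in `t` together with the isometry property gives joint continuity. -/
theorem continuous_rot : Continuous fun p : ℝ × WeightedL2 s => rot p.1 p.2 := by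
  rw [continuous_iff_continuousAt]
  rintro ⟨t, a⟩
  have h1 : Tendsto (fun p : ℝ × WeightedL2 s => rot p.1 a) (𝓝 (t, a)) (𝓝 (rot t a)) :=
    ((continuous_rot_left a).comp continuous_fst).tendsto (t, a)
  have h2 : Tendsto (fun p : ℝ × WeightedL2 s => rot p.1 (p.2 - a)) (𝓝 (t, a)) (𝓝 0) := by
    rw [tendsto_zero_iff_norm_tendsto_zero]
    simp only [norm_rot]
    have : Continuous fun p : ℝ × WeightedL2 s => ‖p.2 - a‖ := by fun_prop
    simpa using this.tendsto (t, a)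
  have h3 := h1.add h2
  simp only [rot_sub, add_zero, add_sub_cancel] at h3
  exact h3

theorem _root_.ContinuousOn.rot {X : Type*} [TopologicalSpace X] {f : X → ℝ} {g : X → WeightedL2 s}
    {I : Set X} (hf : ContinuousOn f I) (hg : ContinuousOn g I) :
    ContinuousOn (fun x => WeightedL2.rot (f x) (g x)) I := by
  have h := continuous_rot.comp_continuousOn (hf.prodMk hg)
  exact h

theorem _root_.Continuous.rot {X : Type*} [TopologicalSpace X] {f : X → ℝ} {g : X → WeightedL2 s}
    (hf : Continuous f) (hg : Continuous g) :
    Continuous (fun x => WeightedL2.rot (f x) (g x)) := by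
  have h := continuous_rot.comp (hf.prodMk hg)
  exact h

end WeightedL2

/-! ### Semilinear equations -/

theorem norm_le_mul_exp_of_norm_deriv_le {X : Type*} [NormedAddCommGroup X] [NormedSpace ℝ X]
    {e h : ℝ → X} {K T : ℝ} (hT : 0 ≤ T)
    (hd : ∀ t ∈ Icc 0 T, HasDerivWithinAt e (h t) (Icc 0 T) t)
    (hb : ∀ t ∈ Icc 0 T, ‖h t‖ ≤ K * ‖e t‖) : ‖e T‖ ≤ ‖e 0‖ * Real.exp (K * T) := by
  have := norm_le_gronwallBound_of_norm_deriv_right_le (f := e) (f' := h) (δ := ‖e 0‖) (K := K)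
    (ε := 0) (a := 0) (b := T) (fun t ht => (hd t ht).continuousWithinAt)
    (fun t ht => (hd t (Ico_subset_Icc_self ht)).mono_of_mem_nhdsWithin (Icc_mem_nhdsGE_of_mem ht))
    le_rfl (fun t ht => by simpa using hb t (Ico_subset_Icc_self ht)) T ⟨hT, le_rfl⟩
  simpa [gronwallBound_ε0] using this

theorem norm_le_mul_exp_abs_of_norm_deriv_le {X : Type*} [NormedAddCommGroup X] [NormedSpace ℝ X]
    {e h : ℝ → X} {K t : ℝ}
    (hd : ∀ τ ∈ uIcc 0 t, HasDerivWithinAt e (h τ) (uIcc 0 t) τ)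
    (hb : ∀ τ ∈ uIcc 0 t, ‖h τ‖ ≤ K * ‖e τ‖) : ‖e t‖ ≤ ‖e 0‖ * Real.exp (K * |t|) := by
  rcases le_total 0 t with ht | ht
  · rw [uIcc_of_le ht] at hd hb
    rw [abs_of_nonneg ht]
    exact norm_le_mul_exp_of_norm_deriv_le ht hd hb
  · rw [uIcc_of_ge ht] at hd hb
    rw [abs_of_nonpos ht]
    have hmap : MapsTo (fun τ : ℝ => -τ) (Icc 0 (-t)) (Icc t 0) := fun τ hτ =>
      ⟨by linarith [hτ.2], by linarith [hτ.1]⟩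
    have := norm_le_mul_exp_of_norm_deriv_le (e := fun τ => e (-τ)) (h := fun τ => -h (-τ)) (K := K)
      (neg_nonneg.2 ht)
      (fun τ hτ => by
        have h1 := (hd (-τ) (hmap hτ)).scomp τ (hasDerivAt_neg τ).hasDerivWithinAt hmap
        simpa [Function.comp_def] using h1)
      (fun τ hτ => by simpa using hb (-τ) (hmap hτ))
    simpa using this

namespace WeightedL2

variable {s : ℝ}

theorem hasDerivWithinAt_coord {e : ℝ → WeightedL2 s} {e' : WeightedL2 s} {I : Set ℝ} {t : ℝ}
    (h : HasDerivWithinAt e e' I t) (n : ℕ) : HasDerivWithinAt (fun τ => e τ n) (e' n) I t := by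
  have h1 : HasFDerivAt (coord s n) ((coord s n).restrictScalars ℝ) (e t) :=
    ((coord s n).restrictScalars ℝ).hasFDerivAt
  exact h1.comp_hasDerivWithinAt t h

/-- Solutions of `i ȧ = D a + F(a)`, coordinate by coordinate, where `D` multiplies `aₙ` by `n`. -/
def IsSemilinearSol (F : WeightedL2 s → WeightedL2 s) (I : Set ℝ) (a : ℝ → WeightedL2 s) : Prop :=
  ContinuousOn a I ∧ ∀ t ∈ I, ∀ n : ℕ,
    HasDerivWithinAt (fun τ => a τ n) (-(Complex.I * (n * a t n + F (a t) n))) I t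

theorem IsSemilinearSol.mono {F : WeightedL2 s → WeightedL2 s} {I J : Set ℝ} {a : ℝ → WeightedL2 s}
    (h : IsSemilinearSol F I a) (hJ : J ⊆ I) : IsSemilinearSol F J a :=
  ⟨h.1.mono hJ, fun t ht n => (h.2 t (hJ ht) n).mono hJ⟩

theorem hasDerivWithinAt_rot_neg {e : ℝ → WeightedL2 s} {g : WeightedL2 s} {I : Set ℝ} {t : ℝ} {n : ℕ}
    (h : HasDerivWithinAt (fun τ => e τ n) (-(Complex.I * (n * e t n + g n))) I t) :
    HasDerivWithinAt (fun τ => rot (-τ) (e τ) n) (rot (-t) (-Complex.I • g) n) I t := by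
  have h1 : HasDerivWithinAt (fun τ => phase (-τ) n * e τ n) _ I t :=
    (hasDerivAt_phase_neg t n).hasDerivWithinAt.fun_mul h
  simp only [rot_apply, smul_apply]
  refine h1.congr_deriv ?_
  ring

theorem hasDerivWithinAt_rot {e : ℝ → WeightedL2 s} {g : WeightedL2 s} {I : Set ℝ} {t : ℝ} {n : ℕ}
    (h : HasDerivWithinAt (fun τ => e τ n) (rot (-t) (-Complex.I • g) n) I t) :
    HasDerivWithinAt (fun τ => rot τ (e τ) n) (-(Complex.I * (n * rot t (e t) n + g n))) I t := by
  have h1 : HasDerivWithinAt (fun τ => phase τ n * e τ n) _ I t :=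
    (hasDerivAt_phase t n).hasDerivWithinAt.fun_mul h
  simp only [rot_apply, smul_apply] at h1 ⊢
  refine h1.congr_deriv ?_
  linear_combination (-Complex.I * g n) * phase_neg_mul t n

/-- Applying `rot (-τ)` to the difference cancels the unbounded linear part without changing norms,
and Grönwall's inequality applies to what remains. -/
theorem IsSemilinearSol.norm_sub_le {F : WeightedL2 s → WeightedL2 s} (hF : Continuous F)
    {a b : ℝ → WeightedL2 s} {t K : ℝ} (ha : IsSemilinearSol F (uIcc 0 t) a)
    (hb : IsSemilinearSol F (uIcc 0 t) b)
    (hK : ∀ τ ∈ uIcc 0 t, ‖F (a τ) - F (b τ)‖ ≤ K * ‖a τ - b τ‖) :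
    ‖a t - b t‖ ≤ ‖a 0 - b 0‖ * Real.exp (K * |t|) := by
  set g : ℝ → WeightedL2 s := fun τ => F (a τ) - F (b τ) with hg
  have hgc : ContinuousOn g (uIcc 0 t) :=
    (hF.comp_continuousOn ha.1).sub (hF.comp_continuousOn hb.1)
  have hrc : ContinuousOn (fun τ => rot (-τ) (-Complex.I • g τ)) (uIcc 0 t) :=
    continuous_neg.continuousOn.rot (hgc.const_smul (-Complex.I))
  have hco : ∀ τ ∈ uIcc 0 t, ∀ n, HasDerivWithinAt (fun τ => (a τ - b τ) n)
      (-(Complex.I * (n * (a τ - b τ) n + g τ n))) (uIcc 0 t) τ := fun τ hτ n => by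
    have h := (ha.2 τ hτ n).fun_sub (hb.2 τ hτ n)
    simp only [hg, sub_apply]
    refine h.congr_deriv ?_
    ring
  set e : ℝ → WeightedL2 s := fun τ => rot (-τ) (a τ - b τ) with he
  have hco' : ∀ τ ∈ uIcc 0 t, ∀ n, HasDerivWithinAt (fun τ => e τ n)
      (rot (-τ) (-Complex.I • g τ) n) (uIcc 0 t) τ := fun τ hτ n =>
    hasDerivWithinAt_rot_neg (e := fun τ => a τ - b τ) (g := g τ) (hco τ hτ n)
  have hd : ∀ τ ∈ uIcc 0 t, HasDerivWithinAt e (rot (-τ) (-Complex.I • g τ)) (uIcc 0 t) τ :=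
    hasDerivWithinAt_of_coord hrc hco'
  have hbd : ∀ τ ∈ uIcc 0 t, ‖rot (-τ) (-Complex.I • g τ)‖ ≤ K * ‖e τ‖ := fun τ hτ => by
    rw [he, norm_rot, norm_rot, norm_smul, norm_neg, Complex.norm_I, one_mul]
    exact hK τ hτ
  have := norm_le_mul_exp_abs_of_norm_deriv_le hd hbd
  simpa only [he, norm_rot] using this

open scoped NNReal in
-- Picard-Lindelöf for the rotated unknown. Since `F` is bounded by `B` everywhere, the ball of
-- radius `B * T` is never left, and `T` is arbitrary.
theorem exists_isSemilinearSol_Icc {F : WeightedL2 s → WeightedL2 s} {B K : ℝ≥0}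
    (hB : ∀ a, ‖F a‖ ≤ B) (hK : LipschitzWith K F) (a₀ : WeightedL2 s) (T : ℝ≥0) :
    ∃ a : ℝ → WeightedL2 s, a 0 = a₀ ∧ IsSemilinearSol F (Icc (-T) T) a := by
  set G : ℝ → WeightedL2 s → WeightedL2 s := fun t b => rot (-t) (-Complex.I • F (rot t b)) with hG
  have hpl : IsPicardLindelof G (tmin := -T) (tmax := T) ⟨0, by simp⟩ a₀ (B * T) 0 B K :=
    { lipschitzOnWith := fun t _ => by
        refine LipschitzWith.lipschitzOnWith (LipschitzWith.of_dist_le_mul fun x y => ?_)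
        have h1 := hK.norm_sub_le (rot t x) (rot t y)
        rw [← rot_sub, norm_rot] at h1
        rw [dist_eq_norm, dist_eq_norm]
        refine le_of_eq_of_le ?_ h1
        simp only [hG]
        rw [← rot_sub, ← smul_sub, norm_rot, norm_smul, norm_neg, Complex.norm_I, one_mul]
      continuousOn := fun x _ => by
        have h1 : Continuous fun t => F (rot t x) := hK.continuous.comp (continuous_rot_left x)
        exact (continuous_neg.rot (h1.const_smul (-Complex.I))).continuousOn
      norm_le := fun t _ x _ => by
        rw [hG]; simp only
        rw [norm_rot, norm_smul, norm_neg, Complex.norm_I, one_mul]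
        exact hB _
      mul_max_le := by simp }
  obtain ⟨b, hb0, hb⟩ := hpl.exists_eq_forall_mem_Icc_hasDerivWithinAt₀
  refine ⟨fun t => rot t (b t), ?_, ?_, fun t ht n => ?_⟩
  · simp only [rot_zero]; exact hb0
  · exact continuousOn_id.rot fun t ht => (hb t ht).continuousWithinAt
  · have h1 : HasDerivWithinAt (fun τ => b τ n) (rot (-t) (-Complex.I • F (rot t (b t))) n)
        (Icc (-T : ℝ) T) t := hasDerivWithinAt_coord (hb t ht) n
    exact hasDerivWithinAt_rot h1

open scoped NNReal in
theorem exists_isSemilinearSol {F : WeightedL2 s → WeightedL2 s} {B K : ℝ≥0}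
    (hB : ∀ a, ‖F a‖ ≤ B) (hK : LipschitzWith K F) (a₀ : WeightedL2 s) :
    ∃ a : ℝ → WeightedL2 s, a 0 = a₀ ∧ IsSemilinearSol F univ a := by
  choose a ha0 ha using fun N : ℕ => exists_isSemilinearSol_Icc hB hK a₀ N
  have huniq : ∀ (N M : ℕ) (t : ℝ), |t| ≤ N → |t| ≤ M → a N t = a M t := by
    intro N M t hN hM
    have sub : ∀ N : ℕ, |t| ≤ N → uIcc 0 t ⊆ Icc (-((N : ℝ≥0) : ℝ)) ((N : ℝ≥0) : ℝ) := fun N hN => by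
      have := abs_le.1 hN
      have hN0 : (0 : ℝ) ≤ N := Nat.cast_nonneg N
      exact uIcc_subset_Icc ⟨by simp, by simp⟩ ⟨by simpa using this.1, by simpa using this.2⟩
    have := IsSemilinearSol.norm_sub_le hK.continuous ((ha N).mono (sub N hN))
      ((ha M).mono (sub M hM)) (K := K) (fun τ _ => hK.norm_sub_le _ _)
    rw [ha0, ha0, sub_self, norm_zero, zero_mul] at this
    exact sub_eq_zero.1 (norm_le_zero_iff.1 this)
  -- Solutions on different intervals agree where both are defined, so any integer at least `|t|`
  -- would select the same value.
  set b : ℝ → WeightedL2 s := fun t => a ⌈|t|⌉₊ t with hb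
  have hloc : ∀ t : ℝ, ∃ N : ℕ, |t| < N ∧ b =ᶠ[𝓝 t] a N := by
    intro t
    obtain ⟨N, hN⟩ := exists_nat_gt |t|
    refine ⟨N, hN, ?_⟩
    filter_upwards [continuous_abs.continuousAt.eventually_lt_const hN] with τ hτ
    exact huniq _ _ τ (Nat.le_ceil _) hτ.le
  have hnhds : ∀ (t : ℝ) (N : ℕ), |t| < N →
      Icc (-((N : ℝ≥0) : ℝ)) ((N : ℝ≥0) : ℝ) ∈ 𝓝 t := fun t N hN => by
    have := abs_lt.1 hN
    exact Icc_mem_nhds (by simpa using this.1) (by simpa using this.2)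
  refine ⟨b, by simp [hb, ha0], ?_, fun t _ n => ?_⟩
  · rw [continuousOn_univ, continuous_iff_continuousAt]
    intro t
    obtain ⟨N, hN, he⟩ := hloc t
    exact (((ha N).1 t (mem_of_mem_nhds (hnhds t N hN))).continuousAt (hnhds t N hN)).congr he.symm
  · obtain ⟨N, hN, he⟩ := hloc t
    have h1 := ((ha N).2 t (mem_of_mem_nhds (hnhds t N hN)) n).hasDerivAt (hnhds t N hN)
    rw [he.eq_of_nhds]
    exact (h1.congr_of_eventuallyEq (he.mono fun τ hτ => by rw [hτ])).hasDerivWithinAt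

end WeightedL2

/-! ### Pairings and the derivatives of mass and energy -/

namespace WeightedL2

theorem hasSum_inner_toLp {s : ℝ} (a b : WeightedL2 s) :
    HasSum (fun n : ℕ => (((1 + n : ℝ) ^ (2 * s) : ℝ) : ℂ) * (star (a n) * b n))
      (inner ℂ (toLpₗᵢ s a) (toLpₗᵢ s b)) := by
  refine (lp.hasSum_inner (𝕜 := ℂ) (toLpₗᵢ s a) (toLpₗᵢ s b)).congr_fun fun n => ?_
  have h : (1 + n : ℝ) ^ (2 * s) = (1 + n : ℝ) ^ s * (1 + n : ℝ) ^ s := by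
    rw [two_mul, Real.rpow_add (by positivity)]
  rw [toLp_apply, toLp_apply, RCLike.inner_apply, map_mul, Complex.conj_ofReal, h, Complex.star_def]
  push_cast; ring

theorem hasSum_inner_toLp_half (a b : WeightedL2 (1 / 2)) :
    HasSum (fun n : ℕ => (1 + n : ℂ) * (star (a n) * b n))
      (inner ℂ (toLpₗᵢ (1 / 2) a) (toLpₗᵢ (1 / 2) b)) := by
  have h := hasSum_inner_toLp a b
  simp_rw [one_add_rpow_two_mul_half] at h
  push_cast at h
  exact h

/-- The duality pairing between `l²_{1/2}` and `l²_{-1/2}`. -/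
def dualPair (p : WeightedL2 (1 / 2)) (g : WeightedL2 (-1 / 2)) : ℂ :=
  inner ℂ (toLpₗᵢ (1 / 2) p) (toLpₗᵢ (-1 / 2) g)

theorem hasSum_dualPair (p : WeightedL2 (1 / 2)) (g : WeightedL2 (-1 / 2)) :
    HasSum (fun n => star (p n) * g n) (dualPair p g) := by
  refine (lp.hasSum_inner (𝕜 := ℂ) (toLpₗᵢ (1 / 2) p) (toLpₗᵢ (-1 / 2) g)).congr_fun fun n => ?_
  have h : (((1 + n : ℝ) ^ (1 / 2 : ℝ) : ℝ) : ℂ) * (((1 + n : ℝ) ^ (-1 / 2 : ℝ) : ℝ) : ℂ) = 1 := by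
    rw [← Complex.ofReal_mul, ← Real.rpow_add (by positivity)]; norm_num
  rw [toLp_apply, toLp_apply, RCLike.inner_apply, map_mul, Complex.conj_ofReal, Complex.star_def]
  linear_combination (-((starRingEnd ℂ) (p n) * g n)) * h

theorem norm_dualPair_le (p : WeightedL2 (1 / 2)) (g : WeightedL2 (-1 / 2)) :
    ‖dualPair p g‖ ≤ ‖p‖ * ‖g‖ := by
  have := norm_inner_le_norm (𝕜 := ℂ) (toLpₗᵢ (1 / 2) p) (toLpₗᵢ (-1 / 2) g)
  rwa [LinearIsometry.norm_map, LinearIsometry.norm_map] at this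

/-- The inclusion of `l²_{1/2}` in `l²_{-1/2}`. -/
abbrev toDual (a : WeightedL2 (1 / 2)) : WeightedL2 (-1 / 2) := incl (r := -1 / 2) (by norm_num) a

theorem toDual_apply (a : WeightedL2 (1 / 2)) (n : ℕ) : toDual a n = a n := rfl

theorem norm_toDual_le (a : WeightedL2 (1 / 2)) : ‖toDual a‖ ≤ ‖a‖ := by
  refine le_of_sq_le_sq ?_ (norm_nonneg _)
  rw [norm_sq_eq, norm_sq_eq]
  refine Summable.tsum_le_tsum (fun n => ?_) (toDual a).2 a.2
  rw [toDual_apply]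
  gcongr
  · simp
  · norm_num

/-- The inclusion of `l²_{1/2}` in `l²_{-1/2}` as a continuous linear map. -/
def toDualL : WeightedL2 (1 / 2) →L[ℂ] WeightedL2 (-1 / 2) :=
  LinearMap.mkContinuous ⟨⟨toDual, fun _ _ => rfl⟩, fun _ _ => rfl⟩ 1
    (fun a => by rw [one_mul]; exact norm_toDual_le a)

theorem mass_eq_re_dualPair (a : WeightedL2 (1 / 2)) : a.mass = (dualPair a (toDual a)).re := by
  have h := Complex.hasSum_re (hasSum_dualPair a (toDual a))
  rw [← h.tsum_eq, mass]
  congr 1; ext n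
  rw [toDual_apply, ← Complex.normSq_eq_norm_sq, Complex.star_def, ← Complex.normSq_eq_conj_mul_self,
    Complex.ofReal_re]

theorem mass_le_norm_mul_norm_toDual (a : WeightedL2 (1 / 2)) : a.mass ≤ ‖a‖ * ‖toDual a‖ := by
  rw [mass_eq_re_dualPair]
  exact (Complex.re_le_norm _).trans (norm_dualPair_le _ _)

theorem hasDerivAt_toLp {s : ℝ} {e : ℝ → WeightedL2 s} {e' : WeightedL2 s} {t : ℝ}
    (h : HasDerivAt e e' t) : HasDerivAt (fun τ => toLpₗᵢ s (e τ)) (toLpₗᵢ s e') t := by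
  have h1 := (((toLpₗᵢ s).toContinuousLinearMap).restrictScalars ℝ).hasFDerivAt (x := e t)
  exact h1.comp_hasDerivAt t h

theorem hasDerivAt_toDual {e : ℝ → WeightedL2 (1 / 2)} {e' : WeightedL2 (1 / 2)} {t : ℝ}
    (h : HasDerivAt e e' t) : HasDerivAt (fun τ => toDual (e τ)) (toDual e') t := by
  have h1 := (toDualL.restrictScalars ℝ).hasFDerivAt (x := e t)
  exact h1.comp_hasDerivAt t h

theorem hasDerivAt_re {f : ℝ → ℂ} {f' : ℂ} {t : ℝ} (h : HasDerivAt f f' t) :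
    HasDerivAt (fun τ => (f τ).re) f'.re t := by
  have h1 := Complex.reCLM.hasFDerivAt (x := f t)
  exact h1.comp_hasDerivAt t h

theorem hasDerivAt_norm_sq {e : ℝ → WeightedL2 (1 / 2)} {e' : WeightedL2 (1 / 2)} {t : ℝ}
    (h : HasDerivAt e e' t) : HasDerivAt (fun τ => ‖e τ‖ ^ 2)
      (2 * (inner ℂ (toLpₗᵢ (1 / 2) (e t)) (toLpₗᵢ (1 / 2) e')).re) t := by
  have h1 := hasDerivAt_toLp h
  have h2 := hasDerivAt_re (h1.inner ℂ h1)
  have h3 : ∀ τ, (inner ℂ (toLpₗᵢ (1 / 2) (e τ)) (toLpₗᵢ (1 / 2) (e τ))).re = ‖e τ‖ ^ 2 := fun τ => by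
    have := norm_sq_eq_re_inner (𝕜 := ℂ) (toLpₗᵢ (1 / 2) (e τ))
    rw [LinearIsometry.norm_map] at this
    exact this.symm
  simp_rw [h3] at h2
  refine h2.congr_deriv ?_
  rw [Complex.add_re, ← inner_conj_symm (toLpₗᵢ (1 / 2) e'), Complex.conj_re]
  ring

theorem hasDerivAt_mass {e : ℝ → WeightedL2 (1 / 2)} {e' : WeightedL2 (1 / 2)} {t : ℝ}
    (h : HasDerivAt e e' t) : HasDerivAt (fun τ => (e τ).mass)
      (2 * (dualPair (e t) (toDual e')).re) t := by
  have h2 := hasDerivAt_re ((hasDerivAt_toLp h).inner ℂ (hasDerivAt_toLp (hasDerivAt_toDual h)))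
  have h4 : dualPair e' (toDual (e t)) = star (dualPair (e t) (toDual e')) := by
    refine (hasSum_dualPair e' (toDual (e t))).unique ?_
    refine (hasSum_dualPair (e t) (toDual e')).star.congr_fun fun n => ?_
    rw [toDual_apply, toDual_apply, star_mul', star_star, mul_comm]
  simp_rw [mass_eq_re_dualPair]
  refine HasDerivAt.congr_deriv (f := fun τ => (dualPair (e τ) (toDual (e τ))).re) h2 ?_
  change (dualPair (e t) (toDual e') + dualPair e' (toDual (e t))).re = _
  rw [h4, Complex.add_re, Complex.star_def, Complex.conj_re]
  ring

/-- The cubic nonlinearity `u ↦ |u|² u` in Hermite coefficients. -/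
def cubic (a : WeightedL2 (1 / 2)) : WeightedL2 (1 / 2) := trilinear a a a

theorem abs_quartic_sub_le (a b : WeightedL2 (1 / 2)) :
    |b.quartic - a.quartic - 4 * (dualPair (cubic a) (toDual (b - a))).re| ≤
      24 * (‖a‖ + ‖b - a‖) ^ 2 * ‖b - a‖ * ‖toDual (b - a)‖ := by
  have h := abs_quartic_add_sub_le a (b - a)
  rw [add_sub_cancel, (hasSum_star_trilinear_mul a (b - a)).unique
    (hasSum_dualPair (cubic a) (toDual (b - a)))] at h
  refine h.trans ?_
  rw [mul_assoc _ ‖b - a‖]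
  gcongr
  exact mass_le_norm_mul_norm_toDual _

/-- The cubic term lies in `l²_{1/2}`, so the linear part can be paired with a derivative that
exists only in `l²_{-1/2}`. The Taylor remainder is `o(1)` by continuity in `l²_{1/2}` times `O(τ -
t)` by differentiability in `l²_{-1/2}`. -/
theorem hasDerivAt_quartic {a : ℝ → WeightedL2 (1 / 2)} {f : WeightedL2 (-1 / 2)} {t : ℝ}
    (hc : ContinuousAt a t) (hd : HasDerivAt (fun τ => toDual (a τ)) f t) :
    HasDerivAt (fun τ => (a τ).quartic) (4 * (dualPair (cubic (a t)) f).re) t := by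
  have h1 : HasDerivAt (fun τ => 4 * (dualPair (cubic (a t)) (toDual (a τ - a t))).re)
      (4 * (dualPair (cubic (a t)) f).re) t := by
    have h2 : HasDerivAt (fun τ => toDual (a τ - a t)) f t := hd.sub_const (toDual (a t))
    have h3 := hasDerivAt_re ((hasDerivAt_const t (toLpₗᵢ (1 / 2) (cubic (a t)))).inner ℂ
      (hasDerivAt_toLp h2))
    rw [inner_zero_left, add_zero] at h3
    exact h3.const_mul 4
  set R : ℝ → ℝ := fun τ => (a τ).quartic - (a t).quartic -
    4 * (dualPair (cubic (a t)) (toDual (a τ - a t))).re with hR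
  have hR0 : R t = 0 := by
    have := abs_quartic_sub_le (a t) (a t)
    rw [sub_self (a t), norm_zero, mul_zero, zero_mul] at this
    have h2 := abs_nonpos_iff.1 this
    simp only [hR]
    rwa [sub_self (a t)]
  have hRd : HasDerivAt R 0 t := by
    rw [hasDerivAt_iff_isLittleO]
    simp only [hR0, smul_zero, sub_zero]
    have hO : (fun τ => ‖toDual (a τ - a t)‖) =O[𝓝 t] fun τ => τ - t := hd.isBigO_sub.norm_left
    have ho : (fun τ => 24 * (‖a t‖ + ‖a τ - a t‖) ^ 2 * ‖a τ - a t‖) =o[𝓝 t] fun _ => (1 : ℝ) := by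
      rw [Asymptotics.isLittleO_one_iff]
      have h2 : Tendsto (fun τ => ‖a τ - a t‖) (𝓝 t) (𝓝 0) :=
        tendsto_iff_norm_sub_tendsto_zero.1 hc
      have h3 := ((((h2.const_add ‖a t‖).pow 2).const_mul 24).mul h2)
      simpa using h3
    have := ho.mul_isBigO hO
    simp only [one_mul] at this
    refine Asymptotics.IsBigO.trans_isLittleO (Asymptotics.IsBigO.of_bound 1
      (Eventually.of_forall fun τ => ?_)) this
    rw [one_mul, Real.norm_eq_abs]
    exact (abs_quartic_sub_le (a t) (a τ)).trans (le_abs_self _)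
  have h4 := ((hRd.add h1).add_const (a t).quartic)
  rw [zero_add] at h4
  refine h4.congr_of_eventuallyEq (Eventually.of_forall fun τ => ?_)
  simp only [hR, Pi.add_apply]
  ring

/-! ### Conservation laws -/

/-- Multiplication by `n`, from `l²_{1/2}` to `l²_{-1/2}`. -/
def numberOp (a : WeightedL2 (1 / 2)) : WeightedL2 (-1 / 2) :=
  ⟨fun n => n * a n, by
    change Summable _
    refine a.summable_half.of_nonneg_of_le (fun n => by positivity) fun n => ?_
    have h1 : (1 + n : ℝ) ^ (2 * (-1 / 2) : ℝ) = (1 + n : ℝ)⁻¹ := by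
      rw [← Real.rpow_neg_one]; norm_num
    have h2 : (0 : ℝ) < 1 + n := by positivity
    rw [h1, norm_mul, Complex.norm_natCast, inv_mul_le_iff₀ h2]
    calc ((n : ℝ) * ‖a n‖) ^ 2 ≤ ((1 + n : ℝ) * ‖a n‖) ^ 2 := by gcongr; linarith
      _ = _ := by ring⟩

theorem numberOp_apply (a : WeightedL2 (1 / 2)) (n : ℕ) : numberOp a n = n * a n := rfl

theorem norm_numberOp_le (a : WeightedL2 (1 / 2)) : ‖numberOp a‖ ≤ ‖a‖ := by
  refine le_of_sq_le_sq ?_ (norm_nonneg _)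
  rw [norm_sq_eq, norm_half_sq]
  refine Summable.tsum_le_tsum (fun n => ?_) (numberOp a).2 a.summable_half
  have h1 : (1 + n : ℝ) ^ (2 * (-1 / 2) : ℝ) = (1 + n : ℝ)⁻¹ := by
    rw [← Real.rpow_neg_one]; norm_num
  have h2 : (0 : ℝ) < 1 + n := by positivity
  rw [h1, numberOp_apply, norm_mul, Complex.norm_natCast, inv_mul_le_iff₀ h2]
  calc ((n : ℝ) * ‖a n‖) ^ 2 ≤ ((1 + n : ℝ) * ‖a n‖) ^ 2 := by gcongr; linarith
    _ = _ := by ring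

theorem continuous_numberOp : Continuous numberOp := by
  have h : numberOp = LinearMap.mkContinuous (σ := RingHom.id ℂ) ⟨⟨numberOp, fun a b => by
      ext n; simp only [numberOp_apply, add_apply, mul_add]⟩, fun c a => by
      ext n; simp only [numberOp_apply, smul_apply, RingHom.id_apply]; ring⟩ 1
      (fun a => by rw [one_mul]; exact norm_numberOp_le a) := rfl
  rw [h]
  exact ContinuousLinearMap.continuous _

/-- The velocity `-i (D a + F)` in `l²_{-1/2}`. -/
def velocity (a F : WeightedL2 (1 / 2)) : WeightedL2 (-1 / 2) :=
  -Complex.I • (numberOp a + toDual F)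

theorem velocity_apply (a F : WeightedL2 (1 / 2)) (n : ℕ) :
    velocity a F n = -(Complex.I * (n * a n + F n)) := by
  rw [velocity, smul_apply, add_apply, numberOp_apply, toDual_apply]; ring

variable {F : WeightedL2 (1 / 2) → WeightedL2 (1 / 2)} {a : ℝ → WeightedL2 (1 / 2)}

theorem IsSemilinearSol.continuous_velocity (hF : Continuous F) (ha : IsSemilinearSol F univ a) :
    Continuous fun t => velocity (a t) (F (a t)) := by
  have hc := continuousOn_univ.1 ha.1
  exact ((continuous_numberOp.comp hc).add (toDualL.continuous.comp (hF.comp hc))).const_smul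
    (-Complex.I)

theorem IsSemilinearSol.hasDerivAt_toDual (hF : Continuous F) (ha : IsSemilinearSol F univ a)
    (t : ℝ) : HasDerivAt (fun τ => toDual (a τ)) (velocity (a t) (F (a t))) t := by
  refine hasDerivAt_of_coord (ha.continuous_velocity hF) (fun τ n => ?_) t
  have h := (ha.2 τ (mem_univ τ) n).hasDerivAt univ_mem
  rw [velocity_apply]
  exact h

theorem IsSemilinearSol.hasDerivAt_rot_neg (hF : Continuous F) (ha : IsSemilinearSol F univ a)
    (t : ℝ) : HasDerivAt (fun τ => rot (-τ) (a τ)) (rot (-t) (-Complex.I • F (a t))) t := by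
  have hc := continuousOn_univ.1 ha.1
  have h1 : Continuous fun t => rot (-t) (-Complex.I • F (a t)) :=
    continuous_neg.rot ((hF.comp hc).const_smul (-Complex.I))
  refine hasDerivAt_of_coord h1 (fun τ n => ?_) t
  exact (hasDerivWithinAt_rot_neg (ha.2 τ (mem_univ τ) n)).hasDerivAt univ_mem

theorem star_phase_mul (t : ℝ) (n : ℕ) : star (phase t n) * phase t n = 1 := by
  rw [Complex.star_def, ← Complex.normSq_eq_conj_mul_self, Complex.normSq_eq_norm_sq, norm_phase]
  simp

theorem inner_toLp_rot (t : ℝ) (a b : WeightedL2 (1 / 2)) :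
    inner ℂ (toLpₗᵢ (1 / 2) (rot t a)) (toLpₗᵢ (1 / 2) (rot t b)) =
      inner ℂ (toLpₗᵢ (1 / 2) a) (toLpₗᵢ (1 / 2) b) := by
  refine (hasSum_inner_toLp_half _ _).unique ?_
  refine (hasSum_inner_toLp_half a b).congr_fun fun n => ?_
  rw [rot_apply, rot_apply, star_mul']
  linear_combination ((1 + n : ℂ) * (star (a n) * b n)) * star_phase_mul t n

theorem dualPair_rot (t : ℝ) (a b : WeightedL2 (1 / 2)) :
    dualPair (rot t a) (toDual (rot t b)) = dualPair a (toDual b) := by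
  refine (hasSum_dualPair _ _).unique ?_
  refine (hasSum_dualPair a (toDual b)).congr_fun fun n => ?_
  rw [toDual_apply, toDual_apply, rot_apply, rot_apply, star_mul']
  linear_combination (star (a n) * b n) * star_phase_mul t n

/-- The curve itself need not be differentiable in `l²_{1/2}`, but its rotation is and has the same
norm; hence only the nonlinearity contributes. -/
theorem IsSemilinearSol.hasDerivAt_norm_sq (hF : Continuous F) (ha : IsSemilinearSol F univ a)
    (t : ℝ) : HasDerivAt (fun τ => ‖a τ‖ ^ 2) (2 * (inner ℂ (toLpₗᵢ (1 / 2) (a t))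
      (toLpₗᵢ (1 / 2) (-Complex.I • F (a t)))).re) t := by
  have h := WeightedL2.hasDerivAt_norm_sq (ha.hasDerivAt_rot_neg hF t)
  rw [inner_toLp_rot] at h
  simpa only [norm_rot] using h

theorem IsSemilinearSol.hasDerivAt_mass (hF : Continuous F) (ha : IsSemilinearSol F univ a)
    (t : ℝ) : HasDerivAt (fun τ => (a τ).mass)
      (2 * (dualPair (a t) (toDual (-Complex.I • F (a t)))).re) t := by
  have h := WeightedL2.hasDerivAt_mass (ha.hasDerivAt_rot_neg hF t)
  rw [dualPair_rot] at h
  simpa only [mass_rot] using h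

/-- The energy (twice the Hamiltonian plus the mass). -/
def energy (σ : ℝ) (a : WeightedL2 (1 / 2)) : ℝ := ‖a‖ ^ 2 + σ / 2 * a.quartic

theorem IsSemilinearSol.hasDerivAt_energy (hF : Continuous F) (ha : IsSemilinearSol F univ a)
    (σ t : ℝ) : HasDerivAt (fun τ => energy σ (a τ))
      (2 * (inner ℂ (toLpₗᵢ (1 / 2) (a t)) (toLpₗᵢ (1 / 2) (-Complex.I • F (a t)))).re +
        σ / 2 * (4 * (dualPair (cubic (a t)) (velocity (a t) (F (a t)))).re)) t :=
  (ha.hasDerivAt_norm_sq hF t).add ((hasDerivAt_quartic (continuousOn_univ.1 ha.1).continuousAt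
    (ha.hasDerivAt_toDual hF t)).const_mul (σ / 2))

/-- The pairing is `-iσ` times the real number `∫ |u|⁴`, so the mass is conserved. -/
theorem re_dualPair_cubic (σ : ℝ) (a : WeightedL2 (1 / 2)) :
    (dualPair a (toDual (-Complex.I • ((σ : ℂ) • cubic a)))).re = 0 := by
  have h1 := (hasSum_star_trilinear_mul_self a).star.mul_left (-Complex.I * σ)
  have h2 : dualPair a (toDual (-Complex.I • ((σ : ℂ) • cubic a))) =
      -Complex.I * σ * star (a.quartic : ℂ) := by
    refine (hasSum_dualPair _ _).unique (h1.congr_fun fun n => ?_)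
    rw [toDual_apply, smul_apply, smul_apply, star_mul', star_star, cubic]
    ring
  rw [h2, Complex.star_def, Complex.conj_ofReal]
  simp

theorem energy_balance (σ : ℝ) (a : WeightedL2 (1 / 2)) :
    2 * (inner ℂ (toLpₗᵢ (1 / 2) a) (toLpₗᵢ (1 / 2) (-Complex.I • ((σ : ℂ) • cubic a)))).re +
      σ / 2 * (4 * (dualPair (cubic a) (velocity a ((σ : ℂ) • cubic a))).re) = 0 := by
  -- With weights `1 + n`, `X` is the pairing of the cubic term with `D a` plus the real quartic.
  -- The norm contributes `-2σ Im X`, the quartic part `2σ Im X`, and every other term is purely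
  -- imaginary.
  set X : ℂ := inner ℂ (toLpₗᵢ (1 / 2) (cubic a)) (toLpₗᵢ (1 / 2) a) with hX
  have e1 : inner ℂ (toLpₗᵢ (1 / 2) a) (toLpₗᵢ (1 / 2) (-Complex.I • ((σ : ℂ) • cubic a))) =
      -Complex.I * (σ * star X) := by
    rw [map_smul, map_smul, inner_smul_right, inner_smul_right, hX, Complex.star_def,
      inner_conj_symm]
  have e2 : dualPair (cubic a) (velocity a ((σ : ℂ) • cubic a)) =
      -Complex.I * (X - (a.quartic : ℂ) + σ * dualPair (cubic a) (toDual (cubic a))) := by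
    refine (hasSum_dualPair _ _).unique ?_
    refine (((hasSum_inner_toLp_half (cubic a) a).sub (hasSum_star_trilinear_mul_self a)).add
      ((hasSum_dualPair (cubic a) (toDual (cubic a))).mul_left (σ : ℂ))).mul_left (-Complex.I)
      |>.congr_fun fun n => ?_
    rw [velocity_apply, toDual_apply, smul_apply, cubic]
    ring
  have e3 : (dualPair (cubic a) (toDual (cubic a))).im = 0 := by
    have h := Complex.hasSum_im (hasSum_dualPair (cubic a) (toDual (cubic a)))
    refine h.unique ?_
    have h0 : ∀ n, (star (cubic a n) * toDual (cubic a) n).im = 0 := fun n => by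
      rw [toDual_apply, Complex.star_def, ← Complex.normSq_eq_conj_mul_self, Complex.ofReal_im]
    simp_rw [h0]
    exact hasSum_zero
  rw [e1, e2]
  simp [e3]
  ring

end WeightedL2

/-! ### The global flow -/

namespace WeightedL2

open scoped NNReal

theorem norm_cubic_le (a : WeightedL2 (1 / 2)) : ‖cubic a‖ ≤ 13 * ‖a‖ ^ 3 :=
  (norm_trilinear_le a a a).trans_eq (by ring)

theorem norm_cubic_sub_le {a b : WeightedL2 (1 / 2)} {R : ℝ} (ha : ‖a‖ ≤ R) (hb : ‖b‖ ≤ R) :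
    ‖cubic a - cubic b‖ ≤ 39 * R ^ 2 * ‖a - b‖ := by
  have hR : 0 ≤ R := (norm_nonneg a).trans ha
  have e : cubic a - cubic b =
      trilinear (a - b) a a + trilinear b (a - b) a + trilinear b b (a - b) := by
    rw [trilinear_sub_left, trilinear_sub_middle, trilinear_sub_right, cubic, cubic]
    abel
  have h1 : ‖trilinear (a - b) a a‖ ≤ 13 * ‖a - b‖ * R * R :=
    (norm_trilinear_le _ _ _).trans (by gcongr)
  have h2 : ‖trilinear b (a - b) a‖ ≤ 13 * R * ‖a - b‖ * R :=
    (norm_trilinear_le _ _ _).trans (by gcongr)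
  have h3 : ‖trilinear b b (a - b)‖ ≤ 13 * R * R * ‖a - b‖ :=
    (norm_trilinear_le _ _ _).trans (by gcongr)
  rw [e]
  refine (norm_add₃_le).trans ?_
  linarith

/-- The nonlinearity of the discrete system. -/
def nonlin (σ : ℝ) (a : WeightedL2 (1 / 2)) : WeightedL2 (1 / 2) := (σ : ℂ) • cubic a

theorem norm_nonlin_sub_le (σ : ℝ) {a b : WeightedL2 (1 / 2)} {R : ℝ} (ha : ‖a‖ ≤ R)
    (hb : ‖b‖ ≤ R) : ‖nonlin σ a - nonlin σ b‖ ≤ |σ| * (39 * R ^ 2) * ‖a - b‖ := by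
  rw [nonlin, nonlin, ← smul_sub, norm_smul, Complex.norm_real, Real.norm_eq_abs, mul_assoc]
  exact mul_le_mul_of_nonneg_left (norm_cubic_sub_le ha hb) (abs_nonneg σ)

theorem continuous_nonlin (σ : ℝ) : Continuous (nonlin σ) := by
  refine continuous_iff_continuousAt.2 fun a => ?_
  refine ContinuousOn.continuousAt (s := Metric.closedBall 0 (‖a‖ + 1)) ?_
    (Metric.closedBall_mem_nhds_of_mem (by simp))
  refine (LipschitzOnWith.of_dist_le_mul (K := Real.toNNReal (|σ| * (39 * (‖a‖ + 1) ^ 2)))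
    fun x hx y hy => ?_).continuousOn
  rw [dist_eq_norm, dist_eq_norm, Real.coe_toNNReal _ (by positivity)]
  exact norm_nonlin_sub_le σ (mem_closedBall_zero_iff.1 hx) (mem_closedBall_zero_iff.1 hy)

/-- A cutoff: `1` for `r ≤ M` and `0` for `r ≥ M + 1`. -/
def cutoff (M r : ℝ) : ℝ := max 0 (min 1 (M + 1 - r))

theorem cutoff_nonneg (M r : ℝ) : 0 ≤ cutoff M r := le_max_left _ _

theorem cutoff_le_one (M r : ℝ) : cutoff M r ≤ 1 := max_le zero_le_one (min_le_left _ _)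

theorem cutoff_of_le {M r : ℝ} (h : r ≤ M) : cutoff M r = 1 := by
  rw [cutoff, min_eq_left (by linarith), max_eq_right zero_le_one]

theorem cutoff_of_ge {M r : ℝ} (h : M + 1 ≤ r) : cutoff M r = 0 := by
  rw [cutoff, max_eq_left]
  exact (min_le_right _ _).trans (by linarith)

theorem abs_cutoff_sub_le (M r r' : ℝ) : |cutoff M r - cutoff M r'| ≤ |r - r'| := by
  have h1 : |cutoff M r - cutoff M r'| ≤ |min 1 (M + 1 - r) - min 1 (M + 1 - r')| := by
    simpa [cutoff] using abs_max_sub_max_le_max 0 (min 1 (M + 1 - r)) 0 (min 1 (M + 1 - r'))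
  have h2 : |min 1 (M + 1 - r) - min 1 (M + 1 - r')| ≤ |M + 1 - r - (M + 1 - r')| := by
    simpa using abs_min_sub_min_le_max 1 (M + 1 - r) 1 (M + 1 - r')
  refine (h1.trans h2).trans_eq ?_
  rw [sub_sub_sub_cancel_left, abs_sub_comm]

/-- The nonlinearity, cut off outside the ball of radius `M`. -/
def truncated (σ M : ℝ) (a : WeightedL2 (1 / 2)) : WeightedL2 (1 / 2) :=
  (cutoff M ‖a‖ : ℂ) • nonlin σ a

theorem truncated_of_le (σ : ℝ) {M : ℝ} {a : WeightedL2 (1 / 2)} (h : ‖a‖ ≤ M) :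
    truncated σ M a = nonlin σ a := by
  rw [truncated, cutoff_of_le h, Complex.ofReal_one, one_smul]

theorem truncated_of_ge (σ : ℝ) {M : ℝ} {a : WeightedL2 (1 / 2)} (h : M + 1 ≤ ‖a‖) :
    truncated σ M a = 0 := by
  rw [truncated, cutoff_of_ge h, Complex.ofReal_zero, zero_smul]

theorem norm_nonlin_le (σ : ℝ) {a : WeightedL2 (1 / 2)} {R : ℝ} (h : ‖a‖ ≤ R) :
    ‖nonlin σ a‖ ≤ |σ| * (13 * R ^ 3) := by
  rw [nonlin, norm_smul, Complex.norm_real, Real.norm_eq_abs]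
  refine mul_le_mul_of_nonneg_left ((norm_cubic_le a).trans ?_) (abs_nonneg σ)
  gcongr

theorem norm_truncated_le (σ : ℝ) {M : ℝ} (hM : 0 ≤ M) (a : WeightedL2 (1 / 2)) :
    ‖truncated σ M a‖ ≤ |σ| * (13 * (M + 1) ^ 3) := by
  rcases le_total ‖a‖ (M + 1) with h | h
  · rw [truncated, norm_smul, Complex.norm_real, Real.norm_of_nonneg (cutoff_nonneg _ _)]
    exact (mul_le_of_le_one_left (norm_nonneg _) (cutoff_le_one _ _)).trans (norm_nonlin_le σ h)
  · rw [truncated_of_ge σ h, norm_zero]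
    positivity

/-- The difference of the cutoffs multiplies `nonlin σ b`, so only `b` has to lie in the ball; if
`a` lies outside, its cutoff removes the other term. -/
theorem norm_truncated_sub_le_of_le (σ : ℝ) {M : ℝ} (hM : 0 ≤ M) (a : WeightedL2 (1 / 2))
    {b : WeightedL2 (1 / 2)} (hb : ‖b‖ ≤ M + 1) : ‖truncated σ M a - truncated σ M b‖ ≤
      |σ| * (39 * (M + 1) ^ 2 + 13 * (M + 1) ^ 3) * ‖a - b‖ := by
  have hcut : |cutoff M ‖a‖ - cutoff M ‖b‖| ≤ ‖a - b‖ :=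
    (abs_cutoff_sub_le _ _ _).trans (abs_norm_sub_norm_le a b)
  have h2 : ‖((cutoff M ‖a‖ - cutoff M ‖b‖ : ℝ) : ℂ) • nonlin σ b‖ ≤
      ‖a - b‖ * (|σ| * (13 * (M + 1) ^ 3)) := by
    rw [norm_smul, Complex.norm_real, Real.norm_eq_abs]
    exact mul_le_mul hcut (norm_nonlin_le σ hb) (norm_nonneg _) (norm_nonneg _)
  have h1 : ‖(cutoff M ‖a‖ : ℂ) • (nonlin σ a - nonlin σ b)‖ ≤
      |σ| * (39 * (M + 1) ^ 2) * ‖a - b‖ := by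
    rw [norm_smul, Complex.norm_real, Real.norm_of_nonneg (cutoff_nonneg _ _)]
    rcases le_total ‖a‖ (M + 1) with ha | ha
    · exact (mul_le_of_le_one_left (norm_nonneg _) (cutoff_le_one _ _)).trans
        (norm_nonlin_sub_le σ ha hb)
    · rw [cutoff_of_ge ha, zero_mul]
      positivity
  have e : truncated σ M a - truncated σ M b = (cutoff M ‖a‖ : ℂ) • (nonlin σ a - nonlin σ b) +
      ((cutoff M ‖a‖ - cutoff M ‖b‖ : ℝ) : ℂ) • nonlin σ b := by
    rw [truncated, truncated, smul_sub, Complex.ofReal_sub, sub_smul]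
    abel
  rw [e]
  refine (norm_add_le _ _).trans ?_
  linarith

theorem norm_truncated_sub_le (σ : ℝ) {M : ℝ} (hM : 0 ≤ M) (a b : WeightedL2 (1 / 2)) :
    ‖truncated σ M a - truncated σ M b‖ ≤
      |σ| * (39 * (M + 1) ^ 2 + 13 * (M + 1) ^ 3) * ‖a - b‖ := by
  rcases le_total ‖b‖ (M + 1) with hb | hb
  · exact norm_truncated_sub_le_of_le σ hM a hb
  rcases le_total ‖a‖ (M + 1) with ha | ha
  · rw [norm_sub_rev, norm_sub_rev a]
    exact norm_truncated_sub_le_of_le σ hM b ha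
  · rw [truncated_of_ge σ ha, truncated_of_ge σ hb, sub_zero, norm_zero]
    positivity

theorem exists_isSemilinearSol_truncated (σ : ℝ) {M : ℝ} (hM : 0 ≤ M) (a₀ : WeightedL2 (1 / 2)) :
    ∃ a, a 0 = a₀ ∧ IsSemilinearSol (truncated σ M) univ a := by
  refine exists_isSemilinearSol (B := Real.toNNReal (|σ| * (13 * (M + 1) ^ 3)))
    (K := Real.toNNReal (|σ| * (39 * (M + 1) ^ 2 + 13 * (M + 1) ^ 3))) (fun a => ?_)
    (LipschitzWith.of_dist_le_mul fun a b => ?_) a₀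
  · rw [Real.coe_toNNReal _ (by positivity)]
    exact norm_truncated_le σ hM a
  · rw [dist_eq_norm, dist_eq_norm, Real.coe_toNNReal _ (by positivity)]
    exact norm_truncated_sub_le σ hM a b

theorem continuous_truncated (σ M : ℝ) : Continuous (truncated σ M) := by
  have h : Continuous fun a : WeightedL2 (1 / 2) => (cutoff M ‖a‖ : ℂ) := by
    unfold cutoff; fun_prop
  exact h.smul (continuous_nonlin σ)

/-- An a priori bound for solutions with initial data of norm at most `R`. -/
def growthBound (σ R : ℝ) : ℝ := 1 + R ^ 2 + 2 * |σ| * R ^ 4 + 2 * |σ| * R ^ 3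

theorem growthBound_pos (σ : ℝ) {R : ℝ} (hR : 0 ≤ R) : 0 < growthBound σ R := by
  unfold growthBound; positivity

theorem quartic_le_of_mass_le {a : WeightedL2 (1 / 2)} {R : ℝ} (hR : 0 ≤ R) (h : a.mass ≤ R ^ 2) :
    a.quartic ≤ 4 * R ^ 3 * ‖a‖ := by
  have h1 : √a.mass ≤ R := (Real.sqrt_le_left hR).2 h
  refine a.quartic_le.trans ?_
  calc 4 * (√a.mass * ‖a‖) * a.mass ≤ 4 * (R * ‖a‖) * R ^ 2 := by
        gcongr
        exact a.mass_nonneg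
    _ = _ := by ring

theorem norm_le_growthBound {σ R : ℝ} {a a₀ : WeightedL2 (1 / 2)} (h0 : ‖a₀‖ ≤ R)
    (hm : a.mass = a₀.mass) (he : energy σ a = energy σ a₀) : ‖a‖ ≤ growthBound σ R := by
  have hR : 0 ≤ R := (norm_nonneg _).trans h0
  have hm0 : a₀.mass ≤ R ^ 2 := a₀.mass_le.trans (by gcongr)
  have hq0 : a₀.quartic ≤ 4 * R ^ 4 := (quartic_le_of_mass_le hR hm0).trans (by
    calc 4 * R ^ 3 * ‖a₀‖ ≤ 4 * R ^ 3 * R := by gcongr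
      _ = _ := by ring)
  have hq : a.quartic ≤ 4 * R ^ 3 * ‖a‖ := quartic_le_of_mass_le hR (hm ▸ hm0)
  have h1 : σ * a₀.quartic ≤ |σ| * (4 * R ^ 4) :=
    mul_le_mul (le_abs_self σ) hq0 a₀.quartic_nonneg (abs_nonneg σ)
  have h2 : -σ * a.quartic ≤ |σ| * (4 * R ^ 3 * ‖a‖) :=
    mul_le_mul (neg_le_abs σ) hq a.quartic_nonneg (abs_nonneg σ)
  have h3 : ‖a₀‖ ^ 2 ≤ R ^ 2 := by gcongr
  have h4 : ‖a‖ ^ 2 ≤ R ^ 2 + 2 * |σ| * R ^ 4 + 2 * |σ| * R ^ 3 * ‖a‖ := by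
    simp only [energy] at he
    linarith
  -- From `‖a‖² ≤ A + B‖a‖` with `A, B ≥ 0` follows `‖a‖ ≤ 1 + A + B`, which is the form of
  -- `growthBound`.
  by_contra! hlt
  have hA : 0 ≤ R ^ 2 + 2 * |σ| * R ^ 4 := by positivity
  have hB : 0 ≤ 2 * |σ| * R ^ 3 := by positivity
  unfold growthBound at hlt
  have h5 : 1 ≤ ‖a‖ := by linarith
  have h6 := mul_lt_mul_of_pos_right hlt (by linarith : 0 < ‖a‖)
  have h7 := mul_le_mul_of_nonneg_left h5 hA
  linarith

theorem _root_.eq_of_hasDerivAt_eq_zero_on_ball {f f' : ℝ → ℝ} (hf : ∀ t, HasDerivAt f (f' t) t)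
    {s r : ℝ} (h : ∀ t ∈ Metric.ball s r, f' t = 0) {t : ℝ} (ht : t ∈ Metric.ball s r) :
    f t = f s := by
  have hr : 0 < r := Metric.pos_of_mem_ball ht
  refine (convex_ball s r).is_const_of_fderivWithin_eq_zero (𝕜 := ℝ)
    (fun x _ => (hf x).differentiableAt.differentiableWithinAt) (fun x hx => ?_) ht
    (Metric.mem_ball_self hr)
  rw [fderivWithin_of_isOpen Metric.isOpen_ball hx, (hf x).hasFDerivAt.fderiv, h x hx]
  ext; simp

/-- A continuity argument for the truncated flow. At times where mass and energy have their initial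
values the norm is strictly below `M`, so the cutoff is inactive nearby and both stay constant
there. The set of such times is open, closed and contains `0`. -/
theorem exists_global_solution (σ : ℝ) (a₀ : WeightedL2 (1 / 2)) : ∃ a : ℝ → WeightedL2 (1 / 2),
    a 0 = a₀ ∧ IsSemilinearSol (nonlin σ) univ a ∧ ∀ t, ‖a t‖ ≤ growthBound σ ‖a₀‖ := by
  set M := growthBound σ ‖a₀‖ + 1 with hM
  have hpos := growthBound_pos σ (norm_nonneg a₀)
  obtain ⟨a, ha0, ha⟩ := exists_isSemilinearSol_truncated σ (M := M) (by positivity) a₀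
  have hF := continuous_truncated σ M
  have hc : Continuous a := continuousOn_univ.1 ha.1
  have hdm := ha.hasDerivAt_mass hF
  have hde := ha.hasDerivAt_energy hF σ
  have hcm : Continuous fun t => (a t).mass :=
    continuous_iff_continuousAt.2 fun t => (hdm t).continuousAt
  have hce : Continuous fun t => energy σ (a t) :=
    continuous_iff_continuousAt.2 fun t => (hde t).continuousAt
  set S : Set ℝ := {t | (a t).mass = a₀.mass ∧ energy σ (a t) = energy σ a₀} with hS
  have hbound : ∀ t ∈ S, ‖a t‖ ≤ growthBound σ ‖a₀‖ := fun t ht =>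
    norm_le_growthBound le_rfl ht.1 ht.2
  have hclosed : IsClosed S :=
    (isClosed_eq hcm continuous_const).inter (isClosed_eq hce continuous_const)
  have hopen : IsOpen S := by
    refine Metric.isOpen_iff.2 fun s hs => ?_
    have hlt : ‖a s‖ < M := by linarith [hbound s hs]
    obtain ⟨r, hr, hball⟩ := Metric.eventually_nhds_iff_ball.1
      ((hc.norm.tendsto s).eventually (gt_mem_nhds hlt))
    refine ⟨r, hr, fun t ht => ⟨?_, ?_⟩⟩
    · have h := eq_of_hasDerivAt_eq_zero_on_ball hdm (fun τ hτ => by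
        rw [truncated_of_le σ (hball τ hτ).le, nonlin, re_dualPair_cubic, mul_zero]) ht
      exact h.trans hs.1
    · have h := eq_of_hasDerivAt_eq_zero_on_ball hde (fun τ hτ => by
        rw [truncated_of_le σ (hball τ hτ).le, nonlin, energy_balance]) ht
      exact h.trans hs.2
  have huniv : S = univ := IsClopen.eq_univ ⟨hclosed, hopen⟩ ⟨0, by simp [hS, ha0]⟩
  have hb : ∀ t, ‖a t‖ ≤ growthBound σ ‖a₀‖ := fun t => hbound t (huniv ▸ mem_univ t)
  refine ⟨a, ha0, ⟨ha.1, fun t ht n => ?_⟩, hb⟩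
  have h := ha.2 t ht n
  rw [truncated_of_le σ (by linarith [hb t])] at h
  exact h

/-! ### Equivalence with the discrete system, uniqueness and continuous dependence -/

theorem isSolutionOn_iff {σ : ℝ} {I : Set ℝ} {a : ℝ → WeightedL2 (1 / 2)} :
    IsSolutionOn σ I a ↔ IsSemilinearSol (nonlin σ) I a := by
  refine and_congr_right fun _ => forall₂_congr fun t _ => forall_congr' fun n => ⟨?_, fun h => ?_⟩
  · rintro ⟨d, S, hd, hS, h⟩
    have hS' : S = cubic (a t) n := hS.unique (hasSum_hermiteK_mul (a t) (a t) (a t) n)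
    refine hd.congr_deriv ?_
    rw [nonlin, smul_apply, ← hS', ← h, ← mul_assoc, Complex.I_mul_I]
    ring
  · refine ⟨_, _, h, hasSum_hermiteK_mul (a t) (a t) (a t) n, ?_⟩
    rw [nonlin, smul_apply, cubic]
    linear_combination (-(n * a t n + σ * trilinear (a t) (a t) (a t) n)) * Complex.I_mul_I

theorem IsSemilinearSol.norm_sub_le_nonlin {σ t R : ℝ} {a b : ℝ → WeightedL2 (1 / 2)}
    (ha : IsSemilinearSol (nonlin σ) (uIcc 0 t) a) (hb : IsSemilinearSol (nonlin σ) (uIcc 0 t) b)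
    (hRa : ∀ τ ∈ uIcc 0 t, ‖a τ‖ ≤ R) (hRb : ∀ τ ∈ uIcc 0 t, ‖b τ‖ ≤ R) :
    ‖a t - b t‖ ≤ ‖a 0 - b 0‖ * Real.exp (|σ| * (39 * R ^ 2) * |t|) :=
  ha.norm_sub_le (continuous_nonlin σ) hb fun τ hτ =>
    norm_nonlin_sub_le σ (hRa τ hτ) (hRb τ hτ)

/-- No a priori bound is needed: continuous curves are bounded on the compact interval between `0`
and `t`, where the nonlinearity is therefore Lipschitz. -/
theorem IsSemilinearSol.eq_of_initial_eq {σ : ℝ} {I : Set ℝ} (hI : I.OrdConnected) (h0 : (0 : ℝ) ∈ I)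
    {a b : ℝ → WeightedL2 (1 / 2)} (ha : IsSemilinearSol (nonlin σ) I a)
    (hb : IsSemilinearSol (nonlin σ) I b) (hab : a 0 = b 0) {t : ℝ} (ht : t ∈ I) : a t = b t := by
  have hsub : uIcc 0 t ⊆ I := hI.uIcc_subset h0 ht
  replace ha := ha.mono hsub
  replace hb := hb.mono hsub
  obtain ⟨A, hA⟩ := isCompact_uIcc.exists_bound_of_continuousOn ha.1
  obtain ⟨B, hB⟩ := isCompact_uIcc.exists_bound_of_continuousOn hb.1
  have h := ha.norm_sub_le_nonlin hb (R := max A B) (fun τ hτ => (hA τ hτ).trans (le_max_left _ _))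
    (fun τ hτ => (hB τ hτ).trans (le_max_right _ _))
  rw [hab, sub_self, norm_zero, zero_mul] at h
  exact sub_eq_zero.1 (norm_le_zero_iff.1 h)

theorem growthBound_mono (σ : ℝ) {R R' : ℝ} (hR : 0 ≤ R) (h : R ≤ R') :
    growthBound σ R ≤ growthBound σ R' := by
  unfold growthBound
  gcongr

/-- Initial data within distance one of `a₀` share one growth bound, hence one Grönwall constant;
this is combined with continuity in time of the single orbit of `a₀`. -/
theorem continuous_flow {σ : ℝ} {Φ : ℝ → WeightedL2 (1 / 2) → WeightedL2 (1 / 2)}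
    (h0 : ∀ a, Φ 0 a = a) (hsol : ∀ a, IsSemilinearSol (nonlin σ) univ fun t => Φ t a)
    (hb : ∀ a t, ‖Φ t a‖ ≤ growthBound σ ‖a‖) :
    Continuous fun p : ℝ × WeightedL2 (1 / 2) => Φ p.1 p.2 := by
  refine continuous_iff_continuousAt.2 fun ⟨t₀, a₀⟩ => ?_
  set K := |σ| * (39 * growthBound σ (‖a₀‖ + 1) ^ 2) with hK
  have h1 : ContinuousAt (fun p : ℝ × WeightedL2 (1 / 2) => Φ p.1 a₀) (t₀, a₀) :=
    ((continuousOn_univ.1 (hsol a₀).1).comp continuous_fst).continuousAt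
  have h2 : Tendsto (fun p : ℝ × WeightedL2 (1 / 2) => Φ p.1 p.2 - Φ p.1 a₀) (𝓝 (t₀, a₀)) (𝓝 0) := by
    have hlim : Tendsto (fun p : ℝ × WeightedL2 (1 / 2) => ‖p.2 - a₀‖ * Real.exp (K * |p.1|))
        (𝓝 (t₀, a₀)) (𝓝 0) := by
      have hc : Continuous fun p : ℝ × WeightedL2 (1 / 2) =>
          ‖p.2 - a₀‖ * Real.exp (K * |p.1|) := by fun_prop
      simpa using hc.tendsto (t₀, a₀)
    refine squeeze_zero_norm' ?_ hlim
    have hnear : ∀ᶠ p : ℝ × WeightedL2 (1 / 2) in 𝓝 (t₀, a₀), ‖p.2‖ < ‖a₀‖ + 1 :=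
      (continuous_snd.norm.tendsto (t₀, a₀)).eventually (gt_mem_nhds (by simp))
    filter_upwards [hnear] with p hp
    have h := ((hsol p.2).mono (subset_univ (uIcc 0 p.1))).norm_sub_le_nonlin
      ((hsol a₀).mono (subset_univ _)) (R := growthBound σ (‖a₀‖ + 1))
      (fun τ _ => (hb _ τ).trans (growthBound_mono σ (norm_nonneg _) hp.le))
      (fun τ _ => (hb _ τ).trans (growthBound_mono σ (norm_nonneg _) (by simp)))
    simpa only [h0] using h
  have h3 := h2.add h1
  simp only [sub_add_cancel, zero_add] at h3
  exact h3

theorem isGloballyWellPosed (σ : ℝ) : IsGloballyWellPosed σ := by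
  choose Ψ h0 hsol hb using exists_global_solution σ
  refine ⟨fun t a => Ψ a t, continuous_flow h0 hsol hb, fun a₀ =>
    ⟨h0 a₀, isSolutionOn_iff.2 (hsol a₀), ?_, fun I b hI h0I hbI hb0 t ht => ?_⟩⟩
  · have hd := (hsol a₀).hasDerivAt_toDual (continuous_nonlin σ)
    have hdc := (hsol a₀).continuous_velocity (continuous_nonlin σ)
    refine contDiff_one_iff_deriv.2 ⟨fun t => (hd t).differentiableAt, ?_⟩
    exact hdc.congr fun t => (hd t).deriv.symm
  · exact (isSolutionOn_iff.1 hbI).eq_of_initial_eq hI h0I ((hsol a₀).mono (subset_univ I))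
      (hb0.trans (h0 a₀).symm) ht

end WeightedL2

theorem theorem2 (σ : ℝ) :
    -- the Hermite functions are complete: every `u ∈ L²(ℝ)` is the sum of its Hermite series
    (∀ u : ℝ → ℂ, MemLp u 2 → IsHermiteExpansion (hermiteCoeff u) u) ∧
    -- `u` lies in the energy space if and only if its coefficients lie in `l²_{1/2}(ℕ)`
    (∀ u : ℝ → ℂ, MemLp u 2 →
      (MemEnergySpace u ↔ MemWeightedL2 (1 / 2) (hermiteCoeff u))) ∧
    -- every element of `l²_{1/2}(ℕ)` is the coefficient sequence of an element of that space
    (∀ a : WeightedL2 (1 / 2), ∃ u : ℝ → ℂ, MemEnergySpace u ∧ hermiteCoeff u = a) ∧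
    -- the two norms agree up to the factor `√2`
    (∀ (u v : ℝ → ℂ) (a : WeightedL2 (1 / 2)), MemEnergySpace u → IsWeakDeriv u v →
      hermiteCoeff u = a → ∫ x, (‖v x‖ ^ 2 + (x ^ 2 + 1) * ‖u x‖ ^ 2) = 2 * ‖a‖ ^ 2) ∧
    -- the discrete system is globally well-posed in `l²_{1/2}(ℕ)`
    IsGloballyWellPosed σ :=
  ⟨fun _ hu => isHermiteExpansion_hermiteCoeff hu, fun _ hu => memEnergySpace_iff hu,
    exists_memEnergySpace, fun _ _ _ hu hv ha => integral_energy_eq hu hv ha,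
    WeightedL2.isGloballyWellPosed σ⟩

end
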